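/- Let $G_{\mathbb R}$ be a connected simple linear real Lie group with Lie algebra $\mathfrak g_{\mathbb R}$, and let $G$ be its complexification, with Lie algebra $\mathfrak g=\mathfrak g_{\mathbb R}\oplus i\,\mathfrak g_{\mathbb R}$; concretely, $G_{\mathbb R}\subset G\subset \mathrm{GL}_n(\mathbb C)$ are the connected Lie subgroups with Lie algebras $\mathfrak g_{\mathbb R}$ and $\mathfrak g$, where $\mathfrak g_{\mathbb R}\subset\mathfrak{gl}_n(\mathbb C)$ is a simple real Lie subalgebra with $\mathfrak g_{\mathbb R}\cap i\,\mathfrak g_{\mathbb R}=0$. Both groups act by the adjoint action $g\cdot x=gxg^{-1}$. For $x\in\mathfrak g_{\mathbb R}$ put $$\lim_{\nu\to0^+}G_{\mathbb R}\cdot(\nu x):=\bigcap_{\epsilon>0}\overline{\bigcup_{\nu\in(0,\epsilon)}G_{\mathbb R}\cdot(\nu x)} .$$ For a nonzero nilpotent element $e\in\mathfrak g_{\mathbb R}$ put $\mathcal L(e):=\lim_{\nu\to0^+}G_{\mathbb R}\cdot(\nu h)$, where $\{h,e,f\}\subset\mathfrak g_{\mathbb R}$ is an $\mathfrak{sl}_2$-triple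 containing $e$, i.e. $h\neq0$, $[h,e]=2e$, $[h,f]=-2f$, $[e,f]=h$; put $\mathcal L(0):=\{0\}$. A nilpotent element $e\in\mathfrak g_{\mathbb R}$ is called even if $e=0$ or $e$ belongs to such a triple for which all eigenvalues of $\mathrm{ad}(h)$ on $\mathfrak g$ are even integers. The real forms of $G\cdot e$ are the $G_{\mathbb R}$-orbits contained in $(G\cdot e)\cap\mathfrak g_{\mathbb R}$. Theorem. Let $e\in\mathfrak g_{\mathbb R}$ be an even nilpotent element. Then $\mathcal L(e)=\lim_{\nu\to0^+}G_{\mathbb R}\cdot(\nu h)$ for every $\mathfrak{sl}_2$-triple $\{h,e,f\}\subset\mathfrak g_{\mathbb R}$ containing $e$, and $$\mathcal L(e)=\overline{(G\cdot e)\cap\mathfrak g_{\mathbb R}}.$$ Moreover $G\cdot e$ has only finitely many real forms $\mathcal O_1,\dots,\mathcal O_r$, and $$\mathcal L(e)=\overline{\mathcal O_1}\cup\dots\cup\overline{\mathcal O_r}.$$ All closures are in the usual (Euclidean) topology. -/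

import Mathlib

open scoped MatrixGroups

-- The Lie bracket of matrices is the commutator.
attribute [local instance 100] LieRing.ofAssociativeRing

noncomputable section

/-- The algebra of complex `n × n` matrices, i.e. the Lie algebra of `GL(n, ℂ)`. -/
abbrev CMat (n : ℕ) : Type := Matrix (Fin n) (Fin n) ℂ

/-- `H` is a connected Lie subgroup of `GL(n, ℂ)` with (real) Lie algebra `𝔥`: the space `𝔥`
consists of the matrices `X` whose one-parameter group `t ↦ exp (t X)` stays in `H`, and every
element of `H` is a finite product of exponentials of elements of `𝔥`. -/
structure IsConnectedLieSubgroup {n : ℕ} (H : Subgroup (GL (Fin n) ℂ))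
    (𝔥 : Submodule ℝ (CMat n)) : Prop where
  mem_iff : ∀ X : CMat n,
    X ∈ 𝔥 ↔ ∀ t : ℝ, ∃ g ∈ H, (g : CMat n) = NormedSpace.exp (t • X)
  eq_prod_exp : ∀ g ∈ H, ∃ l : List (CMat n),
    (∀ X ∈ l, X ∈ 𝔥) ∧ (g : CMat n) = (l.map NormedSpace.exp).prod

/-- The complex Lie algebra `𝔤 = 𝔤_ℝ + i 𝔤_ℝ` of matrices. -/
def complexSpan {n : ℕ} (𝔤R : LieSubalgebra ℝ (CMat n)) : LieSubalgebra ℂ (CMat n) where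
  carrier := {Z | ∃ X ∈ 𝔤R, ∃ Y ∈ 𝔤R, Z = X + Complex.I • Y}
  zero_mem' := ⟨0, 𝔤R.zero_mem, 0, 𝔤R.zero_mem, by simp⟩
  add_mem' := by
    rintro _ _ ⟨X, hX, Y, hY, rfl⟩ ⟨X', hX', Y', hY', rfl⟩
    exact ⟨X + X', 𝔤R.add_mem hX hX', Y + Y', 𝔤R.add_mem hY hY', by rw [smul_add]; abel⟩
  smul_mem' := by
    rintro c _ ⟨X, hX, Y, hY, rfl⟩
    refine ⟨c.re • X - c.im • Y, 𝔤R.sub_mem (𝔤R.smul_mem _ hX) (𝔤R.smul_mem _ hY),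
      c.re • Y + c.im • X, 𝔤R.add_mem (𝔤R.smul_mem _ hY) (𝔤R.smul_mem _ hX), ?_⟩
    ext i j
    apply Complex.ext <;> simp <;> ring
  lie_mem' := by
    rintro _ _ ⟨X, hX, Y, hY, rfl⟩ ⟨X', hX', Y', hY', rfl⟩
    refine ⟨⁅X, X'⁆ - ⁅Y, Y'⁆, 𝔤R.sub_mem (𝔤R.lie_mem hX hX') (𝔤R.lie_mem hY hY'),
      ⁅X, Y'⁆ + ⁅Y, X'⁆, 𝔤R.add_mem (𝔤R.lie_mem hX hY') (𝔤R.lie_mem hY hX'), ?_⟩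
    simp only [add_lie, lie_add, smul_lie, lie_smul, smul_add, smul_smul, Complex.I_mul_I,
      neg_smul, one_smul]
    abel

/-- The inclusion of `𝔤_ℝ` into `𝔤 = 𝔤_ℝ + i 𝔤_ℝ`. -/
def toComplexSpan {n : ℕ} {𝔤R : LieSubalgebra ℝ (CMat n)} (x : 𝔤R) : complexSpan 𝔤R :=
  ⟨x, x, x.2, 0, 𝔤R.zero_mem, by simp⟩

/-- `G` is a complexification, inside `GL(n, ℂ)`, of a connected Lie subgroup with Lie algebra
`𝔤_ℝ`: the sum `𝔤 = 𝔤_ℝ + i 𝔤_ℝ` is direct, so that `𝔤` is the complexification of `𝔤_ℝ`,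
and `G` is the connected Lie subgroup with Lie algebra `𝔤`. -/
structure IsComplexification {n : ℕ} (𝔤R : LieSubalgebra ℝ (CMat n))
    (G : Subgroup (GL (Fin n) ℂ)) : Prop where
  totally_real : ∀ X ∈ 𝔤R, Complex.I • X ∈ 𝔤R → X = 0
  connected : IsConnectedLieSubgroup G ((complexSpan 𝔤R).toSubmodule.restrictScalars ℝ)

/-- The adjoint orbit `H · X`. -/
def adjointOrbit {n : ℕ} (H : Subgroup (GL (Fin n) ℂ)) (X : CMat n) : Set (CMat n) :=
  {Y | ∃ g ∈ H, Y = (g : CMat n) * X * ((g⁻¹ : GL (Fin n) ℂ) : CMat n)}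

/-- The limit of orbits `lim_{ν → 0⁺} H · (ν X)`. -/
def orbitLimit {n : ℕ} (H : Subgroup (GL (Fin n) ℂ)) (X : CMat n) : Set (CMat n) :=
  ⋂ ε ∈ Set.Ioi (0 : ℝ), closure (⋃ ν ∈ Set.Ioo (0 : ℝ) ε, adjointOrbit H (ν • X))

/-- `e ∈ 𝔤_ℝ` is an even nilpotent element: it is nilpotent, and it is zero or belongs to an
`𝔰𝔩₂`-triple `{h, e, f}` of `𝔤_ℝ` such that the eigenvalues of `ad h` on `𝔤` are even integers. -/
def IsEvenNilpotent {n : ℕ} {𝔤R : LieSubalgebra ℝ (CMat n)} (e : 𝔤R) : Prop :=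
  IsNilpotent (LieAlgebra.ad ℝ 𝔤R e) ∧
    (e = 0 ∨ ∃ h f : 𝔤R, IsSl2Triple h e f ∧
      ∀ μ : ℂ, (LieAlgebra.ad ℂ (complexSpan 𝔤R) (toComplexSpan h)).HasEigenvalue μ →
        ∃ k : ℤ, μ = 2 * (k : ℂ))

open Classical in
/-- The set `ℒ(e)`: the limit `lim_{ν → 0⁺} G_ℝ · (ν h)` for an `𝔰𝔩₂`-triple `{h, e, f}` of `𝔤_ℝ`
containing `e`, and `{0}` for `e = 0` (the only nilpotent element without such a triple). -/
def limitMap {n : ℕ} (GR : Subgroup (GL (Fin n) ℂ)) {𝔤R : LieSubalgebra ℝ (CMat n)}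
    (e : 𝔤R) : Set (CMat n) :=
  if H : ∃ h f : 𝔤R, IsSl2Triple h e f then orbitLimit GR (H.choose : CMat n) else {0}

/-- The real forms of the orbit `G · e`: the `G_ℝ`-orbits of the elements of `(G · e) ∩ 𝔤_ℝ`. -/
def realForms {n : ℕ} (GR G : Subgroup (GL (Fin n) ℂ)) (𝔤R : LieSubalgebra ℝ (CMat n))
    (e : 𝔤R) : Set (Set (CMat n)) :=
  {O | ∃ x ∈ adjointOrbit G e ∩ (𝔤R : Set (CMat n)), O = adjointOrbit GR x}

end

/-! Let h be the neutral element of a real triple through e. It is diagonalizable with integer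
eigenvalues (`IsSl2Triple.exists_eq_hd`), so tr h² > 0, and simplicity of 𝔤_ℝ makes the form Re
tr(XY) nondegenerate on it (`trNondeg_of_isSimple`). This form serves throughout for duality. Let 𝔭
and 𝔫 be the parts of 𝔤_ℝ of ad h-weight ≥ 0 and > 0; then 𝔫 is the orthogonal of 𝔭 in 𝔤_ℝ.

The limit lies in the closure. A point of the limit is approximated by ν Ad(g) h with ν small and g
in G_ℝ. The distance from Ad(g) h to Ad(g) 𝔫 is bounded independently of g
(`exists_dist_nilradical_le`): on Ad(g) 𝔭 the functional Re tr(Ad(g) h · Z) is a combination of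
traces of Z on invariant subspaces, each at most n‖Z‖, and a functional of bounded norm is
represented by a bounded element. After multiplication by ν the error tends to 0, so it suffices
that 𝔫 lies in the closure of G·e ∩ 𝔤_ℝ (`nilradical_subset_closure`). Evenness gives [𝔭, e] = 𝔫
(`exists_lie_eq_of_even`). On the complex line through x in 𝔫 and e, all but finitely many points y
satisfy [𝔭_ℂ, y] = 𝔫_ℂ, so orbits are locally constant there; the remaining parameters form a
connected set, hence these points are in G·e, and real parameters tending to 0 give x.

The closure lies in the limit. A real point x of G·e lies in a real triple whose neutral element is
G-conjugate to h (`exists_isSl2Triple_of_Ad_mem`). Real hyperbolic elements that are G-conjugate are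
G_ℝ-conjugate (`exists_real_conj`): after moving one of them by G_ℝ so that its opposite flags are
transversal to the flags of the other, their difference is a sum of elements of the two opposite
nilradicals, and translating a hyperbolic element by its own nilradical does not leave its orbit.
Thus x may be taken with [h', x] = 2x and h' in G_ℝ·h, and νh' + x is conjugate to νh'
(`mem_orbitLimit_of_lie_eq`).

Finiteness. By the same conjugacy each real form contains a weight-two element x of a triple with
neutral element h. Such elements have open orbits in the weight-two space of 𝔤_ℝ. A variational
argument shows that each of these orbits accumulates at a compact fiber of a moment map
(`exists_mem_momentFiber`); every point of the fiber belongs to a triple with neutral element h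
(`exists_isSl2Triple_of_frob`), hence has an open orbit too. So finitely many orbits cover the
fiber, and every orbit is one of them. The minimizer in the variational argument is nonzero because
a determinantal semi-invariant is constant and nonzero on the orbit and vanishes at 0.

Two neutral elements for the same e differ by an element of positive weight, so they are conjugate
and the limit does not depend on the triple (`exists_Ad_eq_of_isSl2Triple`). -/

noncomputable section

/-! ### Casimir identities for 𝔰𝔩₂ in an associative ring -/

section RingSl2

variable {A : Type*} [Ring A] {E F H C : A}

/-- The Casimir element of an `𝔰𝔩₂`-triple in an associative ring (up to normalization). -/
def casimir (E F H : A) : A := H * H + 2 * H + 4 * (F * E)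

/-- The factor `C - (H + 2k)(H + 2k + 2)` occurring in the expansion of `F ^ k * E ^ k`. -/
def casimirFactor (H C : A) (k : ℕ) : A := C - (H + 2 * k) * (H + 2 * k + 2)

/-- The product of the first `k` Casimir factors. -/
def casimirProd (H C : A) : ℕ → A
  | 0 => 1
  | k + 1 => casimirProd H C k * casimirFactor H C k

theorem casimir_comm_h (hE : H * E = E * H + 2 * E) (hF : H * F = F * H - 2 * F) :
    Commute (casimir E F H) H := by
  have : casimir E F H * H - H * casimir E F H =
      4 * (-(H * F - (F * H - 2 * F)) * E - F * (H * E - (E * H + 2 * E))) := by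
    unfold casimir; noncomm_ring
  rw [hE, hF, sub_self, sub_self] at this
  exact sub_eq_zero.1 (by simpa using this)

theorem casimir_comm_e (hE : H * E = E * H + 2 * E) (hEF : E * F = F * E + H) :
    Commute (casimir E F H) E := by
  have : casimir E F H * E - E * casimir E F H =
      H * (H * E - (E * H + 2 * E)) + (H * E - (E * H + 2 * E)) * H
        - 4 * (E * F - (F * E + H)) * E := by
    unfold casimir; noncomm_ring
  rw [hE, hEF, sub_self, sub_self] at this
  exact sub_eq_zero.1 (by simpa using this)

/-- The relations are symmetric under exchanging E with F and H with -H, so each result on powers of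
E also applies to powers of F. -/
theorem casimir_swap (hEF : E * F = F * E + H) : casimir F E (-H) = casimir E F H := by
  unfold casimir; rw [hEF]; noncomm_ring

theorem neg_raises_of_lowers (hF : H * F = F * H - 2 * F) : -H * F = F * -H + 2 * F := by
  rw [neg_mul, hF]; noncomm_ring

theorem mul_eq_mul_add_neg (hEF : E * F = F * E + H) : F * E = E * F + -H := by
  rw [hEF]; abel

theorem casimirFactor_mul_e (hE : H * E = E * H + 2 * E) (hC : Commute C E) (k : ℕ) :
    casimirFactor H C k * E = E * casimirFactor H C (k + 1) := by
  have hk : (H + 2 * k) * E - (E * (H + 2 * k) + 2 * E) = 0 := by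
    have := (Nat.cast_commute k E).eq
    have h2 : (H + 2 * k) * E - (E * (H + 2 * k) + 2 * E) =
      (H * E - (E * H + 2 * E)) + 2 * (k * E - E * k) := by noncomm_ring
    rw [h2, this, hE]; simp
  have h3 : casimirFactor H C k * E - E * casimirFactor H C (k + 1) =
      (C * E - E * C) - ((H + 2 * k) * ((H + 2 * k) * E - (E * (H + 2 * k) + 2 * E))
       + ((H + 2 * k) * E - (E * (H + 2 * k) + 2 * E)) * (H + 2 * k)
       + 4 * ((H + 2 * k) * E - (E * (H + 2 * k) + 2 * E))) := by
    unfold casimirFactor; push_cast; noncomm_ring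
  rw [hk, hC.eq] at h3
  exact sub_eq_zero.1 (by simpa using h3)

/-- One has 4FE = C - H(H + 2), and carrying this factor through E ^ k replaces H by H + 2k.
Nilpotency of E thus becomes a polynomial relation between the commuting elements H and C. -/
theorem four_pow_mul_pow_mul_pow (hE : H * E = E * H + 2 * E)
    (hEF : E * F = F * E + H) (k : ℕ) :
    4 ^ k * (F ^ k * E ^ k) = casimirProd H (casimir E F H) k := by
  have hC := casimir_comm_e hE hEF
  have hpow : ∀ k : ℕ, casimirFactor H (casimir E F H) 0 * E ^ k =
      E ^ k * casimirFactor H (casimir E F H) k := by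
    intro k
    induction k with
    | zero => simp
    | succ k ih => rw [pow_succ, ← mul_assoc, ih, mul_assoc, casimirFactor_mul_e hE hC, mul_assoc]
  have h0 : 4 * (F * E) = casimirFactor H (casimir E F H) 0 := by
    simp only [casimirFactor, casimir]; push_cast; noncomm_ring
  have h4 : ∀ x : A, Commute (4 : A) x := fun x => by exact_mod_cast Nat.cast_commute 4 x
  induction k with
  | zero => simp [casimirProd]
  | succ k ih =>
    rw [casimirProd, ← ih]
    calc 4 ^ (k + 1) * (F ^ (k + 1) * E ^ (k + 1))
        = 4 ^ k * (4 * F ^ k) * F * E * E ^ k := by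
          rw [pow_succ F, pow_succ' E, pow_succ (4 : A)]; noncomm_ring
      _ = 4 ^ k * F ^ k * (4 * (F * E) * E ^ k) := by
          rw [(h4 (F ^ k)).eq]; noncomm_ring
      _ = _ := by rw [h0, hpow]; noncomm_ring

theorem casimirFactor_commute (hc : Commute H C) (j k : ℕ) :
    Commute (casimirFactor H C j) (casimirFactor H C k) := by
  have h1 : ∀ j : ℕ, Commute H (casimirFactor H C j) := fun j => by
    unfold casimirFactor
    have : Commute H (H + 2 * (j : A)) :=
      (Commute.refl H).add_right (by exact_mod_cast Nat.commute_cast H (2 * j))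
    exact hc.sub_right (this.mul_right (this.add_right
      (by exact_mod_cast Nat.commute_cast H 2)))
  have h2 : ∀ j : ℕ, Commute C (casimirFactor H C j) := fun j => by
    unfold casimirFactor
    have : Commute C (H + 2 * (j : A)) :=
      hc.symm.add_right (by exact_mod_cast Nat.commute_cast C (2 * j))
    exact (Commute.refl C).sub_right (this.mul_right (this.add_right
      (by exact_mod_cast Nat.commute_cast C 2)))
  have h3 : Commute (H + 2 * (j : A)) (casimirFactor H C k) :=
    (h1 k).add_left (by exact_mod_cast Nat.cast_commute (2 * j) (casimirFactor H C k))
  exact (h2 k).sub_left (h3.mul_left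
    (h3.add_left (by exact_mod_cast Nat.cast_commute 2 (casimirFactor H C k))))

theorem casimirProd_isUnit (N : ℕ) (h : ∀ j < N, IsUnit (casimirFactor H C j)) :
    IsUnit (casimirProd H C N) := by
  induction N with
  | zero => simp [casimirProd]
  | succ N ih => exact (ih fun j hj => h j (by omega)).mul (h N (by omega))

theorem casimirProd_eq_unit_mul (hc : Commute H C) (j₀ : ℕ) (N : ℕ) (hN : j₀ < N)
    (h : ∀ j < N, j ≠ j₀ → IsUnit (casimirFactor H C j)) :
    ∃ u, IsUnit u ∧ casimirProd H C N = u * casimirFactor H C j₀ := by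
  induction N with
  | zero => omega
  | succ N ih =>
    by_cases hj : j₀ = N
    · subst hj
      exact ⟨_, casimirProd_isUnit j₀ fun j hj => h j (by omega) (by omega), rfl⟩
    · obtain ⟨u, hu, hu'⟩ := ih (by omega) fun j hj hj' => h j (by omega) hj'
      refine ⟨u * casimirFactor H C N, hu.mul (h N (by omega) (Ne.symm hj)), ?_⟩
      rw [casimirProd, hu', mul_assoc, mul_assoc, (casimirFactor_commute hc j₀ N).eq]

/-- Subtracting the two quadratic expressions for C leaves 4(a + b + 1)(H - (b - a)) = 0. -/
theorem h_eq_of_casimirFactor_eq_zero [Algebra ℂ A] (a b : ℕ)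
    (h1 : casimirFactor H C a = 0) (h2 : casimirFactor (-H) C b = 0) :
    H = algebraMap ℂ A ((b : ℂ) - a) := by
  have ha := (Nat.cast_commute a H).eq
  have hb := (Nat.cast_commute b H).eq
  have hab := (Nat.cast_commute a (b : A)).eq
  have h3 : (4 * (a + b + 1) : A) * (H - (b - a)) =
      (casimirFactor (-H) C b - casimirFactor H C a) + 2 * (a * H - H * a)
       + 2 * (b * H - H * b) - 4 * (a * b - b * a) := by
    unfold casimirFactor; noncomm_ring
  rw [h1, h2, ha, hb, hab] at h3
  have h4 : ((4 * (a + b + 1) : ℂ)) • (H - ((b : A) - a)) = 0 := by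
    rw [Algebra.smul_def]
    simpa [map_ofNat] using h3
  have h5 : (4 * (a + b + 1) : ℂ) ≠ 0 := by
    exact_mod_cast (by omega : 4 * (a + b + 1) ≠ 0)
  have h6 := (smul_eq_zero.1 h4).resolve_left h5
  rw [sub_eq_zero.1 h6]; simp

/-- The factor is its nonzero value at (x, y) plus a nilpotent element commuting with it. -/
theorem casimirFactor_isUnit [Algebra ℂ A] {x y : ℂ} (hc : Commute H C)
    (hH : IsNilpotent (H - algebraMap ℂ A x)) (hC : IsNilpotent (C - algebraMap ℂ A y)) (j : ℕ)
    (hs : y - (x + 2 * j) * (x + 2 * j + 2) ≠ 0) : IsUnit (casimirFactor H C j) := by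
  have hx : ∀ z : A, Commute (algebraMap ℂ A x) z := fun z => Algebra.commutes x z
  have hy : ∀ z : A, Commute (algebraMap ℂ A y) z := fun z => Algebra.commutes y z
  have hjH := (Nat.cast_commute j H)
  have hjx := (Nat.cast_commute j (algebraMap ℂ A x))
  have key : casimirFactor H C j = algebraMap ℂ A (y - (x + 2 * j) * (x + 2 * j + 2)) +
      ((C - algebraMap ℂ A y) +
        (H - algebraMap ℂ A x) * (-(H + algebraMap ℂ A x + 4 * j + 2))) := by
    have : casimirFactor H C j - (algebraMap ℂ A (y - (x + 2 * j) * (x + 2 * j + 2)) +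
      ((C - algebraMap ℂ A y) +
        (H - algebraMap ℂ A x) * (-(H + algebraMap ℂ A x + 4 * j + 2)))) =
       (H * algebraMap ℂ A x - algebraMap ℂ A x * H) + 2 * (H * j - j * H)
        + 2 * (j * algebraMap ℂ A x - algebraMap ℂ A x * j) := by
      unfold casimirFactor
      simp only [map_sub, map_add, map_mul, map_natCast, map_ofNat]
      noncomm_ring
    rw [← hjH.eq, hjx.eq, (hx H).eq] at this
    exact sub_eq_zero.1 (by simpa using this)
  rw [key]
  have c1 : Commute (H - algebraMap ℂ A x) (H + algebraMap ℂ A x + 4 * j + 2) := by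
    refine Commute.sub_left ?_ (hx _)
    refine (((Commute.refl H).add_right (hx H).symm).add_right ?_).add_right ?_
    · exact_mod_cast Nat.commute_cast H (4 * j)
    · exact_mod_cast Nat.commute_cast H 2
  have c2 : Commute (C - algebraMap ℂ A y) (H - algebraMap ℂ A x) :=
    (hc.symm.sub_right (hx C).symm).sub_left (hy _)
  have c3 : Commute C (H + algebraMap ℂ A x + 4 * j + 2) := by
    refine ((hc.symm.add_right (hx C).symm).add_right ?_).add_right ?_
    · exact_mod_cast Nat.commute_cast C (4 * j)
    · exact_mod_cast Nat.commute_cast C 2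
  have c4 : Commute (C - algebraMap ℂ A y) (-(H + algebraMap ℂ A x + 4 * j + 2)) :=
    (c3.sub_left (hy _)).neg_right
  refine IsNilpotent.isUnit_add_left_of_commute ?_ ?_ ?_
  · exact (c2.mul_right c4).isNilpotent_add hC (c1.neg_right.isNilpotent_mul_right hH)
  · exact (isUnit_iff_ne_zero.2 hs).map (algebraMap ℂ A)
  · exact (Algebra.commutes _ _).symm

end RingSl2

/-! ### Finite-dimensional 𝔰𝔩₂-modules: integrality and injectivity of powers of E -/

section ModuleSl2

open Module Module.End

variable {V : Type*} [AddCommGroup V] [Module ℂ V] {E F H : End ℂ V}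

-- On a weight vector H acts as a scalar, so the product becomes a polynomial in C alone.
open Polynomial in
theorem casimirProd_apply_of_weight {C : End ℂ V} (hc : Commute H C) {x : ℂ} (k : ℕ) :
    ∀ w : V, H w = x • w → casimirProd H C k w =
      aeval C (∏ j ∈ Finset.range k, (X - Polynomial.C ((x + 2 * j) * (x + 2 * j + 2)))) w := by
  have hf : ∀ (k : ℕ) (w : V), H w = x • w →
      casimirFactor H C k w = (C - algebraMap ℂ (End ℂ V) ((x + 2 * k) * (x + 2 * k + 2))) w := by
    intro k w hw
    have hk : (k : End ℂ V) = algebraMap ℂ _ (k : ℂ) := (map_natCast _ k).symm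
    have h2 : (2 : End ℂ V) = algebraMap ℂ _ (2 : ℂ) := (map_ofNat _ 2).symm
    unfold casimirFactor
    rw [hk, h2]
    simp only [LinearMap.sub_apply, Module.End.mul_apply, LinearMap.add_apply,
      algebraMap_end_apply, hw, map_smul, map_add]
    module
  induction k with
  | zero => intro w _; simp [casimirProd]
  | succ k ih =>
    intro w hw
    have hw' : H (casimirFactor H C k w) = x • casimirFactor H C k w := by
      rw [hf k w hw, ← Module.End.mul_apply]
      have : Commute H (C - algebraMap ℂ (End ℂ V) ((x + 2 * k) * (x + 2 * k + 2))) :=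
        hc.sub_right (Algebra.commutes _ _).symm
      rw [this.eq, Module.End.mul_apply, hw, map_smul]
    rw [casimirProd, Module.End.mul_apply, ih _ hw', hf k w hw, Finset.prod_range_succ,
      map_mul (aeval C), Module.End.mul_apply, aeval_sub, aeval_X, aeval_C]

variable [FiniteDimensional ℂ V]

/-- Otherwise the powers E ^ k would be eigenvectors of ad H with the infinitely many eigenvalues
2k. -/
theorem isNilpotent_of_raises (hE : H * E = E * H + 2 * E) : IsNilpotent E := by
  by_contra hn
  have hpow : ∀ k : ℕ, H * E ^ k - E ^ k * H = (2 * k : ℂ) • E ^ k := by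
    intro k
    induction k with
    | zero => simp
    | succ k ih =>
      have : H * E ^ (k + 1) - E ^ (k + 1) * H =
        (H * E ^ k - E ^ k * H) * E + E ^ k * (H * E - E * H) := by
        rw [pow_succ]; noncomm_ring
      have h2 : H * E - E * H = (2 : ℂ) • E := by
        rw [hE, add_sub_cancel_left, two_mul, two_smul]
      rw [this, ih, h2, pow_succ, smul_mul_assoc, mul_smul_comm, ← add_smul]
      push_cast; ring_nf
  let T : End ℂ (End ℂ V) := LinearMap.mulLeft ℂ H - LinearMap.mulRight ℂ H
  have hT : ∀ k : ℕ, T.HasEigenvalue (2 * k : ℂ) := fun k => by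
    refine hasEigenvalue_of_hasEigenvector (x := E ^ k) ⟨mem_eigenspace_iff.2 ?_, ?_⟩
    · simpa [T] using hpow k
    · exact fun h => hn ⟨k, h⟩
  refine Set.infinite_of_injective_forall_mem (f := fun k : ℕ => (2 * k : ℂ)) ?_ hT
    (finite_hasEigenvalue T)
  intro a b hab
  simpa using hab

open Polynomial in
/-- In a finite-dimensional `𝔰𝔩₂`-module the map `E ^ m` is injective on the space of
weight `-m`. -/
theorem eq_zero_of_pow_apply_eq_zero (hE : H * E = E * H + 2 * E) (hF : H * F = F * H - 2 * F)
    (hEF : E * F = F * E + H) {m : ℕ} {w : V} (hw : H w = (-m : ℂ) • w)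
    (h0 : (E ^ m) w = 0) : w = 0 := by
  have hF' := neg_raises_of_lowers hF
  obtain ⟨N, hN⟩ := isNilpotent_of_raises hF'
  have hc := (casimir_comm_h hE hF).symm
  have hswap := casimir_swap hEF
  have h2 : casimirProd (-H) (casimir E F H) N w = 0 := by
    rw [← hswap, ← four_pow_mul_pow_mul_pow hF' (mul_eq_mul_add_neg hEF), hN]
    simp
  set C := casimir E F H
  have h1 : casimirProd H C m w = 0 := by
    rw [← four_pow_mul_pow_mul_pow hE hEF]
    simp [Module.End.mul_apply, h0]
  rw [casimirProd_apply_of_weight hc _ _ hw] at h1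
  rw [casimirProd_apply_of_weight hc.neg_left (x := m) _ _ (by simp [hw])] at h2
  -- C satisfies on w one polynomial from E ^ m and one from the nilpotency of F. The roots plus 1
  -- are (2i + 1 - m)² with 0 ≤ i < m, and (m + 2j + 1)². The former are less than (m + 1)², the
  -- latter are not, so the two polynomials are coprime.
  have hcop : IsCoprime
      (∏ j ∈ Finset.range m, (X - Polynomial.C (((-m : ℂ) + 2 * j) * (-m + 2 * j + 2))))
      (∏ j ∈ Finset.range N, (X - Polynomial.C (((m : ℂ) + 2 * j) * (m + 2 * j + 2)))) := by
    refine IsCoprime.prod_left fun i hi => IsCoprime.prod_right fun j _ => ?_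
    refine Polynomial.isCoprime_X_sub_C_of_isUnit_sub (isUnit_iff_ne_zero.2 (sub_ne_zero.2 ?_))
    have hi' : (i : ℤ) < m := by exact_mod_cast Finset.mem_range.1 hi
    have : (-(m : ℤ) + 2 * i) * (-m + 2 * i + 2) ≠ (m + 2 * j) * (m + 2 * j + 2) := by
      have : (0 : ℤ) ≤ i := by positivity
      have : (0 : ℤ) ≤ j := by positivity
      intro h
      nlinarith [mul_pos (by linarith : (0 : ℤ) < m - i) (by linarith : (0 : ℤ) < i + 1)]
    exact_mod_cast this
  obtain ⟨u, v, huv⟩ := hcop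
  have : aeval C (_ + _) w = aeval C 1 w := congrArg (fun p => aeval C p w) huv
  rw [map_add (aeval C), map_mul (aeval C), map_mul (aeval C), LinearMap.add_apply,
    Module.End.mul_apply, Module.End.mul_apply, h1, h2, map_one, map_zero, map_zero,
    add_zero] at this
  exact this.symm

/-- The operator `H` of a finite-dimensional `𝔰𝔩₂`-module is diagonalizable with integer
eigenvalues. -/
theorem iSup_eigenspace_int_eq_top (hE : H * E = E * H + 2 * E) (hF : H * F = F * H - 2 * F)
    (hEF : E * F = F * E + H) : ⨆ k : ℤ, eigenspace H (k : ℂ) = ⊤ := by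
  have hF' := neg_raises_of_lowers hF
  obtain ⟨N, hN⟩ := isNilpotent_of_raises hE
  obtain ⟨N', hN'⟩ := isNilpotent_of_raises hF'
  have hc := (casimir_comm_h hE hF).symm
  have hswap := casimir_swap hEF
  have p1 : casimirProd H (casimir E F H) N = 0 := by
    rw [← four_pow_mul_pow_mul_pow hE hEF, hN, mul_zero, mul_zero]
  have p2 : casimirProd (-H) (casimir E F H) N' = 0 := by
    rw [← hswap, ← four_pow_mul_pow_mul_pow hF' (mul_eq_mul_add_neg hEF), hN', mul_zero, mul_zero]
  set C := casimir E F H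
  rw [eq_top_iff, ← iSup_iInf_maxGenEigenspace_eq_top_of_iSup_maxGenEigenspace_eq_top_of_commute
    (![H, C] : Fin 2 → End ℂ V)
    (by intro i j hij; fin_cases i <;> fin_cases j <;> simp_all [hc.symm])
    (fun i => iSup_maxGenEigenspace_eq_top _)]
  refine iSup_le fun χ => ?_
  set M := ⨅ i, maxGenEigenspace ((![H, C] : Fin 2 → End ℂ V) i) (χ i) with hM
  set x := χ 0
  set y := χ 1
  by_cases hbot : M = ⊥
  · rw [hbot]; exact bot_le
  have hle0 : M ≤ maxGenEigenspace H x := iInf_le _ (0 : Fin 2)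
  have hle1 : M ≤ maxGenEigenspace C y := iInf_le _ (1 : Fin 2)
  have hMeq : M = maxGenEigenspace H x ⊓ maxGenEigenspace C y := by
    refine le_antisymm (le_inf hle0 hle1) (le_iInf fun i => ?_)
    fin_cases i
    · exact inf_le_left
    · exact inf_le_right
  have hmH : ∀ v ∈ M, H v ∈ M := fun v hv => by
    rw [hMeq] at hv ⊢
    exact ⟨mapsTo_maxGenEigenspace_of_comm (Commute.refl H) x hv.1,
      mapsTo_maxGenEigenspace_of_comm hc.symm y hv.2⟩
  have hmC : ∀ v ∈ M, C v ∈ M := fun v hv => by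
    rw [hMeq] at hv ⊢
    exact ⟨mapsTo_maxGenEigenspace_of_comm hc x hv.1,
      mapsTo_maxGenEigenspace_of_comm (Commute.refl C) y hv.2⟩
  let H' : End ℂ M := H.restrict hmH
  let C' : End ℂ M := C.restrict hmC
  have hc' : Commute H' C' := by
    ext v; simpa [H', C'] using congrArg (fun T : End ℂ V => T v) hc.eq
  have nH : IsNilpotent (H' - algebraMap ℂ (End ℂ M) x) := by
    refine isNilpotent_restrict_of_le (p := M) (q := maxGenEigenspace H x)
      (f := H - algebraMap ℂ _ x) (hp := fun v hv => ?_)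
      (hq := mapsTo_maxGenEigenspace_of_comm
        ((Commute.refl H).sub_right (Algebra.commutes x H).symm) x) hle0
      (isNilpotent_restrict_maxGenEigenspace_sub_algebraMap H x)
    exact M.sub_mem (hmH v hv) (M.smul_mem _ hv)
  have nC : IsNilpotent (C' - algebraMap ℂ (End ℂ M) y) := by
    refine isNilpotent_restrict_of_le (p := M) (q := maxGenEigenspace C y)
      (f := C - algebraMap ℂ _ y) (hp := fun v hv => ?_)
      (hq := mapsTo_maxGenEigenspace_of_comm
        ((Commute.refl C).sub_right (Algebra.commutes y C).symm) y) hle1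
      (isNilpotent_restrict_maxGenEigenspace_sub_algebraMap C y)
    exact M.sub_mem (hmC v hv) (M.smul_mem _ hv)
  have nH' : IsNilpotent (-H' - algebraMap ℂ (End ℂ M) (-x)) := by
    have : -H' - algebraMap ℂ (End ℂ M) (-x) = -(H' - algebraMap ℂ (End ℂ M) x) := by
      simp; abel
    rw [this]; exact nH.neg
  have hres : ∀ k, ∀ v : M, (casimirFactor H' C' k v : V) = casimirFactor H C k v := by
    intro k v
    simp [casimirFactor, H', C', Module.End.mul_apply]
  have hres' : ∀ k, ∀ v : M, (casimirFactor (-H') C' k v : V) = casimirFactor (-H) C k v := by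
    intro k v
    simp [casimirFactor, H', C', Module.End.mul_apply]
  have hprod : ∀ k, ∀ v : M, (casimirProd H' C' k v : V) = casimirProd H C k v := by
    intro k
    induction k with
    | zero => intro v; simp [casimirProd]
    | succ k ih => intro v; simp only [casimirProd, Module.End.mul_apply, ih, hres]
  have hprod' : ∀ k, ∀ v : M, (casimirProd (-H') C' k v : V) = casimirProd (-H) C k v := by
    intro k
    induction k with
    | zero => intro v; simp [casimirProd]
    | succ k ih => intro v; simp only [casimirProd, Module.End.mul_apply, ih, hres']
  have q1 : casimirProd H' C' N = 0 := by
    ext v; rw [hprod, p1]; simp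
  have q2 : casimirProd (-H') C' N' = 0 := by
    ext v; rw [hprod', p2]; simp
  have : Nontrivial M := Submodule.nontrivial_iff_ne_bot.2 hbot
  -- On the nonzero joint generalized eigenspace M the product of the factors is 0, so some factor
  -- is not a unit; the same holds for -H.
  have hex1 : ∃ a < N, y - (x + 2 * a) * (x + 2 * a + 2) = 0 := by
    by_contra! hcon
    have := casimirProd_isUnit N fun j hj => casimirFactor_isUnit hc' nH nC j (hcon j hj)
    rw [q1] at this
    exact not_isUnit_zero this
  have hex2 : ∃ b < N', y - (-x + 2 * b) * (-x + 2 * b + 2) = 0 := by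
    by_contra! hcon
    have := casimirProd_isUnit N' fun j hj =>
      casimirFactor_isUnit hc'.neg_left nH' nC j (hcon j hj)
    rw [q2] at this
    exact not_isUnit_zero this
  have hx : ∀ a b : ℕ, y - (x + 2 * a) * (x + 2 * a + 2) = 0 →
      y - (-x + 2 * b) * (-x + 2 * b + 2) = 0 → x = (b : ℂ) - a := by
    intro a b ha hb
    have : (4 * (a + b + 1) : ℂ) * (x - (b - a)) = 0 := by linear_combination hb - ha
    have h5 : (4 * (a + b + 1) : ℂ) ≠ 0 := by exact_mod_cast (by omega : 4 * (a + b + 1) ≠ 0)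
    exact sub_eq_zero.1 ((mul_eq_zero.1 this).resolve_left h5)
  obtain ⟨a, haN, ha⟩ := hex1
  obtain ⟨b, hbN, hb⟩ := hex2
  have hxab := hx a b ha hb
  -- Since x = b - a for every admissible pair, a is determined by b and conversely. All other
  -- factors are units, so the singular factor itself vanishes on M, and not just its semisimple
  -- part.
  obtain ⟨u, hu, hu'⟩ := casimirProd_eq_unit_mul hc' a N haN fun j hj hja =>
    casimirFactor_isUnit hc' nH nC j fun h => hja <| by
      have := hx j b h hb
      rw [hxab] at this
      exact_mod_cast (sub_right_injective this).symm
  obtain ⟨u2, hu2, hu2'⟩ := casimirProd_eq_unit_mul hc'.neg_left b N' hbN fun j hj hjb =>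
    casimirFactor_isUnit hc'.neg_left nH' nC j fun h => hjb <| by
      have := hx a j ha h
      rw [hxab] at this
      exact_mod_cast (sub_left_injective this).symm
  rw [q1] at hu'
  rw [q2] at hu2'
  have r1 := (hu.mul_right_eq_zero).1 hu'.symm
  have r2 := (hu2.mul_right_eq_zero).1 hu2'.symm
  have hH' := h_eq_of_casimirFactor_eq_zero a b r1 r2
  intro v hv
  refine Submodule.mem_iSup_of_mem ((b : ℤ) - a) (mem_eigenspace_iff.2 ?_)
  have := congrArg (fun T : End ℂ M => (T ⟨v, hv⟩ : V)) hH'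
  simpa [H', sub_smul, Nat.cast_smul_eq_nsmul] using this

end ModuleSl2

/-! ### Eigenspaces of ad h for a diagonalizable matrix with integer eigenvalues -/

section Weights

variable {n : ℕ}

/-- The adjoint action `X ↦ g X g⁻¹` on matrices. -/
def Ad (g : GL (Fin n) ℂ) : CMat n →ₐ[ℂ] CMat n where
  toFun X := (g : CMat n) * X * ((g⁻¹ : GL (Fin n) ℂ) : CMat n)
  map_one' := by simp
  map_mul' X Y := by
    simp only [mul_assoc]
    rw [← mul_assoc ((g⁻¹ : GL (Fin n) ℂ) : CMat n) g, Units.inv_mul, one_mul]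
  map_zero' := by simp
  map_add' X Y := by simp [mul_add, add_mul]
  commutes' c := by
    rw [← Algebra.commutes, mul_assoc, Units.mul_inv, mul_one]

theorem Ad_apply (g : GL (Fin n) ℂ) (X : CMat n) :
    Ad g X = (g : CMat n) * X * ((g⁻¹ : GL (Fin n) ℂ) : CMat n) := rfl

@[simp] theorem Ad_one (X : CMat n) : Ad 1 X = X := by simp [Ad_apply]

theorem Ad_mul (g k : GL (Fin n) ℂ) (X : CMat n) : Ad (g * k) X = Ad g (Ad k X) := by
  simp [Ad_apply, mul_assoc]

@[simp] theorem Ad_inv_Ad (g : GL (Fin n) ℂ) (X : CMat n) : Ad g⁻¹ (Ad g X) = X := by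
  rw [← Ad_mul, inv_mul_cancel, Ad_one]

@[simp] theorem Ad_Ad_inv (g : GL (Fin n) ℂ) (X : CMat n) : Ad g (Ad g⁻¹ X) = X := by
  rw [← Ad_mul, mul_inv_cancel, Ad_one]

theorem Ad_lie (g : GL (Fin n) ℂ) (X Y : CMat n) : Ad g ⁅X, Y⁆ = ⁅Ad g X, Ad g Y⁆ := by
  simp [Ring.lie_def]

theorem Ad_real_smul (g : GL (Fin n) ℂ) (c : ℝ) (X : CMat n) : Ad g (c • X) = c • Ad g X := by
  simp [Ad_apply]

@[simp] theorem trace_Ad (g : GL (Fin n) ℂ) (X : CMat n) : (Ad g X).trace = X.trace :=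
  Matrix.trace_units_conj g X

/-- The matrix with integer eigenvalues `d` in the basis given by the columns of `q`. -/
def hd (q : GL (Fin n) ℂ) (d : Fin n → ℤ) : CMat n := Ad q (Matrix.diagonal fun j => (d j : ℂ))

theorem Ad_hd (g q : GL (Fin n) ℂ) (d : Fin n → ℤ) : Ad g (hd q d) = hd (g * q) d := by
  rw [hd, hd, Ad_mul]

theorem hd_neg (q : GL (Fin n) ℂ) (d : Fin n → ℤ) : hd q (-d) = -hd q d := by
  rw [hd, hd, ← map_neg, Matrix.diagonal_neg]
  congr 2; ext j; simp

/-- The sum of the eigenspaces of `ad (hd q d)` with eigenvalues in `A`. -/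
def wt (q : GL (Fin n) ℂ) (d : Fin n → ℤ) (A : Set ℤ) : Submodule ℂ (CMat n) where
  carrier := {X | ∀ j l, Ad q⁻¹ X j l ≠ 0 → d j - d l ∈ A}
  zero_mem' j l h := by simp at h
  add_mem' {X Y} hX hY j l h := by
    by_contra hc
    refine h ?_
    rw [map_add, Matrix.add_apply, not_not.1 fun h' => hc (hX j l h'),
      not_not.1 fun h' => hc (hY j l h'), add_zero]
  smul_mem' c X hX j l h := hX j l fun h' => h (by rw [map_smul, Matrix.smul_apply, h', smul_zero])

variable {q : GL (Fin n) ℂ} {d : Fin n → ℤ} {A A' A'' : Set ℤ}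

theorem mem_wt {X : CMat n} : X ∈ wt q d A ↔ ∀ j l, Ad q⁻¹ X j l ≠ 0 → d j - d l ∈ A := Iff.rfl

theorem wt_mono (h : A ⊆ A') : wt q d A ≤ wt q d A' := fun _ hX j l hj => h (hX j l hj)

theorem real_smul_mem_wt (c : ℝ) {X : CMat n} (hX : X ∈ wt q d A) : c • X ∈ wt q d A := by
  have : c • X = (c : ℂ) • X := by ext; simp
  rw [this]; exact (wt q d A).smul_mem _ hX

theorem wt_neg : wt q (-d) A = wt q d {i | -i ∈ A} := by
  ext X
  simp only [mem_wt, Set.mem_ofPred_eq, Pi.neg_apply]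
  refine forall₂_congr fun j l => ?_
  rw [neg_sub, neg_sub_neg, ← neg_sub, neg_sub]

theorem mem_wt_mul {g : GL (Fin n) ℂ} {X : CMat n} :
    X ∈ wt (g * q) d A ↔ Ad g⁻¹ X ∈ wt q d A := by
  rw [mem_wt, mem_wt, mul_inv_rev, Ad_mul]

theorem eq_zero_of_mem_wt_of_disjoint {X : CMat n} (h : X ∈ wt q d A) (h' : X ∈ wt q d A')
    (hd : Disjoint A A') : X = 0 := by
  have : Ad q⁻¹ X = 0 := by
    ext j l
    by_contra hc
    exact Set.disjoint_left.1 hd (h j l hc) (h' j l hc)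
  rw [← Ad_Ad_inv q X, this, map_zero]

theorem mem_wt_inter {X : CMat n} (h : X ∈ wt q d A) (h' : X ∈ wt q d A') : X ∈ wt q d (A ∩ A') :=
  fun j l hj => ⟨h j l hj, h' j l hj⟩

theorem mul_mem_wt {X Y : CMat n} (hX : X ∈ wt q d A) (hY : Y ∈ wt q d A')
    (h : ∀ a ∈ A, ∀ b ∈ A', a + b ∈ A'') : X * Y ∈ wt q d A'' := by
  intro j l hj
  rw [map_mul, Matrix.mul_apply] at hj
  obtain ⟨k, -, hk⟩ := Finset.exists_ne_zero_of_sum_ne_zero hj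
  have := h _ (hX j k (left_ne_zero_of_mul hk)) _ (hY k l (right_ne_zero_of_mul hk))
  simpa using this

theorem lie_mem_wt {X Y : CMat n} (hX : X ∈ wt q d A) (hY : Y ∈ wt q d A')
    (h : ∀ a ∈ A, ∀ b ∈ A', a + b ∈ A'') : ⁅X, Y⁆ ∈ wt q d A'' := by
  rw [Ring.lie_def]
  exact (wt q d A'').sub_mem (mul_mem_wt hX hY h)
    (mul_mem_wt hY hX fun a ha b hb => by rw [add_comm]; exact h b hb a ha)

/-- The operator multiplying the eigenspace of `ad (hd q d)` with eigenvalue `i` by `φ i`. -/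
def wtMul (q : GL (Fin n) ℂ) (d : Fin n → ℤ) (φ : ℤ → ℝ) : CMat n →ₗ[ℂ] CMat n where
  toFun X := Ad q (Matrix.of fun j l => (φ (d j - d l) : ℂ) * Ad q⁻¹ X j l)
  map_add' X Y := by
    rw [← map_add]; congr 1; ext j l; simp [mul_add]
  map_smul' c X := by
    rw [← map_smul]; congr 1; ext j l; simp; ring

theorem Ad_inv_wtMul (φ : ℤ → ℝ) (X : CMat n) (j l : Fin n) :
    Ad q⁻¹ (wtMul q d φ X) j l = (φ (d j - d l) : ℂ) * Ad q⁻¹ X j l := by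
  simp [wtMul]

theorem ext_Ad_inv {X Y : CMat n} (h : ∀ j l, Ad q⁻¹ X j l = Ad q⁻¹ Y j l) : X = Y := by
  rw [← Ad_Ad_inv q X, ← Ad_Ad_inv q Y]
  congr 1; ext j l; exact h j l

theorem lie_hd (X : CMat n) : ⁅hd q d, X⁆ = wtMul q d (fun i => i) X := by
  refine ext_Ad_inv (q := q) fun j l => ?_
  rw [Ad_lie, hd, Ad_inv_Ad, Ad_inv_wtMul, Ring.lie_def, Matrix.sub_apply, Matrix.diagonal_mul,
    Matrix.mul_diagonal]
  push_cast; ring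

theorem wtMul_comp (φ ψ : ℤ → ℝ) (X : CMat n) :
    wtMul q d φ (wtMul q d ψ X) = wtMul q d (fun i => φ i * ψ i) X := by
  refine ext_Ad_inv (q := q) fun j l => ?_
  simp only [Ad_inv_wtMul]; push_cast; ring

theorem wtMul_add (φ ψ : ℤ → ℝ) (X : CMat n) :
    wtMul q d φ X + wtMul q d ψ X = wtMul q d (fun i => φ i + ψ i) X := by
  refine ext_Ad_inv (q := q) fun j l => ?_
  simp only [map_add, Matrix.add_apply, Ad_inv_wtMul]; push_cast; ring

theorem wtMul_mem {φ : ℤ → ℝ} (h : ∀ i, φ i ≠ 0 → i ∈ A) (X : CMat n) :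
    wtMul q d φ X ∈ wt q d A := by
  intro j l hj
  rw [Ad_inv_wtMul] at hj
  exact h _ (by exact_mod_cast left_ne_zero_of_mul hj)

theorem wtMul_mem_wt (φ : ℤ → ℝ) {X : CMat n} (hX : X ∈ wt q d A) : wtMul q d φ X ∈ wt q d A := by
  intro j l hj
  rw [Ad_inv_wtMul] at hj
  exact hX j l (right_ne_zero_of_mul hj)

theorem wtMul_congr {φ ψ : ℤ → ℝ} {X : CMat n} (hX : X ∈ wt q d A) (h : ∀ i ∈ A, φ i = ψ i) :
    wtMul q d φ X = wtMul q d ψ X := by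
  refine ext_Ad_inv (q := q) fun j l => ?_
  rw [Ad_inv_wtMul, Ad_inv_wtMul]
  by_cases h0 : Ad q⁻¹ X j l = 0
  · rw [h0]; simp
  · rw [h _ (hX j l h0)]

theorem wtMul_const (c : ℝ) (X : CMat n) : wtMul q d (fun _ => c) X = (c : ℂ) • X := by
  refine ext_Ad_inv (q := q) fun j l => ?_
  rw [Ad_inv_wtMul, map_smul]; simp

theorem mem_wt_univ (X : CMat n) : X ∈ wt q d Set.univ := fun _ _ _ => trivial

theorem mem_wt_singleton {k : ℤ} {X : CMat n} : X ∈ wt q d {k} ↔ ⁅hd q d, X⁆ = (k : ℂ) • X := by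
  rw [lie_hd]
  constructor
  · intro h
    rw [wtMul_congr (ψ := fun _ => (k : ℝ)) h (by rintro i rfl; rfl), wtMul_const]; simp
  · intro h j l hj
    have h2 := congrArg (fun Y => Ad q⁻¹ Y j l) h
    simp only [Ad_inv_wtMul, map_smul, Matrix.smul_apply, smul_eq_mul] at h2
    have := mul_right_cancel₀ hj h2
    exact_mod_cast this

/-- A real subspace stable under `ad (hd q d)` is stable under projections to eigenspaces. -/
theorem wtMul_mem_of_lie_mem {S : Submodule ℝ (CMat n)} (hS : ∀ X ∈ S, ⁅hd q d, X⁆ ∈ S)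
    (φ : ℤ → ℝ) {X : CMat n} (hX : X ∈ S) : wtMul q d φ X ∈ S := by
  classical
  have hpoly : ∀ p : Polynomial ℝ, wtMul q d (fun i => p.eval (i : ℝ)) X ∈ S := by
    intro p
    induction p using Polynomial.induction_on' with
    | add p r hp hr => simpa [← wtMul_add] using S.add_mem hp hr
    | monomial k a =>
      induction k with
      | zero =>
        have : (a : ℂ) • X = a • X := by ext; simp
        simpa [wtMul_const, this] using S.smul_mem a hX
      | succ k ih =>
        have := hS _ ih
        rw [lie_hd, wtMul_comp] at this
        convert this using 3
        funext i
        simp only [Polynomial.eval_monomial]; ring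
  let T : Finset ℤ := Finset.univ.image fun p : Fin n × Fin n => d p.1 - d p.2
  -- Only finitely many weights occur, so φ agrees on them with a real Lagrange polynomial and the
  -- multiplier is a real polynomial in ad h.
  have hT : wtMul q d φ X =
      wtMul q d (fun i => (Lagrange.interpolate T (fun i : ℤ => (i : ℝ)) φ).eval (i : ℝ)) X := by
    refine wtMul_congr (A := T) (fun j l _ => ?_) fun i hi => ?_
    · exact Finset.mem_coe.2 (Finset.mem_image.2 ⟨(j, l), Finset.mem_univ _, rfl⟩)
    · exact (Lagrange.eval_interpolate_at_node _ (fun _ _ _ _ h => by exact_mod_cast h) hi).symm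
  rw [hT]; exact hpoly _

open Classical in
/-- The projection onto the sum of the eigenspaces of `ad (hd q d)` with eigenvalues in `A`. -/
def wtProj (q : GL (Fin n) ℂ) (d : Fin n → ℤ) (A : Set ℤ) : CMat n →ₗ[ℂ] CMat n :=
  wtMul q d fun i => if i ∈ A then 1 else 0

theorem wtProj_mem (X : CMat n) : wtProj q d A X ∈ wt q d A := by
  classical
  refine wtMul_mem (fun i hi => ?_) X
  by_contra h
  simp [h] at hi

theorem wtProj_mem_wt {X : CMat n} (hX : X ∈ wt q d A') : wtProj q d A X ∈ wt q d A' :=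
  wtMul_mem_wt _ hX

theorem sub_wtProj_mem (X : CMat n) : X - wtProj q d A X ∈ wt q d Aᶜ := by
  classical
  have : X - wtProj q d A X = wtMul q d (fun i => if i ∈ A then 0 else 1) X := by
    rw [sub_eq_iff_eq_add, wtProj, wtMul_add]
    have h1 := wtMul_const (q := q) (d := d) 1 X
    rw [Complex.ofReal_one, one_smul] at h1
    refine h1.symm.trans (wtMul_congr (mem_wt_univ _) fun i _ => ?_)
    by_cases hi : i ∈ A <;> simp [hi]
  rw [this]
  refine wtMul_mem (fun i hi => ?_) X
  intro h
  simp [h] at hi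

theorem wtProj_mem_of_lie_mem {S : Submodule ℝ (CMat n)} (hS : ∀ X ∈ S, ⁅hd q d, X⁆ ∈ S)
    {X : CMat n} (hX : X ∈ S) : wtProj q d A X ∈ S := wtMul_mem_of_lie_mem hS _ hX

theorem mem_wt_of_wtProj_compl_eq_zero {X : CMat n} (h : wtProj q d Aᶜ X = 0) : X ∈ wt q d A := by
  have := sub_wtProj_mem (q := q) (d := d) (A := Aᶜ) X
  rwa [h, sub_zero, compl_compl] at this

theorem lie_wtProj {e X : CMat n} {k : ℤ} (he : e ∈ wt q d {k}) :
    ⁅e, wtProj q d A X⁆ = wtProj q d {i | i - k ∈ A} ⁅e, X⁆ := by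
  classical
  have key : ∀ j l, ⁅Ad q⁻¹ e, Ad q⁻¹ (wtProj q d A X)⁆ j l =
      (if d j - d l - k ∈ A then 1 else 0) * ⁅Ad q⁻¹ e, Ad q⁻¹ X⁆ j l := by
    intro j l
    simp only [Ring.lie_def, Matrix.sub_apply, Matrix.mul_apply, mul_sub, Finset.mul_sum]
    congr 1 <;> refine Finset.sum_congr rfl fun m _ => ?_
    · by_cases h0 : Ad q⁻¹ e j m = 0
      · rw [h0]; simp
      · have : d j - d m = k := he j m h0
        rw [wtProj, Ad_inv_wtMul, show d j - d l - k = d m - d l by omega]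
        split_ifs <;> simp
    · by_cases h0 : Ad q⁻¹ e m l = 0
      · rw [h0]; simp
      · have : d m - d l = k := he m l h0
        rw [wtProj, Ad_inv_wtMul, show d j - d l - k = d j - d m by omega]
        split_ifs <;> simp
  refine ext_Ad_inv (q := q) fun j l => ?_
  rw [Ad_lie, key, wtProj, Ad_inv_wtMul, Ad_lie]
  simp only [Set.mem_ofPred_eq]
  split_ifs <;> simp

/-- The trace form pairs weight i only with weight -i. -/
theorem trace_wtProj_mul (X Y : CMat n) :
    (wtProj q d A X * Y).trace = (X * wtProj q d {i | -i ∈ A} Y).trace := by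
  classical
  rw [← trace_Ad q⁻¹, ← trace_Ad q⁻¹ (X * _), map_mul, map_mul]
  simp only [Matrix.trace, Matrix.diag_apply, Matrix.mul_apply]
  refine Finset.sum_congr rfl fun j _ => Finset.sum_congr rfl fun l _ => ?_
  rw [wtProj, wtProj, Ad_inv_wtMul, Ad_inv_wtMul]
  simp only [Set.mem_ofPred_eq, neg_sub]
  split_ifs <;> simp

theorem trace_hd_sq : (hd q d * hd q d).trace = ((∑ j, (d j : ℝ) ^ 2 : ℝ) : ℂ) := by
  rw [hd, ← map_mul, trace_Ad, Matrix.diagonal_mul_diagonal, Matrix.trace_diagonal]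
  push_cast
  exact Finset.sum_congr rfl fun j _ => by ring

theorem trace_hd_sq_pos (h : hd q d ≠ 0) : 0 < (hd q d * hd q d).trace.re := by
  rw [trace_hd_sq, Complex.ofReal_re]
  by_contra hc
  have h0 : ∀ j, (d j : ℝ) ^ 2 = 0 := fun j =>
    (Finset.sum_eq_zero_iff_of_nonneg fun j _ => sq_nonneg _).1
      (le_antisymm (not_lt.1 hc) (Finset.sum_nonneg fun j _ => sq_nonneg _)) j (Finset.mem_univ j)
  refine h ?_
  have : (fun j => (d j : ℂ)) = 0 := by
    ext j
    have := pow_eq_zero_iff (two_ne_zero) |>.1 (h0 j)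
    simpa using this
  rw [hd, this]
  simp

end Weights

/-! ### Triples of matrices and the centralizer of e -/

section MatrixTriple

open Module Module.End

variable {n : ℕ} {h e f : CMat n}

theorem sl2_mul_rel (t : IsSl2Triple h e f) :
    h * e = e * h + 2 * e ∧ h * f = f * h - 2 * f ∧ e * f = f * e + h := by
  have h1 := t.lie_h_e_nsmul
  have h2 := t.lie_h_f_nsmul
  have h3 := t.lie_e_f
  rw [Ring.lie_def, sub_eq_iff_eq_add'] at h1 h2 h3
  refine ⟨by rw [h1, two_mul, two_smul], by rw [h2, two_mul, two_smul]; abel, h3⟩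

theorem sl2_end_rel (t : IsSl2Triple h e f) :
    Matrix.toLinAlgEquiv' h * Matrix.toLinAlgEquiv' e =
      Matrix.toLinAlgEquiv' e * Matrix.toLinAlgEquiv' h + 2 * Matrix.toLinAlgEquiv' e ∧
    Matrix.toLinAlgEquiv' h * Matrix.toLinAlgEquiv' f =
      Matrix.toLinAlgEquiv' f * Matrix.toLinAlgEquiv' h - 2 * Matrix.toLinAlgEquiv' f ∧
    Matrix.toLinAlgEquiv' e * Matrix.toLinAlgEquiv' f =
      Matrix.toLinAlgEquiv' f * Matrix.toLinAlgEquiv' e +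
        (Matrix.toLinAlgEquiv' h : End ℂ (Fin n → ℂ)) := by
  obtain ⟨h1, h2, h3⟩ := sl2_mul_rel t
  have two : (Matrix.toLinAlgEquiv' (2 : CMat n) : End ℂ (Fin n → ℂ)) = 2 := map_ofNat _ 2
  refine ⟨?_, ?_, ?_⟩
  · rw [← map_mul, h1, map_add, map_mul, map_mul, two]
  · rw [← map_mul, h2, map_sub, map_mul, map_mul, two]
  · rw [← map_mul, h3, map_add, map_mul]

theorem sl2_ad_rel (t : IsSl2Triple h e f) :
    LieAlgebra.ad ℂ (CMat n) h * LieAlgebra.ad ℂ (CMat n) e =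
      LieAlgebra.ad ℂ (CMat n) e * LieAlgebra.ad ℂ (CMat n) h + 2 * LieAlgebra.ad ℂ (CMat n) e ∧
    LieAlgebra.ad ℂ (CMat n) h * LieAlgebra.ad ℂ (CMat n) f =
      LieAlgebra.ad ℂ (CMat n) f * LieAlgebra.ad ℂ (CMat n) h - 2 * LieAlgebra.ad ℂ (CMat n) f ∧
    LieAlgebra.ad ℂ (CMat n) e * LieAlgebra.ad ℂ (CMat n) f =
      LieAlgebra.ad ℂ (CMat n) f * LieAlgebra.ad ℂ (CMat n) e + LieAlgebra.ad ℂ (CMat n) h := by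
  have h1 := congrArg (LieAlgebra.ad ℂ (CMat n)) t.lie_h_e_nsmul
  have h2 := congrArg (LieAlgebra.ad ℂ (CMat n)) t.lie_h_f_nsmul
  have h3 := congrArg (LieAlgebra.ad ℂ (CMat n)) t.lie_e_f
  rw [LieHom.map_lie, Ring.lie_def, sub_eq_iff_eq_add'] at h1 h2 h3
  refine ⟨?_, ?_, h3⟩
  · rw [h1, map_nsmul, two_mul, two_smul]
  · rw [h2, map_neg, map_nsmul, two_mul, two_smul]; abel

/-- The neutral element of an `𝔰𝔩₂`-triple of matrices is diagonalizable with integer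
eigenvalues. -/
theorem IsSl2Triple.exists_eq_hd (t : IsSl2Triple h e f) : ∃ q d, h = hd q d := by
  obtain ⟨h1, h2, h3⟩ := sl2_end_rel t
  set T : End ℂ (Fin n → ℂ) := Matrix.toLinAlgEquiv' h with hT
  have htop := iSup_eigenspace_int_eq_top h1 h2 h3
  have hind : iSupIndep fun k : ℤ => eigenspace T (k : ℂ) :=
    (eigenspaces_iSupIndep T).comp Int.cast_injective
  have hint := DirectSum.isInternal_submodule_of_iSupIndep_of_iSup_eq_top hind htop
  let b₀ := hint.collectedBasis fun k => Module.finBasis ℂ (eigenspace T (k : ℂ))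
  let σ := b₀.indexEquiv (Pi.basisFun ℂ (Fin n))
  let b := b₀.reindex σ
  let d : Fin n → ℤ := fun j => (σ.symm j).1
  have hb : ∀ j, T (b j) = (d j : ℂ) • b j := fun j => by
    have : b j ∈ eigenspace T (d j : ℂ) := by
      simp [b, b₀, d]
    exact mem_eigenspace_iff.1 this
  let Q : CMat n := (Pi.basisFun ℂ (Fin n)).toMatrix b
  let Q' : CMat n := b.toMatrix (Pi.basisFun ℂ (Fin n))
  let q : GL (Fin n) ℂ := ⟨Q, Q', Basis.toMatrix_mul_toMatrix_flip _ _,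
    Basis.toMatrix_mul_toMatrix_flip _ _⟩
  refine ⟨q, d, ?_⟩
  have hQ : h * Q = Q * Matrix.diagonal fun j => (d j : ℂ) := by
    ext i j
    have := congrFun (hb j) i
    rw [Matrix.mul_diagonal]
    simp only [hT, Matrix.toLinAlgEquiv'_apply, Pi.smul_apply, smul_eq_mul] at this
    rw [mul_comm]
    simpa [Q, Basis.toMatrix_apply, Matrix.mul_apply, Matrix.mulVec, dotProduct] using this
  rw [hd, Ad_apply]
  change h = Q * _ * Q'
  rw [← hQ, mul_assoc]
  change h = h * ((q * q⁻¹ : GL (Fin n) ℂ) : CMat n)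
  simp

variable {q : GL (Fin n) ℂ} {d : Fin n → ℤ}

theorem mem_wt_of_forall_wtProj_eq_zero {A : Set ℤ} {X : CMat n}
    (h : ∀ k ∉ A, wtProj q d {k} X = 0) : X ∈ wt q d A := by
  intro j l hj
  by_contra hc
  have := congrArg (fun Y => Ad q⁻¹ Y j l) (h _ hc)
  simp [wtProj, Ad_inv_wtMul] at this
  exact hj this

theorem mem_wt_two (t : IsSl2Triple (hd q d) e f) : e ∈ wt q d {2} :=
  mem_wt_singleton.2 (by rw [t.lie_h_e_smul ℂ]; norm_num)

theorem eq_zero_of_ad_pow_eq_zero (t : IsSl2Triple (hd q d) e f) {m : ℕ} {X : CMat n}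
    (hX : X ∈ wt q d {-(m : ℤ)}) (h0 : (LieAlgebra.ad ℂ (CMat n) e ^ m) X = 0) : X = 0 := by
  obtain ⟨h1, h2, h3⟩ := sl2_ad_rel t
  refine eq_zero_of_pow_apply_eq_zero h1 h2 h3 ?_ h0
  rw [LieAlgebra.ad_apply, mem_wt_singleton.1 hX]
  push_cast; rfl

theorem wtProj_singleton_eq_zero (t : IsSl2Triple (hd q d) e f) {X : CMat n} (hX : ⁅e, X⁆ = 0)
    {k : ℤ} (hk : k < 0) : wtProj q d {k} X = 0 := by
  obtain ⟨m, hm⟩ : ∃ m : ℕ, k = -((m + 1 : ℕ) : ℤ) := ⟨(-k - 1).toNat, by omega⟩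
  have h1 : ⁅e, wtProj q d {k} X⁆ = 0 := by rw [lie_wtProj (mem_wt_two t), hX, map_zero]
  refine eq_zero_of_ad_pow_eq_zero t (m := m + 1) (hm ▸ wtProj_mem X) ?_
  rw [pow_succ, Module.End.mul_apply, LieAlgebra.ad_apply, h1, map_zero]

/-- The centralizer of `e` has nonnegative weights. -/
theorem mem_wt_of_lie_eq_zero (t : IsSl2Triple (hd q d) e f) {X : CMat n} (hX : ⁅e, X⁆ = 0) :
    X ∈ wt q d (Set.Ici 0) :=
  mem_wt_of_forall_wtProj_eq_zero fun _ hk =>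
    wtProj_singleton_eq_zero t hX (not_le.1 fun h => hk (Set.mem_Ici.2 h))

/-- The intersection of the centralizer of `e` with the image of `ad e` has positive weights. -/
theorem lie_mem_wt_of_lie_lie_eq_zero (t : IsSl2Triple (hd q d) e f) {Y : CMat n}
    (hY : ⁅e, ⁅e, Y⁆⁆ = 0) : ⁅e, Y⁆ ∈ wt q d (Set.Ioi 0) := by
  refine mem_wt_of_forall_wtProj_eq_zero fun k hk => ?_
  rcases lt_or_eq_of_le (not_lt.1 fun h => hk (Set.mem_Ioi.2 h)) with hk | rfl
  · exact wtProj_singleton_eq_zero t hY hk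
  -- The weight-zero part of [e, Y] is [e, Y₋₂]; it is killed by ad e, while (ad e)² is injective in
  -- weight -2.
  · have h1 : ⁅e, wtProj q d {-2} Y⁆ = wtProj q d {0} ⁅e, Y⁆ := by
      rw [lie_wtProj (mem_wt_two t)]
      congr 2; ext i; simp
    have h2 : wtProj q d {-2} Y = 0 := by
      refine eq_zero_of_ad_pow_eq_zero t (m := 2) (by simpa using wtProj_mem Y) ?_
      rw [pow_two, Module.End.mul_apply, LieAlgebra.ad_apply, LieAlgebra.ad_apply, h1,
        lie_wtProj (mem_wt_two t), hY, map_zero]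
    rw [← h1, h2, lie_zero]

end MatrixTriple

/-! ### Conjugation by exponentials -/

section ExpConj

variable {𝔸 : Type*} [NormedRing 𝔸] [NormedAlgebra ℝ 𝔸] [CompleteSpace 𝔸]

open NormedSpace

theorem exp_map_of_map_pow {𝔹 : Type*} [NormedRing 𝔹] [NormedAlgebra ℝ 𝔹] [CompleteSpace 𝔹]
    (φ : 𝔸 →L[ℝ] 𝔹) (z : 𝔸) (h : ∀ k : ℕ, φ (z ^ k) = φ z ^ k) :
    exp (φ z) = φ (exp z) := by
  have h1 := (exp_series_hasSum_exp' (𝕂 := ℝ) z).mapL φ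
  have h2 := exp_series_hasSum_exp' (𝕂 := ℝ) (φ z)
  refine h2.unique ?_
  convert h1 using 2 with k
  rw [map_smul, h]

/-- `exp z * x * exp (-z)` is the sum of the exponential series of `ad z` applied to `x`. -/
theorem hasSum_exp_conj (z x : 𝔸) :
    HasSum (fun k : ℕ => ((k.factorial : ℝ)⁻¹) • ((LieAlgebra.ad ℝ 𝔸 z) ^ k) x)
      (exp z * x * exp (-z)) := by
  -- Left multiplication by z and right multiplication by -z commute and add up to ad z, so exp(ad
  -- z) is the product of their exponentials.
  let L := ContinuousLinearMap.mul ℝ 𝔸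
  let R := (ContinuousLinearMap.mul ℝ 𝔸).flip
  have hL : ∀ k : ℕ, L (z ^ k) = L z ^ k := fun k => by
    induction k with
    | zero => ext y; simp [L]
    | succ k ih => rw [pow_succ', pow_succ', ← ih]; ext y; simp [L, mul_assoc]
  have hR : ∀ k : ℕ, R ((-z) ^ k) = R (-z) ^ k := fun k => by
    induction k with
    | zero => ext y; simp [R]
    | succ k ih => rw [pow_succ, pow_succ', ← ih]; ext y; simp [R, mul_assoc]
  have hc : Commute (L z) (R (-z)) := by
    ext y; simp [L, R, mul_assoc]
  let _ : NormedAlgebra ℚ (𝔸 →L[ℝ] 𝔸) := NormedAlgebra.restrictScalars ℚ ℝ _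
  have h1 := exp_add_of_commute hc
  rw [exp_map_of_map_pow L z hL, exp_map_of_map_pow R (-z) hR] at h1
  have h2 := (exp_series_hasSum_exp' (𝕂 := ℝ) (L z + R (-z))).mapL
    (ContinuousLinearMap.apply ℝ 𝔸 x)
  rw [h1] at h2
  have h3 : ∀ k : ℕ, ((LieAlgebra.ad ℝ 𝔸 z) ^ k) x = ((L z + R (-z)) ^ k) x := by
    intro k
    induction k with
    | zero => simp
    | succ k ih =>
      rw [pow_succ', pow_succ', Module.End.mul_apply, ih]
      simp [L, R, Ring.lie_def, sub_eq_add_neg]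
  have h4 : (fun k : ℕ => ((k.factorial : ℝ)⁻¹) • ((LieAlgebra.ad ℝ 𝔸 z) ^ k) x) =
      fun k : ℕ => ContinuousLinearMap.apply ℝ 𝔸 x
        (((k.factorial : ℝ)⁻¹) • (L z + R (-z)) ^ k) := by
    funext k; rw [h3, map_smul]; rfl
  have h5 : exp z * x * exp (-z) = ContinuousLinearMap.apply ℝ 𝔸 x (L (exp z) * R (exp (-z))) := by
    change _ = exp z * (x * exp (-z))
    rw [mul_assoc]
  rw [h4, h5]; exact h2

end ExpConj

/-! ### The adjoint action of exponentials of matrices -/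

section ExpMat

open NormedSpace Matrix.Norms.Operator

variable {n : ℕ}

/-- The exponential of a matrix as an element of the general linear group. -/
def expG (X : CMat n) : GL (Fin n) ℂ where
  val := exp X
  inv := exp (-X)
  val_inv := by
    rw [← Matrix.exp_add_of_commute _ _ (Commute.refl X).neg_right, add_neg_cancel, exp_zero]
  inv_val := by
    rw [← Matrix.exp_add_of_commute _ _ (Commute.refl X).neg_left, neg_add_cancel, exp_zero]

@[simp] theorem coe_expG (X : CMat n) : (expG X : CMat n) = exp X := rfl

theorem expG_inv (X : CMat n) : (expG X)⁻¹ = expG (-X) := by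
  refine Units.ext ?_
  rfl

theorem Ad_expG_apply (z x : CMat n) : Ad (expG z) x = exp z * x * exp (-z) := rfl

theorem hasSum_Ad_expG (z x : CMat n) :
    HasSum (fun k : ℕ => ((k.factorial : ℝ)⁻¹) • ((LieAlgebra.ad ℝ (CMat n) z) ^ k) x)
      (Ad (expG z) x) := hasSum_exp_conj z x

theorem Ad_expG_mem {S : Submodule ℝ (CMat n)} {z x : CMat n} (hz : ∀ y ∈ S, ⁅z, y⁆ ∈ S)
    (hx : x ∈ S) : Ad (expG z) x ∈ S := by
  refine (Submodule.closed_of_finiteDimensional S).mem_of_tendsto (hasSum_Ad_expG z x)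
    (Filter.Eventually.of_forall fun s => S.sum_mem fun k hk => S.smul_mem _ ?_)
  clear hk
  induction k with
  | zero => simpa using hx
  | succ k ih => rw [pow_succ', Module.End.mul_apply]; exact hz _ ih

/-- The tail of the exponential series from order two on lies in S, which is closed. With S spanned
by higher weights, this isolates the leading term of a conjugation. -/
theorem Ad_expG_sub_mem {S : Submodule ℝ (CMat n)} {z x : CMat n} (hz : ∀ y ∈ S, ⁅z, y⁆ ∈ S)
    (hx : ⁅z, ⁅z, x⁆⁆ ∈ S) : Ad (expG z) x - (x + ⁅z, x⁆) ∈ S := by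
  have h1 := (hasSum_nat_add_iff' 2).2 (hasSum_Ad_expG z x)
  simp only [Finset.sum_range_succ, Finset.sum_range_zero] at h1
  have h2 : Ad (expG z) x - (x + ⁅z, x⁆) = Ad (expG z) x -
      (0 + ((Nat.factorial 0 : ℝ)⁻¹) • ((LieAlgebra.ad ℝ (CMat n) z) ^ 0) x +
        ((Nat.factorial 1 : ℝ)⁻¹) • ((LieAlgebra.ad ℝ (CMat n) z) ^ 1) x) := by simp
  rw [h2]
  refine (Submodule.closed_of_finiteDimensional S).mem_of_tendsto h1
    (Filter.Eventually.of_forall fun s => S.sum_mem fun k hk => S.smul_mem _ ?_)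
  clear hk
  induction k with
  | zero => simpa [pow_two] using hx
  | succ k ih =>
    rw [show k + 1 + 2 = (k + 2) + 1 by ring, pow_succ', Module.End.mul_apply]
    exact hz _ ih

theorem Ad_expG_of_lie_lie_eq_zero {z x : CMat n} (h : ⁅z, ⁅z, x⁆⁆ = 0) :
    Ad (expG z) x = x + ⁅z, x⁆ := by
  have := Ad_expG_sub_mem (S := ⊥) (z := z) (x := x)
    (by rintro y hy; rw [(Submodule.mem_bot ℝ).1 hy]; simp) ((Submodule.mem_bot ℝ).2 h)
  exact sub_eq_zero.1 ((Submodule.mem_bot ℝ).1 this)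

theorem Ad_expG_of_lie_eq_zero {z x : CMat n} (h : ⁅z, x⁆ = 0) : Ad (expG z) x = x := by
  rw [Ad_expG_of_lie_lie_eq_zero (by rw [h, lie_zero]), h, add_zero]

/-- The subgroup generated by exponentials of elements of a set of matrices. -/
def expClosure (S : Set (CMat n)) : Subgroup (GL (Fin n) ℂ) :=
  Subgroup.closure (expG '' S)

theorem expG_mem_expClosure {S : Set (CMat n)} {z : CMat n} (hz : z ∈ S) :
    expG z ∈ expClosure S := Subgroup.subset_closure ⟨z, hz, rfl⟩

/-- For a subalgebra `𝔫` of positive `h`-weights, `h + 𝔫` is a single orbit of the group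
generated by `exp 𝔫`. -/
theorem exists_Ad_eq_add {q : GL (Fin n) ℂ} {d : Fin n → ℤ} {N : Submodule ℝ (CMat n)}
    (hpos : ∀ X ∈ N, X ∈ wt q d (Set.Ioi 0)) (hh : ∀ X ∈ N, ⁅hd q d, X⁆ ∈ N)
    (hN : ∀ X ∈ N, ∀ Y ∈ N, ⁅X, Y⁆ ∈ N) {y : CMat n} (hy : y ∈ N) :
    ∃ g ∈ expClosure (N : Set (CMat n)), Ad g (hd q d) = hd q d + y := by
  obtain ⟨M, hM⟩ : ∃ M : ℕ, ∀ j l, d j - d l < M := by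
    refine ⟨(∑ p : Fin n × Fin n, |d p.1 - d p.2|).toNat + 1, fun j l => ?_⟩
    have h1 : |d j - d l| ≤ ∑ p : Fin n × Fin n, |d p.1 - d p.2| :=
      Finset.single_le_sum (f := fun p : Fin n × Fin n => |d p.1 - d p.2|)
        (fun _ _ => abs_nonneg _) (Finset.mem_univ (j, l))
    have := le_abs_self (d j - d l)
    omega
  have main : ∀ r k : ℕ, 1 ≤ k → k + r = M + 1 → ∀ y ∈ N, y ∈ wt q d (Set.Ici (k : ℤ)) →
      ∃ g ∈ expClosure (N : Set (CMat n)), Ad g (hd q d) = hd q d + y := by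
    intro r
    induction r with
    | zero =>
      intro k _ hkM y _ hyk
      have : y = 0 := ext_Ad_inv (q := q) fun j l => by
        by_contra hc
        have h1 := hyk j l (by simpa using hc)
        have h2 := hM j l
        rw [Set.mem_Ici] at h1
        omega
      exact ⟨1, one_mem _, by simp [this]⟩
    | succ r ih =>
      intro k hk hkr y hyN hyk
      set yk := wtProj q d {(k : ℤ)} y with hykdef
      have hykN : yk ∈ N := wtProj_mem_of_lie_mem hh hyN
      have hykw : yk ∈ wt q d {(k : ℤ)} := wtProj_mem y
      -- Since [h, w] = k w, this choice gives [w, h] = -yk. Conjugating by exp w removes the lowest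
      -- component of y and leaves only weights above k; these eventually run out.
      set w : CMat n := (k : ℝ)⁻¹ • yk with hw
      have hwN : w ∈ N := N.smul_mem _ hykN
      have hww : w ∈ wt q d {(k : ℤ)} := real_smul_mem_wt _ hykw
      have hk0 : (k : ℝ) ≠ 0 := by positivity
      have hhw : ⁅hd q d, w⁆ = yk := by
        rw [mem_wt_singleton.1 hww, hw]
        ext a b; simp [← mul_assoc]
        rw [mul_inv_cancel₀ (by exact_mod_cast hk0), one_mul]
      let S : Submodule ℝ (CMat n) :=
        N ⊓ (wt q d (Set.Ici ((k : ℤ) + 1))).restrictScalars ℝ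
      have hwS : ∀ x ∈ S, ⁅w, x⁆ ∈ S := fun x hx =>
        ⟨hN _ hwN _ hx.1, lie_mem_wt hww hx.2 (by
          rintro a rfl b hb; rw [Set.mem_Ici] at hb ⊢; omega)⟩
      have hyk' : y - yk ∈ S := by
        refine ⟨N.sub_mem hyN hykN, ?_⟩
        have h1 := mem_wt_inter ((wt q d _).sub_mem hyk (wtProj_mem_wt hyk))
          (sub_wtProj_mem (A := {(k : ℤ)}) y)
        refine wt_mono (fun i hi => ?_) h1
        have h2 : (k : ℤ) ≤ i := hi.1
        have h3 : i ≠ k := hi.2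
        rw [Set.mem_Ici]; omega
      have hwh : ⁅w, hd q d⁆ = -yk := by rw [← lie_skew, hhw]
      have hwy : ∀ x ∈ N, x ∈ wt q d (Set.Ici (k : ℤ)) → ⁅w, x⁆ ∈ S := fun x hx hx' =>
        ⟨hN _ hwN _ hx, lie_mem_wt hww hx' (by
          rintro a rfl b hb; rw [Set.mem_Ici] at hb ⊢; omega)⟩
      have hwyk : ⁅w, yk⁆ ∈ S := hwy _ hykN (wt_mono (by simp) hykw)
      have h2 : ⁅w, ⁅w, hd q d + y⁆⁆ ∈ S := by
        rw [lie_add, hwh, lie_add, lie_neg]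
        exact S.add_mem (S.neg_mem hwyk) (hwS _ (hwy _ hyN hyk))
      have h3 := Ad_expG_sub_mem hwS h2
      have h4 : Ad (expG w) (hd q d + y) - hd q d ∈ S := by
        have : Ad (expG w) (hd q d + y) - hd q d =
            (Ad (expG w) (hd q d + y) - (hd q d + y + ⁅w, hd q d + y⁆)) + (y - yk) + ⁅w, y⁆ := by
          rw [lie_add, hwh]; abel
        rw [this]
        exact S.add_mem (S.add_mem h3 hyk') (hwy _ hyN hyk)
      obtain ⟨g, hg, hg'⟩ := ih (k + 1) (by omega) (by omega) _ h4.1 (by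
        have := h4.2
        simpa using this)
      refine ⟨(expG w)⁻¹ * g, mul_mem (inv_mem (expG_mem_expClosure hwN)) hg, ?_⟩
      rw [Ad_mul, hg', add_sub_cancel, Ad_inv_Ad]
  refine main M 1 le_rfl (by omega) y hy (wt_mono (fun i hi => ?_) (hpos y hy))
  have : (0 : ℤ) < i := hi
  rw [Set.mem_Ici]; push_cast; omega

end ExpMat

/-! ### Connected Lie subgroups and their orbits -/

section Groups

open NormedSpace

variable {n : ℕ} {H : Subgroup (GL (Fin n) ℂ)} {𝔥 : Submodule ℝ (CMat n)}

theorem IsConnectedLieSubgroup.expG_mem (hH : IsConnectedLieSubgroup H 𝔥) {X : CMat n}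
    (hX : X ∈ 𝔥) : expG X ∈ H := by
  obtain ⟨g, hg, hg'⟩ := (hH.mem_iff X).1 hX 1
  rw [one_smul] at hg'
  have : g = expG X := Units.ext hg'
  exact this ▸ hg

theorem coe_prod_map_expG (l : List (CMat n)) :
    (((l.map expG).prod : GL (Fin n) ℂ) : CMat n) = (l.map exp).prod := by
  induction l with
  | nil => simp
  | cons X l ih => rw [List.map_cons, List.prod_cons, Units.val_mul, ih]; simp

theorem IsConnectedLieSubgroup.eq_prod_expG (hH : IsConnectedLieSubgroup H 𝔥)
    {g : GL (Fin n) ℂ} (hg : g ∈ H) :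
    ∃ l : List (CMat n), (∀ X ∈ l, X ∈ 𝔥) ∧ g = (l.map expG).prod := by
  obtain ⟨l, hl, hl'⟩ := hH.eq_prod_exp g hg
  exact ⟨l, hl, Units.ext (by rw [hl', coe_prod_map_expG])⟩

theorem IsConnectedLieSubgroup.expClosure_le (hH : IsConnectedLieSubgroup H 𝔥)
    {S : Set (CMat n)} (hS : ∀ X ∈ S, X ∈ 𝔥) : expClosure S ≤ H := by
  refine (Subgroup.closure_le H).2 ?_
  rintro _ ⟨X, hX, rfl⟩
  exact hH.expG_mem (hS X hX)

theorem IsConnectedLieSubgroup.Ad_mem (hH : IsConnectedLieSubgroup H 𝔥)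
    (hlie : ∀ X ∈ 𝔥, ∀ Y ∈ 𝔥, ⁅X, Y⁆ ∈ 𝔥) {g : GL (Fin n) ℂ} (hg : g ∈ H) {X : CMat n}
    (hX : X ∈ 𝔥) : Ad g X ∈ 𝔥 := by
  obtain ⟨l, hl, rfl⟩ := hH.eq_prod_expG hg
  clear hg
  induction l with
  | nil => simpa using hX
  | cons Y l ih =>
    rw [List.map_cons, List.prod_cons, Ad_mul]
    exact Ad_expG_mem (fun y hy => hlie _ (hl Y (by simp)) _ hy)
      (ih fun Z hZ => hl Z (by simp [hZ]))

theorem Ad_eq_of_mem_expClosure {S : Set (CMat n)} {x : CMat n} (hS : ∀ z ∈ S, ⁅z, x⁆ = 0)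
    {g : GL (Fin n) ℂ} (hg : g ∈ expClosure S) : Ad g x = x := by
  induction hg using Subgroup.closure_induction with
  | mem g hg =>
    obtain ⟨z, hz, rfl⟩ := hg
    exact Ad_expG_of_lie_eq_zero (hS z hz)
  | one => simp
  | mul a b _ _ ha hb => rw [Ad_mul, hb, ha]
  | inv a _ ha => nth_rewrite 1 [← ha]; exact Ad_inv_Ad _ _

theorem adjointOrbit_Ad {g : GL (Fin n) ℂ} (hg : g ∈ H) (X : CMat n) :
    adjointOrbit H (Ad g X) = adjointOrbit H X := by
  ext Y
  constructor
  · rintro ⟨k, hk, rfl⟩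
    exact ⟨k * g, mul_mem hk hg, (Ad_mul k g X).symm⟩
  · rintro ⟨k, hk, rfl⟩
    refine ⟨k * g⁻¹, mul_mem hk (inv_mem hg), ?_⟩
    change Ad k X = Ad (k * g⁻¹) (Ad g X)
    rw [Ad_mul, Ad_inv_Ad]

theorem orbitLimit_Ad {g : GL (Fin n) ℂ} (hg : g ∈ H) (X : CMat n) :
    orbitLimit H (Ad g X) = orbitLimit H X := by
  simp only [orbitLimit, ← Ad_real_smul, adjointOrbit_Ad hg]

end Groups

/-! ### The trace form on 𝔤_ℝ and duality -/

section TraceForm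

open Matrix.Norms.Operator

variable {n : ℕ}

/-- The real part of the trace form on complex matrices. -/
def trForm (n : ℕ) : LinearMap.BilinForm ℝ (CMat n) :=
  LinearMap.mk₂ ℝ (fun X Y => (X * Y).trace.re)
    (fun X X' Y => by simp [add_mul]) (fun c X Y => by simp)
    (fun X Y Y' => by simp [mul_add]) (fun c X Y => by simp)

theorem trForm_apply (X Y : CMat n) : trForm n X Y = (X * Y).trace.re := rfl

theorem trForm_comm (X Y : CMat n) : trForm n X Y = trForm n Y X := by
  rw [trForm_apply, trForm_apply, Matrix.trace_mul_comm]

theorem trForm_lie (X Y Z : CMat n) : trForm n ⁅X, Y⁆ Z = trForm n X ⁅Y, Z⁆ := by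
  simp only [trForm_apply, Ring.lie_def, sub_mul, mul_sub, Matrix.trace_sub]
  rw [mul_assoc, mul_assoc, Matrix.trace_mul_comm Y (X * Z), mul_assoc]

/-- The trace form is nondegenerate on the real subspace `S`. -/
def TrNondeg (S : Submodule ℝ (CMat n)) : Prop :=
  ∀ X ∈ S, (∀ Y ∈ S, trForm n X Y = 0) → X = 0

/-- A simple real Lie algebra of matrices on which the trace form does not vanish has a
nondegenerate trace form. -/
theorem trNondeg_of_isSimple {𝔤R : LieSubalgebra ℝ (CMat n)} (hs : LieAlgebra.IsSimple ℝ 𝔤R)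
    {h : CMat n} (hh : h ∈ 𝔤R) (h0 : trForm n h h ≠ 0) : TrNondeg 𝔤R.toSubmodule := by
  let I : LieIdeal ℝ 𝔤R :=
    { carrier := {X | ∀ Y : 𝔤R, trForm n (X : CMat n) Y = 0}
      add_mem' := fun {X X'} hX hX' Y => by
        rw [AddMemClass.coe_add, map_add, LinearMap.add_apply, hX Y, hX' Y, add_zero]
      zero_mem' := fun Y => by simp
      smul_mem' := fun c X hX Y => by
        rw [SetLike.val_smul, map_smul, LinearMap.smul_apply, hX Y, smul_zero]
      lie_mem := fun {Z X} hX Y => by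
        rw [LieSubalgebra.coe_bracket, ← lie_skew, map_neg, LinearMap.neg_apply, trForm_lie,
          ← LieSubalgebra.coe_bracket, hX ⁅Z, Y⁆, neg_zero] }
  intro X hX hX0
  rcases hs.eq_bot_or_eq_top I with hI | hI
  · have : (⟨X, hX⟩ : 𝔤R) ∈ I := fun Y => hX0 Y Y.2
    rw [hI, LieSubmodule.mem_bot] at this
    exact congrArg Subtype.val this
  · have : (⟨h, hh⟩ : 𝔤R) ∈ I := hI ▸ LieSubmodule.mem_top _
    exact absurd (this ⟨h, hh⟩) h0

theorem exists_represent_of_nondeg {V : Type*} [NormedAddCommGroup V] [NormedSpace ℝ V]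
    [FiniteDimensional ℝ V] (B : LinearMap.BilinForm ℝ V)
    (hB : ∀ x, (∀ y, B x y = 0) → x = 0) :
    ∃ C : ℝ, ∀ ℓ : V →L[ℝ] ℝ, ∃ x, ‖x‖ ≤ C * ‖ℓ‖ ∧ ∀ y, ℓ y = B x y := by
  let Φ : V →ₗ[ℝ] (V →L[ℝ] ℝ) :=
    (LinearMap.toContinuousLinearMap : (V →ₗ[ℝ] ℝ) ≃ₗ[ℝ] (V →L[ℝ] ℝ)).toLinearMap ∘ₗ B
  have hΦ : ∀ x y, Φ x y = B x y := fun x y => rfl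
  have hinj : Function.Injective Φ := by
    refine LinearMap.ker_eq_bot.1 (LinearMap.ker_eq_bot'.2 fun x hx => hB x fun y => ?_)
    rw [← hΦ, hx]; rfl
  have hfr : Module.finrank ℝ V = Module.finrank ℝ (V →L[ℝ] ℝ) := by
    rw [← (LinearMap.toContinuousLinearMap : (V →ₗ[ℝ] ℝ) ≃ₗ[ℝ] (V →L[ℝ] ℝ)).finrank_eq]
    exact (Subspace.dual_finrank_eq (K := ℝ) (V := V)).symm
  let Ψ₀ : V ≃ₗ[ℝ] (V →L[ℝ] ℝ) := LinearEquiv.ofInjectiveOfFinrankEq Φ hinj hfr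
  let Ψ := Ψ₀.toContinuousLinearEquiv
  have hΨ : ∀ x, Ψ x = Φ x := fun x => rfl
  refine ⟨‖(Ψ.symm : (V →L[ℝ] ℝ) →L[ℝ] V)‖, fun ℓ => ⟨Ψ.symm ℓ, ?_, fun y => ?_⟩⟩
  · exact (Ψ.symm : (V →L[ℝ] ℝ) →L[ℝ] V).le_opNorm ℓ
  · rw [← hΦ, ← hΨ, ContinuousLinearEquiv.apply_symm_apply]

/-- A functional on a subspace is represented by the form up to the annihilator of the subspace,
with a bound on the norm. -/
theorem exists_represent_on_submodule {V : Type*} [NormedAddCommGroup V] [NormedSpace ℝ V]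
    [FiniteDimensional ℝ V] (B : LinearMap.BilinForm ℝ V)
    (hB : ∀ x, (∀ y, B x y = 0) → x = 0) :
    ∃ C : ℝ, 0 ≤ C ∧ ∀ (p : Submodule ℝ V) (ℓ : V →ₗ[ℝ] ℝ) (c : ℝ), 0 ≤ c →
      (∀ y ∈ p, |ℓ y| ≤ c * ‖y‖) → ∃ x, ‖x‖ ≤ C * c ∧ ∀ y ∈ p, ℓ y = B x y := by
  obtain ⟨C, hC⟩ := exists_represent_of_nondeg B hB
  refine ⟨|C|, abs_nonneg C, fun p ℓ c hc h => ?_⟩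
  let ℓp : p →L[ℝ] ℝ := LinearMap.mkContinuous (ℓ ∘ₗ p.subtype) c fun y => h y y.2
  -- Norm-preserving Hahn–Banach extension makes the constant independent of the subspace p, which
  -- will vary with the group element.
  obtain ⟨ℓ', hℓ', hn⟩ := _root_.exists_extension_norm_eq p ℓp
  obtain ⟨x, hx, hxy⟩ := hC ℓ'
  refine ⟨x, hx.trans ?_, fun y hy => ?_⟩
  · have : ‖ℓ'‖ ≤ c := hn ▸ LinearMap.mkContinuous_norm_le _ hc _
    exact (mul_le_mul_of_nonneg_right (le_abs_self C) (norm_nonneg _)).trans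
      (mul_le_mul_of_nonneg_left this (abs_nonneg C))
  · rw [← hxy]; exact (hℓ' ⟨y, hy⟩).symm

theorem TrNondeg.exists_represent_on_submodule {S : Submodule ℝ (CMat n)} (hS : TrNondeg S) :
    ∃ C : ℝ, 0 ≤ C ∧ ∀ (p : Submodule ℝ (CMat n)) (ℓ : CMat n →ₗ[ℝ] ℝ) (c : ℝ), 0 ≤ c → p ≤ S →
      (∀ y ∈ p, |ℓ y| ≤ c * ‖y‖) → ∃ x ∈ S, ‖x‖ ≤ C * c ∧ ∀ y ∈ p, ℓ y = trForm n x y := by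
  obtain ⟨C, hC0, hC⟩ := _root_.exists_represent_on_submodule
    (V := S) ((trForm n).compl₁₂ S.subtype S.subtype)
    (fun x hx => Subtype.ext (hS x x.2 fun y hy => hx ⟨y, hy⟩))
  refine ⟨C, hC0, fun p ℓ c hc hp h => ?_⟩
  obtain ⟨x, hx, hxy⟩ := hC (p.comap S.subtype) (ℓ ∘ₗ S.subtype) c hc fun y hy => h y hy
  exact ⟨x, x.2, hx, fun y hy => hxy ⟨y, hp hy⟩ hy⟩

theorem TrNondeg.exists_represent_linear {S : Submodule ℝ (CMat n)} (hS : TrNondeg S)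
    (ℓ : CMat n →ₗ[ℝ] ℝ) : ∃ X ∈ S, ∀ Y ∈ S, ℓ Y = trForm n X Y := by
  obtain ⟨C, hC⟩ := exists_represent_of_nondeg
    (V := S) ((trForm n).compl₁₂ S.subtype S.subtype)
    (fun x hx => Subtype.ext (hS x x.2 fun y hy => hx ⟨y, hy⟩))
  obtain ⟨x, -, hx⟩ := hC (LinearMap.toContinuousLinearMap (ℓ ∘ₗ S.subtype))
  exact ⟨x, x.2, fun Y hY => hx ⟨Y, hY⟩⟩

variable {q : GL (Fin n) ℂ} {d : Fin n → ℤ}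

/-- The projection of X to the weights in -A stays in S and, by the pairing of opposite weights, is
orthogonal to all of S, so it vanishes. With A the nonnegative weights this says that the orthogonal
of 𝔭 lies in 𝔫. -/
theorem TrNondeg.mem_wt {S : Submodule ℝ (CMat n)} (hS : TrNondeg S)
    (hh : ∀ X ∈ S, ⁅hd q d, X⁆ ∈ S) {A : Set ℤ} {X : CMat n} (hX : X ∈ S)
    (h0 : ∀ Z ∈ S, Z ∈ wt q d A → trForm n X Z = 0) : X ∈ wt q d {i | -i ∉ A} := by
  have h1 : wtProj q d {i | -i ∈ A} X = 0 := by
    refine hS _ (wtProj_mem_of_lie_mem hh hX) fun Y hY => ?_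
    rw [trForm_apply, trace_wtProj_mul, ← trForm_apply]
    have : {i : ℤ | -i ∈ {i : ℤ | -i ∈ A}} = A := by ext; simp
    rw [this]
    exact h0 _ (wtProj_mem_of_lie_mem hh hY) (wtProj_mem Y)
  refine mem_wt_of_wtProj_compl_eq_zero ?_
  convert h1 using 2
  congr 1
  ext i; simp

theorem trForm_eq_zero_of_wt {A A' : Set ℤ} {X Y : CMat n} (hX : X ∈ wt q d A)
    (hY : Y ∈ wt q d A') (h : ∀ i ∈ A, -i ∉ A') : trForm n X Y = 0 := by
  have h1 : X = wtProj q d A X := by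
    refine sub_eq_zero.1 (eq_zero_of_mem_wt_of_disjoint
      ((wt q d A).sub_mem hX (wtProj_mem X)) (sub_wtProj_mem X) disjoint_compl_right)
  have h2 : wtProj q d {i | -i ∈ A} Y = 0 :=
    eq_zero_of_mem_wt_of_disjoint (wtProj_mem Y) (wtProj_mem_wt hY)
      (Set.disjoint_left.2 fun i hi hi' => h (-i) hi (by simpa using hi'))
  rw [h1, trForm_apply, trace_wtProj_mul, h2]; simp

/-- For an even `𝔰𝔩₂`-triple, `ad e` maps the nonnegative part onto the positive part. -/
theorem exists_lie_eq_of_even {S : Submodule ℝ (CMat n)} (hS : TrNondeg S)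
    (hlie : ∀ X ∈ S, ∀ Y ∈ S, ⁅X, Y⁆ ∈ S) {e f : CMat n} (t : IsSl2Triple (hd q d) e f)
    (hhS : hd q d ∈ S) (heS : e ∈ S) (heven : ∀ X ∈ S, X ∈ wt q d {i | Even i})
    {y : CMat n} (hy : y ∈ S) (hyw : y ∈ wt q d (Set.Ioi 0)) :
    ∃ Z ∈ S, Z ∈ wt q d (Set.Ici 0) ∧ ⁅Z, e⁆ = y := by
  let p : Submodule ℝ (CMat n) := S ⊓ (wt q d (Set.Ici 0)).restrictScalars ℝ
  let im : Submodule ℝ (CMat n) := p.map (LieAlgebra.ad ℝ (CMat n) e : Module.End ℝ (CMat n))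
  by_cases hyim : y ∈ im
  · obtain ⟨Z, hZ, hZy⟩ := hyim
    refine ⟨-Z, S.neg_mem hZ.1, (wt q d _).neg_mem hZ.2, ?_⟩
    rw [neg_lie, lie_skew]; exact hZy
  exfalso
  -- A functional separating y from [e, 𝔭] is represented by some X in S; the aim is to show that X
  -- has only nonnegative weights, which makes it orthogonal to y.
  obtain ⟨ℓ, hℓy, hℓ⟩ := Submodule.exists_le_ker_of_notMem hyim
  obtain ⟨X, hX, hXℓ⟩ := hS.exists_represent_linear ℓ
  have he2 := mem_wt_two t
  have h1 : ∀ Z ∈ S, Z ∈ wt q d (Set.Ici 0) → trForm n ⁅X, e⁆ Z = 0 := fun Z hZ hZw => by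
    rw [trForm_lie, ← hXℓ _ (hlie _ heS _ hZ)]
    exact hℓ ⟨Z, ⟨hZ, hZw⟩, rfl⟩
  have h2 := hS.mem_wt (hlie _ hhS) (hlie _ hX _ heS) h1
  set X' := wtProj q d (Set.Iio 0) X with hX'
  have hX'S : X' ∈ S := wtProj_mem_of_lie_mem (hlie _ hhS) hX
  have hXw : X - X' ∈ wt q d (Set.Ici 0) :=
    wt_mono (fun i hi => by simpa using hi) (sub_wtProj_mem (A := Set.Iio 0) X)
  -- Evenness enters here: there is no weight -1, so [X', e] has weights ≤ 0. As it also has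
  -- positive weights, it vanishes, and the centralizer of e contains nothing of negative weight.
  have hX'w : X' ∈ wt q d (Set.Iic (-2)) := by
    refine wt_mono (fun i hi => ?_) (mem_wt_inter (wtProj_mem (A := Set.Iio 0) X) (heven _ hX'S))
    obtain ⟨k, hk⟩ := hi.2
    have := Set.mem_Iio.1 hi.1
    rw [Set.mem_Iic]; omega
  have h3 : ⁅X', e⁆ = 0 := by
    refine eq_zero_of_mem_wt_of_disjoint (A := Set.Iic 0) (A' := Set.Ioi 0) (q := q) (d := d)
      (lie_mem_wt hX'w he2 ?_) ?_ ?_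
    · rintro a ha b rfl
      rw [Set.mem_Iic] at *; omega
    · have : ⁅X', e⁆ = ⁅X, e⁆ - ⁅X - X', e⁆ := by rw [sub_lie]; abel
      rw [this]
      refine (wt q d _).sub_mem (wt_mono (fun i hi => ?_) h2) (lie_mem_wt hXw he2 ?_)
      · simpa using hi
      · rintro a ha b rfl
        rw [Set.mem_Ici] at ha; rw [Set.mem_Ioi]; omega
    · rw [Set.disjoint_left]; intro i hi; simpa using hi
  have h4 : X' = 0 := by
    refine eq_zero_of_mem_wt_of_disjoint hX'w (mem_wt_of_lie_eq_zero t
      (by rw [← lie_skew, h3, neg_zero])) ?_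
    rw [Set.disjoint_left]; intro i hi hi'; rw [Set.mem_Iic] at hi; rw [Set.mem_Ici] at hi'; omega
  rw [h4, sub_zero] at hXw
  refine hℓy ?_
  rw [hXℓ y hy]
  refine trForm_eq_zero_of_wt hXw hyw fun i hi hi' => ?_
  rw [Set.mem_Ici] at hi; rw [Set.mem_Ioi] at hi'; omega

end TraceForm

/-! ### Open orbits from surjectivity of the infinitesimal action -/

section OpenOrbit

open NormedSpace Topology

/-- If `[𝔭, x] = 𝔫` and the map `Z ↦ exp Z * x * exp (-Z)` takes `𝔭` to `𝔫`, then its image contains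
a neighbourhood of `x` in `𝔫`. -/
theorem eventually_exists_exp_conj_eq {𝔸 : Type*} [NormedRing 𝔸] [NormedAlgebra ℝ 𝔸]
    [FiniteDimensional ℝ 𝔸] {p N : Submodule ℝ 𝔸} {x : 𝔸} (hx : x ∈ N)
    (hFN : ∀ Z ∈ p, exp Z * x * exp (-Z) ∈ N)
    (hsurj : ∀ y ∈ N, ∃ Z ∈ p, Z * x - x * Z = y) :
    ∀ᶠ y in 𝓝[(N : Set 𝔸)] x, ∃ Z ∈ p, y = exp Z * x * exp (-Z) := by
  have : CompleteSpace 𝔸 := FiniteDimensional.complete ℝ 𝔸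
  obtain ⟨π, hπ⟩ := Submodule.ClosedComplemented.of_finiteDimensional N
  let F : p → 𝔸 := fun Z => exp (Z : 𝔸) * x * exp (-(Z : 𝔸))
  have hsub : HasStrictFDerivAt (fun Z : p => (Z : 𝔸)) p.subtypeL 0 :=
    p.subtypeL.hasStrictFDerivAt
  have hexp : HasStrictFDerivAt (fun Z : p => exp (Z : 𝔸)) p.subtypeL 0 := by
    have h1 : HasStrictFDerivAt (exp : 𝔸 → 𝔸) (1 : 𝔸 →L[ℝ] 𝔸)
      ((0 : p) : 𝔸) := hasStrictFDerivAt_exp_zero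
    exact h1.comp (0 : p) hsub
  have hexp' : HasStrictFDerivAt (fun Z : p => exp (-(Z : 𝔸))) (-p.subtypeL) 0 := by
    have h1 : HasStrictFDerivAt (exp : 𝔸 → 𝔸) (1 : 𝔸 →L[ℝ] 𝔸)
      (-((0 : p) : 𝔸)) := by
      rw [ZeroMemClass.coe_zero, neg_zero]; exact hasStrictFDerivAt_exp_zero
    exact h1.comp (0 : p) hsub.neg
  have hF := (hexp.mul_const' x).mul' hexp'
  have hG := (π.hasStrictFDerivAt (x := F 0)).comp (0 : p) hF
  have hG' : ∀ Z : p, π (F Z) = ⟨F Z, hFN Z Z.2⟩ := fun Z => hπ ⟨F Z, hFN Z Z.2⟩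
  -- The derivative of the orbit map at 0 is Z ↦ [Z, x]. The projection π gives it values in N,
  -- where it is onto.
  have hmap := hG.map_nhds_eq_of_surj (by
    refine LinearMap.range_eq_top.2 fun y => ?_
    obtain ⟨Z, hZ, hZy⟩ := hsurj y y.2
    refine ⟨⟨Z, hZ⟩, ?_⟩
    rw [← hπ y, ← hZy]
    simp [sub_eq_add_neg, add_comm])
  have hev : ∀ᶠ y in 𝓝 (⟨x, hx⟩ : N), ∃ Z : p, π (F Z) = y := by
    have h0 : π (F 0) = ⟨x, hx⟩ := by rw [hG']; ext1; simp [F]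
    rw [← h0]
    exact hmap ▸ Filter.range_mem_map
  have h3 : ∀ᶠ y : N in 𝓝 (⟨x, hx⟩ : N), ∃ Z ∈ p, (y : 𝔸) = exp Z * x * exp (-Z) := by
    filter_upwards [hev] with y ⟨Z, hZ⟩
    refine ⟨Z, Z.2, ?_⟩
    rw [← hZ, hG']
  rw [← map_nhds_subtype_val (⟨x, hx⟩ : N)]
  exact h3

open Matrix.Norms.Operator in
/-- If `[𝔭, x] = 𝔫` and `𝔫` is `𝔭`-stable, then the `exp 𝔭`-orbit of `x` contains a neighbourhood
of `x` in `𝔫`. -/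
theorem eventually_exists_Ad_expG_eq {n : ℕ} {p N : Submodule ℝ (CMat n)} {x : CMat n} (hx : x ∈ N)
    (hp : ∀ Z ∈ p, ∀ y ∈ N, ⁅Z, y⁆ ∈ N) (hsurj : ∀ y ∈ N, ∃ Z ∈ p, ⁅Z, x⁆ = y) :
    ∀ᶠ y in 𝓝[(N : Set (CMat n))] x, ∃ Z ∈ p, y = Ad (expG Z) x :=
  eventually_exists_exp_conj_eq (p := p) hx (fun Z hZ => Ad_expG_mem (hp Z hZ) hx) hsurj

end OpenOrbit

/-! ### Flags of a hyperbolic element and traces on them -/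

section FlagProjections

open Matrix.Norms.Operator

variable {n : ℕ}

/-- The two relations say that the idempotents have the same range, and both sides are the trace of
Z on this invariant subspace. -/
theorem trace_mul_eq_of_same_range {P Q Z : CMat n} (hPQ : P * Q = Q) (hQP : Q * P = P)
    (hZ : P * Z * P = Z * P) : (Z * P).trace = (Z * Q).trace := by
  have h1 : Z * Q = P * (Z * Q) := by
    calc Z * Q = (Z * P) * Q := by rw [mul_assoc, hPQ]
      _ = P * (Z * (P * Q)) := by rw [← hZ]; noncomm_ring
      _ = P * (Z * Q) := by rw [hPQ]
  rw [h1, Matrix.trace_mul_comm P (Z * Q), mul_assoc, hQP]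

/-- The determinant condition says that k maps the range of 1 - P to a complement of the range of P.
Both subspaces are Z-invariant, so the trace of Z is the sum of its traces on them. -/
theorem trace_mul_eq_of_opposite {P Z : CMat n} (k : GL (Fin n) ℂ) (hP : P * P = P)
    (hdet : ((1 - P) * k * (1 - P) + P).det ≠ 0) (hZ : P * Z * P = Z * P)
    (hZ' : Ad k (1 - P) * Z * Ad k (1 - P) = Z * Ad k (1 - P)) :
    (Z * P).trace = (Z * Ad k P).trace := by
  set N := 1 - P with hN
  have hPN : P * N = 0 := by rw [hN, mul_sub, hP, mul_one, sub_self]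
  have hNP : N * P = 0 := by rw [hN, sub_mul, hP, one_mul, sub_self]
  have hNN : N * N = N := by
    nth_rewrite 1 [hN]; rw [sub_mul, one_mul, hPN, sub_zero]
  set A := N * k * N + P with hA
  have hu : IsUnit A.det := isUnit_iff_ne_zero.2 hdet
  have hAN : A * N = N * k * N := by rw [hA, add_mul, hPN, add_zero, mul_assoc, hNN]
  have hAP : A * P = P := by rw [hA, add_mul, mul_assoc, hNP, mul_zero, zero_add, hP]
  have hPA : P * A = P := by
    rw [hA, mul_add, ← mul_assoc, ← mul_assoc, hPN, zero_mul, zero_mul, zero_add, hP]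
  have hPA' : P * A⁻¹ = P := by
    nth_rewrite 1 [← hPA]; rw [mul_assoc, Matrix.mul_nonsing_inv _ hu, mul_one]
  -- This is the projection onto the range of `Ad k N` with kernel the range of P.
  set S := (k : CMat n) * N * A⁻¹ * N with hS
  have hkk : ((k⁻¹ : GL (Fin n) ℂ) : CMat n) * k = 1 := by rw [← Units.val_mul]; simp
  have hSN' : S * Ad k N = Ad k N := by
    calc S * Ad k N = k * N * A⁻¹ * (N * k * N) * ((k⁻¹ : GL (Fin n) ℂ) : CMat n) := by
          rw [hS, Ad_apply]; noncomm_ring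
      _ = k * N * (A⁻¹ * A) * N * ((k⁻¹ : GL (Fin n) ℂ) : CMat n) := by
          rw [← hAN]; noncomm_ring
      _ = k * (N * N) * ((k⁻¹ : GL (Fin n) ℂ) : CMat n) := by
          rw [Matrix.nonsing_inv_mul _ hu]; noncomm_ring
      _ = _ := by rw [hNN, Ad_apply]
  have hN'S : Ad k N * S = S := by
    calc Ad k N * S = k * N * (((k⁻¹ : GL (Fin n) ℂ) : CMat n) * k) * N * A⁻¹ * N := by
          rw [hS, Ad_apply]; noncomm_ring
      _ = k * (N * N) * A⁻¹ * N := by rw [hkk]; noncomm_ring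
      _ = S := by rw [hNN]
  have hSP : S * P = 0 := by rw [hS, mul_assoc, hNP, mul_zero]
  have hNS : N * S = N := by
    calc N * S = (N * k * N) * A⁻¹ * N := by rw [hS]; noncomm_ring
      _ = (A - P) * A⁻¹ * N := by rw [hA, add_sub_cancel_right]
      _ = A * A⁻¹ * N - P * A⁻¹ * N := by noncomm_ring
      _ = N := by rw [Matrix.mul_nonsing_inv _ hu, hPA', hPN, one_mul, sub_zero]
  have h1 : (Z * P).trace = (Z * (1 - S)).trace := by
    refine trace_mul_eq_of_same_range ?_ ?_ hZ
    · have : P * (1 - S) = (1 - S) - (N - N * S) := by rw [hN]; noncomm_ring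
      rw [this, hNS, sub_self, sub_zero]
    · rw [sub_mul, hSP, one_mul, sub_zero]
  have h2 : (Z * Ad k N).trace = (Z * S).trace := trace_mul_eq_of_same_range hN'S hSN' hZ'
  have h3 : Ad k N = 1 - Ad k P := by rw [hN, map_sub, map_one]
  rw [h3, mul_sub, mul_one, Matrix.trace_sub] at h2
  rw [h1, mul_sub, mul_one, Matrix.trace_sub, ← h2, sub_sub_cancel]

/-- A bound for the trace of a matrix on an invariant subspace. -/
theorem norm_trace_mul_le {P Z : CMat n} (hZ : P * Z * P = Z * P) :
    ‖(Z * P).trace‖ ≤ n * ‖Z‖ := by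
  -- An eigenvector for a nonzero eigenvalue lies in the range of P, so it is an eigenvector of Z
  -- and the operator norm bounds μ. No bound on ‖P‖ is needed, which gives uniformity over the
  -- orbit.
  have hroot : ∀ μ ∈ (Z * P).charpoly.roots, ‖μ‖ ≤ ‖Z‖ := by
    intro μ hμ
    have h1 := (Polynomial.mem_roots'.1 hμ).2
    rw [Polynomial.IsRoot, Matrix.eval_charpoly] at h1
    obtain ⟨v, hv, hv'⟩ := Matrix.exists_mulVec_eq_zero_iff.2 h1
    rw [Matrix.sub_mulVec, sub_eq_zero] at hv'
    have h2 : (Z * P).mulVec v = μ • v := by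
      rw [← hv']; simp [Matrix.scalar_apply, ← Matrix.smul_one_eq_diagonal, Matrix.smul_mulVec]
    by_cases hμ0 : μ = 0
    · rw [hμ0, norm_zero]; exact norm_nonneg _
    have h3 : P.mulVec v = v := by
      have : P.mulVec (μ • v) = μ • v := by
        rw [← h2, Matrix.mulVec_mulVec, ← mul_assoc, hZ]
      rw [Matrix.mulVec_smul] at this
      exact smul_right_injective _ hμ0 this
    rw [← Matrix.mulVec_mulVec, h3] at h2
    have h4 := Matrix.linfty_opNorm_mulVec Z v
    rw [h2, norm_smul] at h4
    exact le_of_mul_le_mul_right h4 (norm_pos_iff.2 hv)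
  rw [Matrix.trace_eq_sum_roots_charpoly]
  have hcard : ((Z * P).charpoly.roots).card ≤ n := by
    refine (Polynomial.card_roots' _).trans ?_
    rw [Matrix.charpoly_natDegree_eq_dim, Fintype.card_fin]
  have hsum : ∀ s : Multiset ℂ, (∀ μ ∈ s, ‖μ‖ ≤ ‖Z‖) → ‖s.sum‖ ≤ s.card * ‖Z‖ := by
    intro s
    induction s using Multiset.induction_on with
    | empty => intro; simp
    | cons a s ih =>
      intro h
      rw [Multiset.sum_cons, Multiset.card_cons]
      push_cast
      have h1 := h a (Multiset.mem_cons_self a s)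
      have h2 := ih fun μ hμ => h μ (Multiset.mem_cons_of_mem hμ)
      linarith [norm_add_le a s.sum]
  refine (hsum _ hroot).trans (mul_le_mul_of_nonneg_right ?_ (norm_nonneg _))
  exact_mod_cast hcard

/-- The projection onto the sum of the eigenspaces of `hd q d` with eigenvalues at least `c`. -/
def flagProj (q : GL (Fin n) ℂ) (d : Fin n → ℤ) (c : ℤ) : CMat n :=
  Ad q (Matrix.diagonal fun j => if c ≤ d j then 1 else 0)

variable {q : GL (Fin n) ℂ} {d : Fin n → ℤ}

theorem Ad_flagProj (g : GL (Fin n) ℂ) (c : ℤ) : Ad g (flagProj q d c) = flagProj (g * q) d c := by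
  rw [flagProj, flagProj, Ad_mul]

theorem flagProj_mul_self (c : ℤ) : flagProj q d c * flagProj q d c = flagProj q d c := by
  rw [flagProj, ← map_mul, Matrix.diagonal_mul_diagonal]
  congr 2; ext j; split_ifs <;> simp

/-- Each eigenvalue is -M plus the number of levels c in (-M, M] not exceeding it. Pairing with h is
thereby reduced to traces on the flag. -/
theorem hd_eq_sum_flagProj {M : ℤ} (hM : ∀ j, |d j| ≤ M) :
    hd q d = (-M : ℂ) • 1 + ∑ c ∈ Finset.Ioc (-M) M, flagProj q d c := by
  simp only [flagProj]
  rw [← map_sum, ← map_one (Ad q), ← map_smul, ← map_add, hd]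
  congr 1
  ext i j
  by_cases hij : i = j
  · subst hij
    have h1 := hM i
    rw [abs_le] at h1
    have h2 : (Finset.Ioc (-M) M).filter (fun c => c ≤ d i) = Finset.Ioc (-M) (d i) := by
      ext c; simp only [Finset.mem_filter, Finset.mem_Ioc]; omega
    have h3 : ((Finset.Ioc (-M) (d i)).card : ℤ) = d i + M := by
      rw [Int.card_Ioc]; omega
    have h4 : ((Finset.Ioc (-M) (d i)).card : ℂ) = d i + M := by exact_mod_cast h3
    simp [Matrix.sum_apply, h2]
    rw [show ((d i + M).toNat : ℂ) = d i + M by rw [← h4]; simp]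
    ring
  · simp [Matrix.sum_apply, hij]

theorem flagProj_mul_mul_self {Z : CMat n} (hZ : Z ∈ wt q d (Set.Ici 0)) (c : ℤ) :
    flagProj q d c * Z * flagProj q d c = Z * flagProj q d c := by
  refine ext_Ad_inv (q := q) fun j l => ?_
  simp only [flagProj, map_mul, Ad_inv_Ad, Matrix.mul_diagonal, Matrix.diagonal_mul]
  by_cases h0 : Ad q⁻¹ Z j l = 0
  · rw [h0]; simp
  · have := hZ j l h0
    rw [Set.mem_Ici] at this
    by_cases h1 : c ≤ d l
    · rw [if_pos h1, if_pos (by omega), one_mul]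
    · rw [if_neg h1, mul_zero, mul_zero]

theorem one_sub_flagProj_mul_mul_self {Z : CMat n} (hZ : Z ∈ wt q d (Set.Iic 0)) (c : ℤ) :
    (1 - flagProj q d c) * Z * (1 - flagProj q d c) = Z * (1 - flagProj q d c) := by
  have h1 : 1 - flagProj q d c = Ad q (Matrix.diagonal fun j => if c ≤ d j then 0 else 1) := by
    rw [flagProj, ← map_one (Ad q), ← map_sub, ← Matrix.diagonal_one, Matrix.diagonal_sub]
    congr 2; ext j; split_ifs <;> simp
  rw [h1]
  refine ext_Ad_inv (q := q) fun j l => ?_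
  simp only [map_mul, Ad_inv_Ad, Matrix.mul_diagonal, Matrix.diagonal_mul]
  by_cases h0 : Ad q⁻¹ Z j l = 0
  · rw [h0]; simp
  · have := hZ j l h0
    rw [Set.mem_Iic] at this
    by_cases h1 : c ≤ d l
    · rw [if_pos h1, mul_zero, mul_zero]
    · rw [if_neg h1, if_neg (by omega), one_mul]

theorem exists_abs_le (d : Fin n → ℤ) : ∃ M : ℤ, 0 ≤ M ∧ ∀ j, |d j| ≤ M :=
  ⟨∑ j, |d j|, Finset.sum_nonneg fun _ _ => abs_nonneg _, fun j =>
    Finset.single_le_sum (f := fun j => |d j|) (fun _ _ => abs_nonneg _) (Finset.mem_univ j)⟩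

/-- The elements of the orbit of `hd q d` lie within bounded distance of the nilradicals of the
parabolic subalgebras attached to them. -/
theorem exists_dist_nilradical_le {S : Submodule ℝ (CMat n)} (hS : TrNondeg S)
    (hlie : ∀ X ∈ S, ∀ Y ∈ S, ⁅X, Y⁆ ∈ S) :
    ∃ C : ℝ, 0 ≤ C ∧ ∀ g : GL (Fin n) ℂ, hd (g * q) d ∈ S →
      ∃ N ∈ S, N ∈ wt (g * q) d (Set.Ioi 0) ∧ ‖hd (g * q) d - N‖ ≤ C := by
  obtain ⟨C, hC0, hC⟩ := hS.exists_represent_on_submodule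
  obtain ⟨M, hM0, hM⟩ := exists_abs_le d
  -- One bound n‖Z‖ for each flag projection, and M times the same bound for the scalar term.
  set K : ℝ := M * n + (Finset.Ioc (-M) M).card * n with hK
  have hM0' : (0 : ℝ) ≤ M := by exact_mod_cast hM0
  have hK0 : 0 ≤ K := by positivity
  refine ⟨C * K, mul_nonneg hC0 hK0, fun g hg => ?_⟩
  obtain ⟨x, hx, hxn, hxZ⟩ := hC (S ⊓ (wt (g * q) d (Set.Ici 0)).restrictScalars ℝ)
    (trForm n (hd (g * q) d)) K hK0 inf_le_left (fun Z hZ => by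
      have hZw : Z ∈ wt (g * q) d (Set.Ici 0) := hZ.2
      have h1 : ‖Z.trace‖ ≤ n * ‖Z‖ := by
        simpa using norm_trace_mul_le (P := 1) (Z := Z) (by simp)
      have h2 : ‖(hd (g * q) d * Z).trace‖ ≤ K * ‖Z‖ := by
        rw [hd_eq_sum_flagProj hM, add_mul, Finset.sum_mul, Matrix.trace_add, Matrix.trace_sum,
          smul_mul_assoc, one_mul, Matrix.trace_smul]
        refine (norm_add_le _ _).trans ?_
        rw [hK, add_mul]
        refine add_le_add ?_ ?_
        · rw [norm_smul, norm_neg, Complex.norm_intCast, abs_of_nonneg hM0', mul_assoc]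
          exact mul_le_mul_of_nonneg_left h1 hM0'
        · refine (norm_sum_le_of_le (f := fun c => (flagProj (g * q) d c * Z).trace)
            (n := fun _ => n * ‖Z‖) _ fun c _ => ?_).trans ?_
          · rw [Matrix.trace_mul_comm]
            exact norm_trace_mul_le (flagProj_mul_mul_self hZw c)
          · rw [Finset.sum_const, nsmul_eq_mul, mul_assoc]
      exact (Complex.abs_re_le_norm _).trans h2)
  refine ⟨hd (g * q) d - x, S.sub_mem hg hx, ?_, by rwa [sub_sub_cancel]⟩
  refine wt_mono (fun i hi => ?_) (hS.mem_wt (A := Set.Ici 0) (hlie _ hg) (S.sub_mem hg hx)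
    fun Z hZ hZw => ?_)
  · simpa using hi
  · rw [map_sub, LinearMap.sub_apply, hxZ Z ⟨hZ, hZw⟩, sub_self]

end FlagProjections

/-! ### Density of the real group in its complexification -/

section ZariskiDensity

open Matrix.Norms.Operator NormedSpace

variable {n : ℕ} {GR G : Subgroup (GL (Fin n) ℂ)} {𝔤R : LieSubalgebra ℝ (CMat n)}

theorem mem_complexSpan {Z : CMat n} :
    Z ∈ complexSpan 𝔤R ↔ ∃ X ∈ 𝔤R, ∃ Y ∈ 𝔤R, Z = X + Complex.I • Y := Iff.rfl

theorem mem_complexSpan_of_mem {X : CMat n} (hX : X ∈ 𝔤R) : X ∈ complexSpan 𝔤R :=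
  (toComplexSpan ⟨X, hX⟩).2

theorem eq_zero_of_entire_of_real {f : ℂ → ℂ} (hf : Differentiable ℂ f)
    (h0 : ∀ t : ℝ, f t = 0) (z : ℂ) : f z = 0 := by
  have h1 : AnalyticOnNhd ℂ f Set.univ := fun w _ => hf.analyticAt w
  have h2 : ∃ᶠ w in nhdsWithin (0 : ℂ) {0}ᶜ, f w = (fun _ => (0 : ℂ)) w := by
    have ht : Filter.Tendsto (fun k : ℕ => (((k : ℝ) + 1)⁻¹ : ℝ)) Filter.atTop
        (nhds 0) := by
      simpa using tendsto_one_div_add_atTop_nhds_zero_nat (𝕜 := ℝ)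
    have ht2 : Filter.Tendsto (fun k : ℕ => ((((k : ℝ) + 1)⁻¹ : ℝ) : ℂ)) Filter.atTop
        (nhdsWithin (0 : ℂ) {0}ᶜ) := by
      refine tendsto_nhdsWithin_iff.2 ⟨?_, Filter.Eventually.of_forall fun k => ?_⟩
      · exact (Complex.continuous_ofReal.tendsto' 0 0 Complex.ofReal_zero).comp ht
      · have : ((k : ℝ) + 1)⁻¹ ≠ 0 := by positivity
        exact Set.mem_compl_singleton_iff.2 (Complex.ofReal_ne_zero.2 this)
    exact ht2.frequently (Filter.Frequently.of_forall fun k => h0 _)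
  exact congrFun (h1.eq_of_frequently_eq (analyticOnNhd_const) h2) z

theorem differentiable_exp_add_smul (X Y : CMat n) :
    Differentiable ℂ fun t : ℂ => exp (X + t • Y) := by
  intro t
  have h1 : DifferentiableAt ℂ (exp : CMat n → CMat n) (X + t • Y) :=
    (exp_analytic (𝕂 := ℂ) (X + t • Y)).differentiableAt
  exact h1.comp t ((differentiableAt_const X).add (differentiableAt_id.smul_const Y))

/-- A holomorphic function of matrices vanishing on `GR` vanishes on the complexification `G`. -/
theorem eq_zero_of_eq_zero_on_real (hGR : IsConnectedLieSubgroup GR 𝔤R.toSubmodule)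
    (hG : IsComplexification 𝔤R G) {Φ : CMat n → ℂ} (hΦ : Differentiable ℂ Φ)
    (h0 : ∀ r ∈ GR, Φ r = 0) {g : GL (Fin n) ℂ} (hg : g ∈ G) : Φ g = 0 := by
  obtain ⟨l, hl, hl'⟩ := hG.connected.eq_prod_exp g hg
  have main : ∀ l : List (CMat n), (∀ X ∈ l, X ∈ complexSpan 𝔤R) → ∀ r ∈ GR,
      Φ (r * (l.map exp).prod) = 0 := by
    intro l
    induction l with
    | nil => intro _ r hr; simpa using h0 r hr
    | cons Z l ih =>
      intro hl r hr
      obtain ⟨X, hX, Y, hY, rfl⟩ := mem_complexSpan.1 (hl Z (by simp))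
      have hd : Differentiable ℂ fun t : ℂ =>
          Φ (r * (exp (X + t • Y) * (l.map exp).prod)) :=
        hΦ.comp (((differentiable_exp_add_smul X Y).mul_const _).const_mul _)
      rw [List.map_cons, List.prod_cons]
      -- For real t the factor exp(X + tY) can be absorbed into the element of GR; the value t = i
      -- is the required one.
      refine eq_zero_of_entire_of_real hd (fun t => ?_) Complex.I
      have hXY : X + (t : ℂ) • Y ∈ 𝔤R.toSubmodule := by
        have : (t : ℂ) • Y = t • Y := by ext; simp
        rw [this]; exact 𝔤R.add_mem hX (𝔤R.smul_mem t hY)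
      rw [← mul_assoc]
      have := ih (fun W hW => hl W (by simp [hW])) (r * expG (X + (t : ℂ) • Y))
        (mul_mem hr (hGR.expG_mem hXY))
      simpa using this
  rw [hl']
  simpa using main l hl 1 (one_mem _)

theorem differentiable_det : Differentiable ℂ fun M : CMat n => M.det := by
  have hentry : ∀ i j, Differentiable ℂ fun M : CMat n => M i j := fun i j =>
    (Matrix.entryLinearMap ℂ ℂ i j : CMat n →ₗ[ℂ] ℂ).toContinuousLinearMap.differentiable
  simp only [Matrix.det_apply]
  fun_prop

theorem differentiable_prod {ι : Type*} {F : ι → CMat n → ℂ} {T : Finset ι}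
    (h : ∀ c ∈ T, Differentiable ℂ (F c)) : Differentiable ℂ fun M => ∏ c ∈ T, F c M := by
  classical
  induction T using Finset.induction_on with
  | empty => simp
  | insert a T ha ih =>
    simp only [Finset.prod_insert ha]
    exact (h a (by simp)).mul (ih fun c hc => h c (by simp [hc]))

variable {q : GL (Fin n) ℂ} {d : Fin n → ℤ}

/-- Some element of `GR` moves the opposite of a real flag to a flag opposite to a given flag. -/
theorem exists_real_opposite (hGR : IsConnectedLieSubgroup GR 𝔤R.toSubmodule)
    (hG : IsComplexification 𝔤R G) {g₀ : GL (Fin n) ℂ} (hg₀ : g₀ ∈ G) (T : Finset ℤ) :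
    ∃ r ∈ GR, ∀ c ∈ T, ((1 - flagProj q d c) * ((g₀⁻¹ * r : GL (Fin n) ℂ) : CMat n) *
      (1 - flagProj q d c) + flagProj q d c).det ≠ 0 := by
  by_contra! hcon
  let Φ : CMat n → ℂ := fun M => ∏ c ∈ T, ((1 - flagProj q d c) *
    (((g₀⁻¹ : GL (Fin n) ℂ) : CMat n) * M) * (1 - flagProj q d c) + flagProj q d c).det
  have hΦ : Differentiable ℂ Φ := by
    have hc : ∀ c ∈ T, Differentiable ℂ fun M : CMat n => ((1 - flagProj q d c) *
        (((g₀⁻¹ : GL (Fin n) ℂ) : CMat n) * M) * (1 - flagProj q d c) + flagProj q d c).det :=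
      fun c _ => differentiable_det.comp (Differentiable.add_const _
        (((differentiable_id.const_mul _).const_mul _).mul_const _))
    exact differentiable_prod hc
  -- Transversality holds at r = g₀, where every determinant is 1, so it cannot fail on the whole of
  -- GR.
  have h1 : Φ g₀ = 0 := eq_zero_of_eq_zero_on_real hGR hG hΦ (fun r hr => by
    obtain ⟨c, hc, hc0⟩ := hcon r hr
    exact Finset.prod_eq_zero hc (by rwa [Units.val_mul] at hc0)) hg₀
  obtain ⟨c, -, hc⟩ := Finset.prod_eq_zero_iff.1 h1
  rw [← Units.val_mul, inv_mul_cancel, Units.val_one, mul_one] at hc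
  have : (1 - flagProj q d c) * (1 - flagProj q d c) + flagProj q d c = 1 := by
    have := flagProj_mul_self (q := q) (d := d) c
    rw [sub_mul, one_mul, mul_sub, mul_one, this]; abel
  rw [this, Matrix.det_one] at hc
  exact one_ne_zero hc

end ZariskiDensity

/-! ### Conjugacy of real hyperbolic elements -/

section RealConjugacy

variable {n : ℕ} {GR G : Subgroup (GL (Fin n) ℂ)} {𝔤R : LieSubalgebra ℝ (CMat n)}
variable {q : GL (Fin n) ℂ} {d : Fin n → ℤ}

/-- A real functional vanishing on `p ⊓ p'` is a sum of functionals vanishing on `p` and `p'`;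
expressed with a nondegenerate trace form. -/
theorem TrNondeg.exists_add_of_inf {S p p' : Submodule ℝ (CMat n)} (hS : TrNondeg S)
    (hp : p ≤ S) (hp' : p' ≤ S) {X : CMat n} (hX : X ∈ S)
    (h : ∀ Z ∈ p ⊓ p', trForm n X Z = 0) :
    ∃ u ∈ S, ∃ u' ∈ S, X = u + u' ∧ (∀ Z ∈ p, trForm n u Z = 0) ∧
      ∀ Z ∈ p', trForm n u' Z = 0 := by
  have h1 : trForm n X ∈ (p ⊓ p').dualAnnihilator :=
    (Submodule.mem_dualAnnihilator _).2 h
  rw [Subspace.dualAnnihilator_inf_eq] at h1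
  obtain ⟨ℓ, hℓ, ℓ', hℓ', hsum⟩ := Submodule.mem_sup.1 h1
  obtain ⟨u, hu, huℓ⟩ := hS.exists_represent_linear ℓ
  obtain ⟨u', hu', huℓ'⟩ := hS.exists_represent_linear ℓ'
  refine ⟨u, hu, u', hu', ?_, fun Z hZ => ?_, fun Z hZ => ?_⟩
  · refine sub_eq_zero.1 (hS _ (S.sub_mem hX (S.add_mem hu hu')) fun Y hY => ?_)
    rw [map_sub, map_add, LinearMap.sub_apply, LinearMap.add_apply, ← huℓ Y hY, ← huℓ' Y hY,
      ← hsum, LinearMap.add_apply, sub_self]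
  · rw [← huℓ Z (hp hZ)]; exact (Submodule.mem_dualAnnihilator _).1 hℓ Z hZ
  · rw [← huℓ' Z (hp' hZ)]; exact (Submodule.mem_dualAnnihilator _).1 hℓ' Z hZ

/-- Translating a real hyperbolic element by its positive part does not leave its orbit. -/
theorem exists_Ad_eq_add_of_mem (hGR : IsConnectedLieSubgroup GR 𝔤R.toSubmodule)
    (hh : hd q d ∈ 𝔤R) {u : CMat n} (hu : u ∈ 𝔤R) (huw : u ∈ wt q d (Set.Ioi 0)) :
    ∃ r ∈ GR, Ad r (hd q d) = hd q d + u := by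
  obtain ⟨r, hr, hr'⟩ := exists_Ad_eq_add
    (N := 𝔤R.toSubmodule ⊓ (wt q d (Set.Ioi 0)).restrictScalars ℝ) (fun X hX => hX.2)
    (fun X hX => ⟨𝔤R.lie_mem hh hX.1, by rw [lie_hd]; exact wtMul_mem_wt _ hX.2⟩)
    (fun X hX Y hY => ⟨𝔤R.lie_mem hX.1 hY.1, lie_mem_wt hX.2 hY.2 fun a ha b hb => by
      rw [Set.mem_Ioi] at *; omega⟩) ⟨hu, huw⟩
  exact ⟨r, hGR.expClosure_le (fun X hX => hX.1) hr, hr'⟩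

/-- Real hyperbolic elements conjugate under the complexification are conjugate under the real
group. -/
theorem exists_real_conj (hGR : IsConnectedLieSubgroup GR 𝔤R.toSubmodule)
    (hG : IsComplexification 𝔤R G) (hS : TrNondeg 𝔤R.toSubmodule) (hh : hd q d ∈ 𝔤R)
    {g₀ : GL (Fin n) ℂ} (hg₀ : g₀ ∈ G) (hh' : Ad g₀ (hd q d) ∈ 𝔤R) :
    ∃ r ∈ GR, Ad r (hd q d) = Ad g₀ (hd q d) := by
  obtain ⟨M, -, hM⟩ := exists_abs_le d
  obtain ⟨r, hr, hopp⟩ := exists_real_opposite (q := q) (d := d) hGR hG hg₀ (Finset.Ioc (-M) M)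
  have hlie : ∀ X ∈ 𝔤R.toSubmodule, ∀ Y ∈ 𝔤R.toSubmodule, ⁅X, Y⁆ ∈ 𝔤R.toSubmodule :=
    fun X hX Y hY => 𝔤R.lie_mem hX hY
  have hhr : Ad r (hd q d) ∈ 𝔤R := hGR.Ad_mem hlie hr hh
  rw [Ad_hd] at hh' hhr
  set p := 𝔤R.toSubmodule ⊓ (wt (g₀ * q) d (Set.Ici 0)).restrictScalars ℝ
  set p' := 𝔤R.toSubmodule ⊓ (wt (r * q) d (Set.Iic 0)).restrictScalars ℝ
  -- An element Z of p ⊓ p' preserves the flags of one element and the opposite flags of the other.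
  -- These are complementary, so the traces against corresponding flag projections agree, hence so
  -- do those against the hyperbolic elements.
  have htr : ∀ Z ∈ p ⊓ p', trForm n (hd (g₀ * q) d - hd (r * q) d) Z = 0 := by
    rintro Z ⟨⟨-, hZ⟩, ⟨-, hZ'⟩⟩
    have hZ : Z ∈ wt (g₀ * q) d (Set.Ici 0) := hZ
    have hZ' : Z ∈ wt (r * q) d (Set.Iic 0) := hZ'
    have hc : ∀ c ∈ Finset.Ioc (-M) M, (flagProj (g₀ * q) d c * Z).trace =
        (flagProj (r * q) d c * Z).trace := by
      intro c hc
      set k : GL (Fin n) ℂ := g₀⁻¹ * r with hk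
      have hrk : r * q = g₀ * (k * q) := by rw [hk]; group
      have h1 := trace_mul_eq_of_opposite (Z := Ad g₀⁻¹ Z) k
        (flagProj_mul_self (q := q) (d := d) c)
        (hopp c hc) (flagProj_mul_mul_self (mem_wt_mul.1 hZ) c) (by
          rw [map_sub, map_one, Ad_flagProj]
          rw [hrk] at hZ'
          exact one_sub_flagProj_mul_mul_self (mem_wt_mul.1 hZ') c)
      rw [Ad_flagProj] at h1
      rw [Matrix.trace_mul_comm, Matrix.trace_mul_comm (flagProj (r * q) d c), hrk,
        ← Ad_flagProj g₀, ← Ad_flagProj g₀, ← trace_Ad g₀⁻¹, ← trace_Ad g₀⁻¹ (Z * _),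
        map_mul, map_mul, Ad_inv_Ad, Ad_inv_Ad]
      exact h1
    rw [trForm_apply, hd_eq_sum_flagProj (q := g₀ * q) hM, hd_eq_sum_flagProj (q := r * q) hM,
      add_sub_add_left_eq_sub, sub_mul, Finset.sum_mul, Finset.sum_mul, Matrix.trace_sub,
      Matrix.trace_sum, Matrix.trace_sum, Finset.sum_congr rfl hc, sub_self, Complex.zero_re]
  obtain ⟨u, hu, u', hu', huu, hup, hup'⟩ := hS.exists_add_of_inf inf_le_left inf_le_left
    (𝔤R.toSubmodule.sub_mem hh' hhr) htr
  have huw : u ∈ wt (g₀ * q) d (Set.Ioi 0) :=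
    wt_mono (fun i hi => by simpa using hi) (hS.mem_wt (A := Set.Ici 0) (hlie _ hh') hu
      fun Z hZ hZw => hup Z ⟨hZ, hZw⟩)
  have huw' : u' ∈ wt (r * q) d (Set.Iio 0) :=
    wt_mono (fun i hi => by simpa using hi) (hS.mem_wt (A := Set.Iic 0) (hlie _ hhr) hu'
      fun Z hZ hZw => hup' Z ⟨hZ, hZw⟩)
  obtain ⟨a, ha, ha'⟩ := exists_Ad_eq_add_of_mem hGR hh' (𝔤R.neg_mem hu)
    ((wt _ _ _).neg_mem huw)
  -- The part of negative weight is positive for the opposite element -h, so the same translation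
  -- lemma applies to it.
  obtain ⟨b, hb, hb'⟩ := exists_Ad_eq_add_of_mem (q := r * q) (d := -d) (u := -u') hGR
    (by rw [hd_neg]; exact 𝔤R.neg_mem hhr) (𝔤R.neg_mem hu') (by
      rw [wt_neg]
      exact wt_mono (fun i hi => by simpa using hi) ((wt _ _ _).neg_mem huw'))
  rw [hd_neg, map_neg, ← neg_add, neg_inj] at hb'
  refine ⟨a⁻¹ * (b * r), mul_mem (inv_mem ha) (mul_mem hb hr), ?_⟩
  have : hd (g₀ * q) d + -u = hd (r * q) d + u' := by
    rw [← sub_eq_add_neg, sub_eq_iff_eq_add, add_assoc, add_comm u', ← huu]; abel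
  rw [Ad_mul, Ad_mul, Ad_hd r, hb', ← this, ← ha', Ad_inv_Ad, Ad_hd]

end RealConjugacy

/-! ### The nilradical lies in the closure of the real points of the orbit -/

section Density

open Topology

variable {n : ℕ} {GR G : Subgroup (GL (Fin n) ℂ)} {𝔤R : LieSubalgebra ℝ (CMat n)}
variable {q : GL (Fin n) ℂ} {d : Fin n → ℤ}

theorem IsComplexification.eq_zero_of_add_I_smul (hG : IsComplexification 𝔤R G) {X Y : CMat n}
    (hX : X ∈ 𝔤R) (hY : Y ∈ 𝔤R) (h : X + Complex.I • Y = 0) : X = 0 ∧ Y = 0 := by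
  have hY0 : Y = 0 := hG.totally_real Y hY (by
    rw [← neg_eq_of_add_eq_zero_right h]; exact 𝔤R.neg_mem hX)
  exact ⟨by simpa [hY0] using h, hY0⟩

theorem IsComplexification.ext_iff (hG : IsComplexification 𝔤R G) {X Y X' Y' : CMat n}
    (hX : X ∈ 𝔤R) (hY : Y ∈ 𝔤R) (hX' : X' ∈ 𝔤R) (hY' : Y' ∈ 𝔤R)
    (h : X + Complex.I • Y = X' + Complex.I • Y') : X = X' ∧ Y = Y' := by
  have := hG.eq_zero_of_add_I_smul (𝔤R.sub_mem hX hX') (𝔤R.sub_mem hY hY') (by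
    rw [smul_sub, sub_add_sub_comm, h, sub_self])
  exact ⟨sub_eq_zero.1 this.1, sub_eq_zero.1 this.2⟩

theorem IsComplexification.mem_wt_of_add (hG : IsComplexification 𝔤R G) (hh : hd q d ∈ 𝔤R)
    {A : Set ℤ} {X Y : CMat n} (hX : X ∈ 𝔤R) (hY : Y ∈ 𝔤R)
    (h : X + Complex.I • Y ∈ wt q d A) : X ∈ wt q d A ∧ Y ∈ wt q d A := by
  have h0 : wtProj q d Aᶜ (X + Complex.I • Y) = 0 :=
    eq_zero_of_mem_wt_of_disjoint (wtProj_mem_wt h) (wtProj_mem _) disjoint_compl_right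
  rw [map_add, map_smul] at h0
  have hm : ∀ X ∈ 𝔤R, wtProj q d Aᶜ X ∈ 𝔤R := fun X hX =>
    wtProj_mem_of_lie_mem (S := 𝔤R.toSubmodule) (fun Y hY => 𝔤R.lie_mem hh hY) hX
  have := hG.eq_zero_of_add_I_smul (hm X hX) (hm Y hY) h0
  exact ⟨mem_wt_of_wtProj_compl_eq_zero this.1, mem_wt_of_wtProj_compl_eq_zero this.2⟩

theorem complexSpan_lie_mem {X Y : CMat n} (hX : X ∈ complexSpan 𝔤R) (hY : Y ∈ complexSpan 𝔤R) :
    ⁅X, Y⁆ ∈ complexSpan 𝔤R := (complexSpan 𝔤R).lie_mem hX hY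

/-- The generic points of the line through `x` and `e` in the nilradical lie in the orbit of
`e`. -/
theorem exists_finite_forall_line_mem_orbit (hG : IsComplexification 𝔤R G)
    {p N : Submodule ℂ (CMat n)}
    (hp : ∀ Z ∈ p, Z ∈ complexSpan 𝔤R) (hpN : ∀ Z ∈ p, ∀ y ∈ N, ⁅Z, y⁆ ∈ N)
    {e : CMat n} (he : e ∈ N) (hsurj : ∀ y ∈ N, ∃ Z ∈ p, ⁅Z, e⁆ = y) {x : CMat n} (hx : x ∈ N) :
    ∃ T : Set ℂ, T.Finite ∧ ∀ t ∉ T, x + t • (e - x) ∈ adjointOrbit G e := by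
  let ade : p →ₗ[ℂ] N :=
    { toFun := fun Z => ⟨⁅(Z : CMat n), e⁆, hpN Z Z.2 e he⟩
      map_add' := fun Z Z' => Subtype.ext (by simp [add_lie])
      map_smul' := fun c Z => Subtype.ext (by simp [smul_lie]) }
  obtain ⟨s, hs⟩ := ade.exists_rightInverse_of_surjective (LinearMap.range_eq_top.2 fun y => by
    obtain ⟨Z, hZ, hZy⟩ := hsurj y y.2
    exact ⟨⟨Z, hZ⟩, Subtype.ext hZy⟩)
  have hse : ∀ u : N, ⁅(s u : CMat n), e⁆ = u := fun u =>
    congrArg Subtype.val (LinearMap.congr_fun hs u)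
  let B : Module.End ℂ N :=
    { toFun := fun u => ⟨⁅(s u : CMat n), x⁆, hpN _ (s u).2 x hx⟩
      map_add' := fun Z Z' => Subtype.ext (by simp [add_lie])
      map_smul' := fun c Z => Subtype.ext (by simp [smul_lie]) }
  let xt : ℂ → CMat n := fun t => x + t • (e - x)
  have hxt : ∀ t, xt t ∈ N := fun t => N.add_mem hx (N.smul_mem t (N.sub_mem he hx))
  -- With s a linear right inverse of Z ↦ [Z, e], the operator u ↦ [s u, xt t] on N is (1 - t)B + t.
  -- It is invertible unless t/(t - 1) is an eigenvalue of B.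
  let T : Set ℂ := {t | t ≠ 1 ∧ B.HasEigenvalue (t / (t - 1))}
  have hT : T.Finite := by
    refine Set.Finite.of_finite_image (f := fun t : ℂ => t / (t - 1))
      ((Module.End.finite_hasEigenvalue B).subset ?_) ?_
    · rintro _ ⟨t, ht, rfl⟩; exact ht.2
    · intro a ha b hb hab
      have ha' := sub_ne_zero.2 ha.1
      have hb' := sub_ne_zero.2 hb.1
      have h1 : a / (a - 1) = b / (b - 1) := hab
      rw [div_eq_div_iff ha' hb'] at h1
      linear_combination -h1
  have hgood : ∀ t ∉ T, ∀ y ∈ N, ∃ Z ∈ p, ⁅Z, xt t⁆ = y := by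
    intro t ht
    let At : Module.End ℂ N := (1 - t) • B + t • 1
    have hAt : ∀ u : N, (At u : CMat n) = ⁅(s u : CMat n), xt t⁆ := fun u => by
      simp only [At, xt, LinearMap.add_apply, LinearMap.smul_apply, Module.End.one_apply,
        lie_add, lie_smul, lie_sub, hse]
      change (1 - t) • ⁅(s u : CMat n), x⁆ + t • (u : CMat n) = _
      rw [sub_smul, one_smul, smul_sub]; abel
    have hinj : Function.Injective At := by
      refine LinearMap.ker_eq_bot.1 (LinearMap.ker_eq_bot'.2 fun u hu => ?_)
      by_contra hu0
      have hu' : (1 - t) • B u + t • u = 0 := hu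
      by_cases ht1 : t = 1
      · rw [ht1, sub_self, zero_smul, zero_add, one_smul] at hu'
        exact hu0 hu'
      · refine ht ⟨ht1, Module.End.hasEigenvalue_of_hasEigenvector (x := u)
          ⟨Module.End.mem_eigenspace_iff.2 ?_, hu0⟩⟩
        have ht1' := sub_ne_zero.2 ht1
        have h2 : (t - 1) • B u = t • u := by
          rw [← sub_eq_zero, ← neg_eq_zero, ← hu']; module
        rw [div_eq_inv_mul, mul_smul, ← h2, smul_smul, inv_mul_cancel₀ ht1', one_smul]
    intro y hy
    obtain ⟨u, hu⟩ := LinearMap.injective_iff_surjective.1 hinj ⟨y, hy⟩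
    exact ⟨s u, (s u).2, by rw [← hAt, hu]⟩
  have hcont : Continuous xt := by fun_prop
  -- The complement of a finite set in the complex plane is connected, so local constancy of the
  -- orbit along the line is enough. A real line would be disconnected, which is why the argument is
  -- carried out over ℂ.
  have hconn : IsPreconnected Tᶜ := (hT.countable.isConnected_compl_of_one_lt_rank (by
    rw [Complex.rank_real_complex]; exact Cardinal.one_lt_two)).isPreconnected
  have hrel : ∀ a ∈ Tᶜ, ∀ b ∈ Tᶜ, ∃ g ∈ G, xt b = Ad g (xt a) := by
    intro a ha b hb
    refine hconn.induction₂ (fun a b => ∃ g ∈ G, xt b = Ad g (xt a)) ?_ ?_ ?_ ha hb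
    · intro a ha
      have h1 := eventually_exists_Ad_expG_eq (p := p.restrictScalars ℝ)
        (N := N.restrictScalars ℝ) (hxt a) hpN (hgood a ha)
      have h2 : Filter.Tendsto xt (𝓝[Tᶜ] a) (𝓝[(N : Set (CMat n))] (xt a)) :=
        tendsto_nhdsWithin_iff.2 ⟨hcont.continuousWithinAt,
          Filter.Eventually.of_forall fun t => hxt t⟩
      filter_upwards [h2.eventually h1] with b ⟨Z, hZ, hZb⟩
      exact ⟨expG Z, hG.connected.expG_mem (hp Z hZ), hZb⟩
    · rintro a b c - - - ⟨g, hg, hab⟩ ⟨k, hk, hbc⟩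
      exact ⟨k * g, mul_mem hk hg, by rw [Ad_mul, ← hab, hbc]⟩
    · rintro a b - - ⟨g, hg, hab⟩
      exact ⟨g⁻¹, inv_mem hg, by rw [hab, Ad_inv_Ad]⟩
  refine ⟨T, hT, fun t ht => ?_⟩
  have h1 : (1 : ℂ) ∈ Tᶜ := fun h => h.1 rfl
  have hx1 : xt 1 = e := by simp [xt]
  have := hrel 1 h1 t ht
  rwa [hx1] at this

/-- For an even nilpotent element, the nilradical of its parabolic subalgebra lies in the closure
of the real points of its orbit. -/
theorem nilradical_subset_closure (hG : IsComplexification 𝔤R G) (hS : TrNondeg 𝔤R.toSubmodule)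
    {e f : CMat n} (t : IsSl2Triple (hd q d) e f) (hh : hd q d ∈ 𝔤R) (he : e ∈ 𝔤R)
    (heven : ∀ X ∈ 𝔤R, X ∈ wt q d {i | Even i}) {x : CMat n} (hx : x ∈ 𝔤R)
    (hxw : x ∈ wt q d (Set.Ioi 0)) :
    x ∈ closure (adjointOrbit G e ∩ (𝔤R : Set (CMat n))) := by
  have hlie : ∀ X ∈ 𝔤R.toSubmodule, ∀ Y ∈ 𝔤R.toSubmodule, ⁅X, Y⁆ ∈ 𝔤R.toSubmodule :=
    fun X hX Y hY => 𝔤R.lie_mem hX hY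
  have hsurjR := fun y hy hyw => exists_lie_eq_of_even (y := y) hS hlie t hh he heven hy hyw
  have hew : e ∈ wt q d (Set.Ioi 0) := wt_mono (by simp) (mem_wt_two t)
  obtain ⟨T, hT, hTx⟩ := exists_finite_forall_line_mem_orbit hG
    (p := (complexSpan 𝔤R).toSubmodule ⊓ wt q d (Set.Ici 0))
    (N := (complexSpan 𝔤R).toSubmodule ⊓ wt q d (Set.Ioi 0)) (e := e) (x := x)
    (fun Z hZ => hZ.1)
    (fun Z hZ y hy => ⟨complexSpan_lie_mem hZ.1 hy.1, lie_mem_wt hZ.2 hy.2 fun a ha b hb => by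
      rw [Set.mem_Ici] at ha; rw [Set.mem_Ioi] at *; omega⟩)
    ⟨mem_complexSpan_of_mem he, hew⟩
    (by
      rintro y ⟨hy, hyw⟩
      obtain ⟨X, hX, Y, hY, rfl⟩ := mem_complexSpan.1 hy
      obtain ⟨hXw, hYw⟩ := hG.mem_wt_of_add hh hX hY hyw
      obtain ⟨Z, hZ, hZw, hZX⟩ := hsurjR X hX hXw
      obtain ⟨W, hW, hWw, hWY⟩ := hsurjR Y hY hYw
      refine ⟨Z + Complex.I • W, ⟨mem_complexSpan.2 ⟨Z, hZ, W, hW, rfl⟩,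
        (wt q d _).add_mem hZw ((wt q d _).smul_mem _ hWw)⟩, ?_⟩
      rw [add_lie, smul_lie, hZX, hWY])
    ⟨mem_complexSpan_of_mem hx, hxw⟩
  have hreal : ∀ t : ℝ, x + (t : ℂ) • (e - x) ∈ 𝔤R := fun t => by
    have : (t : ℂ) • (e - x) = t • (e - x) := by ext; simp
    rw [this]; exact 𝔤R.add_mem hx (𝔤R.smul_mem t (𝔤R.sub_mem he hx))
  have hfin : {t : ℝ | (t : ℂ) ∈ T}.Finite :=
    hT.preimage (Complex.ofReal_injective.injOn)
  -- The value 0, which corresponds to x, may itself be exceptional.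
  have hev : ∀ᶠ t : ℝ in 𝓝[≠] 0, (t : ℂ) ∉ T := by
    have h1 := (hfin.subset (Set.sdiff_subset (t := {0}))).isClosed.isOpen_compl.mem_nhds
      (x := (0 : ℝ)) (by simp)
    filter_upwards [nhdsWithin_le_nhds h1, self_mem_nhdsWithin] with t ht ht0 htT
    exact ht ⟨htT, ht0⟩
  refine mem_closure_of_tendsto (f := fun t : ℝ => x + (t : ℂ) • (e - x)) (b := 𝓝[≠] 0) ?_
    (hev.mono fun t ht => ⟨hTx _ ht, hreal t⟩)
  have hc : Continuous fun t : ℝ => x + (t : ℂ) • (e - x) := by fun_prop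
  exact (hc.tendsto' 0 x (by simp)).mono_left nhdsWithin_le_nhds

end Density

/-! ### Real triples through real nilpotent elements -/

section RealTriples

variable {n : ℕ} {GR G : Subgroup (GL (Fin n) ℂ)} {𝔤R : LieSubalgebra ℝ (CMat n)}
variable {q : GL (Fin n) ℂ} {d : Fin n → ℤ}

theorem IsSl2Triple.conj {h e f : CMat n} (t : IsSl2Triple h e f) (g : GL (Fin n) ℂ) :
    IsSl2Triple (Ad g h) (Ad g e) (Ad g f) where
  h_ne_zero h0 := t.h_ne_zero (by rw [← Ad_inv_Ad g h, h0, map_zero])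
  lie_e_f := by rw [← Ad_lie, t.lie_e_f]
  lie_h_e_nsmul := by rw [← Ad_lie, t.lie_h_e_nsmul, map_nsmul]
  lie_h_f_nsmul := by rw [← Ad_lie, t.lie_h_f_nsmul, map_neg, map_nsmul]

theorem IsComplexification.Ad_mem (hG : IsComplexification 𝔤R G) {g : GL (Fin n) ℂ} (hg : g ∈ G)
    {X : CMat n} (hX : X ∈ complexSpan 𝔤R) : Ad g X ∈ complexSpan 𝔤R :=
  hG.connected.Ad_mem (fun _ hX _ hY => complexSpan_lie_mem hX hY) hg hX

/-- The neutral elements of two real `𝔰𝔩₂`-triples with the same nilpositive element are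
conjugate. -/
theorem exists_Ad_eq_of_isSl2Triple (hGR : IsConnectedLieSubgroup GR 𝔤R.toSubmodule)
    {h₁ e f f₁ : CMat n} (t : IsSl2Triple (hd q d) e f) (t₁ : IsSl2Triple h₁ e f₁)
    (hh : hd q d ∈ 𝔤R) (hh₁ : h₁ ∈ 𝔤R) : ∃ r ∈ GR, Ad r (hd q d) = h₁ := by
  -- The difference of the neutral elements lies both in the image and in the kernel of ad e, so it
  -- has positive weights.
  have h1 : ⁅e, f₁ - f⁆ = h₁ - hd q d := by rw [lie_sub, t.lie_e_f, t₁.lie_e_f]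
  have h2 : ⁅e, ⁅e, f₁ - f⁆⁆ = 0 := by
    rw [h1, lie_sub, ← lie_skew, t₁.lie_h_e_nsmul, ← lie_skew e (hd q d), t.lie_h_e_nsmul,
      sub_self]
  have h3 := lie_mem_wt_of_lie_lie_eq_zero t h2
  rw [h1] at h3
  obtain ⟨r, hr, hr'⟩ := exists_Ad_eq_add_of_mem hGR hh (𝔤R.sub_mem hh₁ hh) h3
  exact ⟨r, hr, by rw [hr', add_sub_cancel]⟩

/-- A real point of the complex orbit of `e` belongs to a real `𝔰𝔩₂`-triple whose neutral element
is conjugate to that of a triple containing `e`. -/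
theorem exists_isSl2Triple_of_Ad_mem (hG : IsComplexification 𝔤R G) {e f : CMat n}
    (t : IsSl2Triple (hd q d) e f) (hh : hd q d ∈ 𝔤R) (hf : f ∈ 𝔤R)
    {g : GL (Fin n) ℂ} (hg : g ∈ G) (hx : Ad g e ∈ 𝔤R) :
    ∃ k ∈ G, ∃ f' ∈ 𝔤R, Ad k (hd q d) ∈ 𝔤R ∧ IsSl2Triple (Ad k (hd q d)) (Ad g e) f' := by
  have t' := t.conj g
  rw [Ad_hd] at t'
  set x := Ad g e
  set h' := hd (g * q) d with hh'
  have hh'c : h' ∈ complexSpan 𝔤R := by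
    rw [hh', ← Ad_hd]; exact hG.Ad_mem hg (mem_complexSpan_of_mem hh)
  have hf'c := hG.Ad_mem hg (mem_complexSpan_of_mem hf)
  obtain ⟨A, hA, B, hB, hAB⟩ := mem_complexSpan.1 hh'c
  obtain ⟨C, hC, D, hD, hCD⟩ := mem_complexSpan.1 hf'c
  -- As x is real, the triple relations split into real and imaginary parts. The imaginary part B of
  -- h' then lies in the kernel and in the image of ad x, so it has positive h'-weights.
  obtain ⟨h1, h2⟩ : ⁅A, x⁆ = 2 • x ∧ ⁅B, x⁆ = 0 :=
    hG.ext_iff (𝔤R.lie_mem hA hx) (𝔤R.lie_mem hB hx) (𝔤R.nsmul_mem hx 2) 𝔤R.zero_mem (by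
      rw [← smul_lie, ← add_lie, ← hAB, t'.lie_h_e_nsmul, smul_zero, add_zero])
  obtain ⟨h3, h4⟩ : ⁅x, C⁆ = A ∧ ⁅x, D⁆ = B :=
    hG.ext_iff (𝔤R.lie_mem hx hC) (𝔤R.lie_mem hx hD) hA hB (by
      rw [← lie_smul, ← lie_add, ← hCD, t'.lie_e_f, hAB])
  have h5 : ⁅x, -(Complex.I • D)⁆ = -(Complex.I • B) := by rw [lie_neg, lie_smul, h4]
  have h6 : ⁅x, -(Complex.I • B)⁆ = 0 := by
    rw [lie_neg, lie_smul, ← lie_skew, h2, neg_zero, smul_zero, neg_zero]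
  have h7 : -(Complex.I • B) ∈ wt (g * q) d (Set.Ioi 0) := by
    rw [← h5]; exact lie_mem_wt_of_lie_lie_eq_zero t' (by rw [h5, h6])
  have hBc : -(Complex.I • B) ∈ complexSpan 𝔤R :=
    neg_mem ((complexSpan 𝔤R).smul_mem _ (mem_complexSpan_of_mem hB))
  -- Working within the centralizer of x yields v that fixes x and moves h' to its real part A.
  obtain ⟨v, hv, hvh⟩ := exists_Ad_eq_add (q := g * q) (d := d)
    (N := ((complexSpan 𝔤R).toSubmodule ⊓ wt (g * q) d (Set.Ioi 0) ⊓
      LinearMap.ker (LieAlgebra.ad ℂ (CMat n) x : Module.End ℂ (CMat n))).restrictScalars ℝ)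
    (fun X hX => hX.1.2)
    (fun X hX => by
      have hX0 : ⁅x, X⁆ = 0 := hX.2
      refine ⟨⟨complexSpan_lie_mem hh'c hX.1.1, by rw [lie_hd]; exact wtMul_mem_wt _ hX.1.2⟩, ?_⟩
      change ⁅x, ⁅h', X⁆⁆ = 0
      rw [leibniz_lie, hX0, lie_zero, add_zero, ← lie_skew x h', t'.lie_h_e_nsmul, neg_lie,
        nsmul_lie, hX0, smul_zero, neg_zero])
    (fun X hX Y hY => by
      have hX0 : ⁅x, X⁆ = 0 := hX.2
      have hY0 : ⁅x, Y⁆ = 0 := hY.2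
      refine ⟨⟨complexSpan_lie_mem hX.1.1 hY.1.1, lie_mem_wt hX.1.2 hY.1.2 fun a ha b hb => ?_⟩, ?_⟩
      · rw [Set.mem_Ioi] at *; omega
      · change ⁅x, ⁅X, Y⁆⁆ = 0
        rw [leibniz_lie, hX0, hY0, zero_lie, lie_zero, add_zero])
    (y := -(Complex.I • B)) ⟨⟨hBc, h7⟩, h6⟩
  have hvx : Ad v x = x := Ad_eq_of_mem_expClosure (fun z hz => by
    have : ⁅x, z⁆ = 0 := hz.2
    rw [← lie_skew, this, neg_zero]) hv
  have hvG : v ∈ G := hG.connected.expClosure_le (fun X hX => hX.1.1) hv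
  have hvA : Ad v h' = A := by
    rw [hvh]; change h' + _ = A; rw [hAB]; abel
  have t'' := t'.conj v
  rw [hvA, hvx] at t''
  -- With x and A real, the real part C' of the third element still satisfies the relations.
  obtain ⟨C', hC', D', hD', hCD'⟩ := mem_complexSpan.1 (hG.Ad_mem hvG hf'c)
  refine ⟨v * g, mul_mem hvG hg, C', hC', ?_, ?_⟩
  · rw [Ad_mul, Ad_hd, hvA]; exact hA
  · rw [Ad_mul, Ad_hd, hvA]
    rw [hCD'] at t''
    refine ⟨t''.h_ne_zero, ?_, h1, ?_⟩
    · refine (hG.ext_iff (Y' := 0) (𝔤R.lie_mem hx hC') (𝔤R.lie_mem hx hD') hA 𝔤R.zero_mem ?_).1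
      rw [← lie_smul, ← lie_add, t''.lie_e_f, smul_zero, add_zero]
    · refine (hG.ext_iff (Y' := -(2 • D')) (𝔤R.lie_mem hA hC') (𝔤R.lie_mem hA hD')
        (𝔤R.neg_mem (𝔤R.nsmul_mem hC' 2)) (𝔤R.neg_mem (𝔤R.nsmul_mem hD' 2)) ?_).1
      rw [← lie_smul, ← lie_add, t''.lie_h_f_nsmul, smul_add, smul_neg, smul_comm Complex.I,
        neg_add]

end RealTriples

/-- The derivative along a curve depends only on the velocity. It may be computed on the tangent
line, where a determinant or a quadratic form is an explicit polynomial. -/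
theorem hasDerivAt_comp_of_line {𝕜 E F : Type*} [NontriviallyNormedField 𝕜]
    [NormedAddCommGroup E] [NormedSpace 𝕜 E] [NormedAddCommGroup F] [NormedSpace 𝕜 F]
    {f : E → F} {c : 𝕜 → E} {c' : E} {l : F} {t : 𝕜} (hf : DifferentiableAt 𝕜 f (c t))
    (hl : HasDerivAt (fun s : 𝕜 => f (c t + s • c')) l 0) (hc : HasDerivAt c c' t) :
    HasDerivAt (fun s => f (c s)) l t := by
  have h1 := hf.hasFDerivAt.comp_hasDerivAt t hc
  have h2 : HasDerivAt (fun s : 𝕜 => c t + s • c') c' 0 := by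
    simpa using ((hasDerivAt_id (0 : 𝕜)).smul_const c').const_add (c t)
  have h3 : HasFDerivAt f (fderiv 𝕜 f (c t)) (c t + (0 : 𝕜) • c') := by
    rw [zero_smul, add_zero]; exact hf.hasFDerivAt
  exact h1.congr_deriv ((h3.comp_hasDerivAt (0 : 𝕜) h2).unique hl)

/-! ### Determinants of exponentials on an invariant summand -/

section DetExp

open NormedSpace Matrix.Norms.Operator

variable {n : ℕ}

theorem hasDerivAt_det_one_add_smul (A : CMat n) :
    HasDerivAt (fun t : ℂ => (1 + t • A).det) A.trace 0 := by
  obtain ⟨p, hp⟩ : ∃ p : Polynomial ℂ, ∀ t : ℂ,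
      (1 + t • A).det = 1 + A.trace * t + p.eval t * t ^ 2 :=
    ⟨_, fun t => Matrix.det_one_add_smul t A⟩
  have h4 := ((Polynomial.C 1 + Polynomial.C A.trace * Polynomial.X +
    p * Polynomial.X ^ 2).hasDerivAt (0 : ℂ))
  refine (h4.congr_deriv (by simp)).congr_of_eventuallyEq (Filter.Eventually.of_forall fun t => ?_)
  simp [hp]

/-- The determinant of a one-parameter group of matrices. -/
theorem det_eq_exp_trace_of_map_add {F : ℂ → CMat n} {A : CMat n} (h0 : F 0 = 1)
    (hmul : ∀ s t, F (s + t) = F s * F t) (hF : HasDerivAt F A 0) (t : ℂ) :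
    (F t).det = Complex.exp (t * A.trace) := by
  have hD0 : HasDerivAt (fun t => (F t).det) A.trace 0 :=
    hasDerivAt_comp_of_line (f := fun M : CMat n => M.det) (differentiable_det _)
      (by rw [h0]; exact hasDerivAt_det_one_add_smul A) hF
  have hD : ∀ t, HasDerivAt (fun t => (F t).det) ((F t).det * A.trace) t := by
    intro t
    have h1 : HasDerivAt (fun s => (F (s - t)).det) A.trace t := by
      have h2 : HasDerivAt (fun t => (F t).det) A.trace (t - t) := by rwa [sub_self]
      exact h2.comp_sub_const t t
    have h2 := h1.const_mul (F t).det
    refine h2.congr_of_eventuallyEq (Filter.Eventually.of_forall fun s => ?_)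
    change (F s).det = (F t).det * (F (s - t)).det
    rw [← Matrix.det_mul, ← hmul, add_sub_cancel]
  have hu : ∀ t, HasDerivAt (fun t => (F t).det * Complex.exp (-(t * A.trace))) 0 t := by
    intro t
    have h1 := (hD t).mul (((hasDerivAt_id t).mul_const A.trace).neg.cexp)
    refine h1.congr_deriv ?_
    change (F t).det * A.trace * _ + (F t).det * (_ * -(1 * A.trace)) = 0
    ring
  have hconst := is_const_of_deriv_eq_zero (fun t => (hu t).differentiableAt)
    (fun t => (hu t).deriv) t 0
  simp only [h0, Matrix.det_one, zero_mul, neg_zero, Complex.exp_zero, one_mul] at hconst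
  rw [Complex.exp_neg, ← div_eq_mul_inv, div_eq_one_iff_eq (Complex.exp_ne_zero _)] at hconst
  exact hconst

/-- The corner of `X` at the idempotent `P`, extended by the identity of the complement. -/
def compress (P X : CMat n) : CMat n := P * X * P + (1 - P)

theorem compress_mul {P A B : CMat n} (hP : P * P = P) (hA : A * P = P * A) :
    compress P (A * B) = compress P A * compress P B := by
  have h1 : (1 - P) * P = 0 := by rw [sub_mul, one_mul, hP, sub_self]
  have h2 : P * (1 - P) = 0 := by rw [mul_sub, mul_one, hP, sub_self]
  have h3 : (1 - P) * (1 - P) = 1 - P := by rw [sub_mul, one_mul, h2, sub_zero]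
  have h4 : P * A * P * (P * B * P) = P * (A * B) * P := by
    calc P * A * P * (P * B * P) = P * A * (P * P) * (B * P) := by simp only [mul_assoc]
      _ = P * (P * A) * (B * P) := by rw [hP, mul_assoc P A P, hA]
      _ = P * (A * B) * P := by rw [← mul_assoc P P, hP]; simp only [mul_assoc]
  rw [compress, compress, compress, add_mul, mul_add, mul_add, h4, h3,
    mul_assoc (P * A) P, h2, mul_zero, add_zero, mul_assoc P B P, ← mul_assoc (1 - P) P, h1,
    zero_mul, zero_add]

theorem compress_mul' {P A B : CMat n} (hP : P * P = P) (hB : B * P = P * B) :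
    compress P (A * B) = compress P A * compress P B := by
  have h1 : (1 - P) * P = 0 := by rw [sub_mul, one_mul, hP, sub_self]
  have h2 : P * (1 - P) = 0 := by rw [mul_sub, mul_one, hP, sub_self]
  have h3 : (1 - P) * (1 - P) = 1 - P := by rw [sub_mul, one_mul, h2, sub_zero]
  have h4 : P * A * P * (P * B * P) = P * (A * B) * P := by
    calc P * A * P * (P * B * P) = P * A * (P * P * B * P) := by simp only [mul_assoc]
      _ = P * A * (B * P * P) := by rw [hP, ← hB]
      _ = P * (A * B) * P := by rw [mul_assoc B P P, hP]; simp only [mul_assoc]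
  rw [compress, compress, compress, add_mul, mul_add, mul_add, h4, h3,
    mul_assoc (P * A) P, h2, mul_zero, add_zero, mul_assoc P B P, ← mul_assoc (1 - P) P, h1,
    zero_mul, zero_add]

theorem compress_one {P : CMat n} (hP : P * P = P) : compress P 1 = 1 := by
  rw [compress, mul_one, hP, add_sub_cancel]

theorem commute_exp_of_commute {Z P : CMat n} (h : Z * P = P * Z) : exp Z * P = P * exp Z :=
  (show Commute Z P from h).exp_left

theorem det_compress_exp {P Z : CMat n} (hP : P * P = P) (hZ : Z * P = P * Z) :
    (compress P (exp Z)).det = Complex.exp (P * Z).trace := by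
  have hF : HasDerivAt (fun t : ℂ => compress P (exp (t • Z))) (P * Z * P) 0 := by
    have h1 : HasDerivAt (fun t : ℂ => exp (t • Z)) Z 0 := by
      refine (hasDerivAt_exp_smul_const (𝕂 := ℂ) Z (0 : ℂ)).congr_deriv ?_
      rw [zero_smul, exp_zero, one_mul]
    exact ((h1.const_mul P).mul_const P).add_const (1 - P)
  have h2 := det_eq_exp_trace_of_map_add (F := fun t : ℂ => compress P (exp (t • Z)))
    (by rw [zero_smul, exp_zero, compress_one hP]) (fun s t => by
      rw [add_smul, Matrix.exp_add_of_commute _ _ ((Commute.refl Z).smul_left s |>.smul_right t)]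
      exact compress_mul hP (commute_exp_of_commute (by rw [smul_mul_assoc, hZ, mul_smul_comm])))
      hF 1
  rw [one_smul, one_mul, mul_assoc, hZ, ← mul_assoc, hP] at h2
  exact h2

end DetExp

/-! ### A semi-invariant of the weight-two space -/

section SemiInvariant

open NormedSpace

variable {n : ℕ} {q : GL (Fin n) ℂ} {d : Fin n → ℤ}

/-- The projection onto the eigenspace of `hd q d` with eigenvalue `i`. -/
def eigProj (q : GL (Fin n) ℂ) (d : Fin n → ℤ) (i : ℤ) : CMat n :=
  Ad q (Matrix.diagonal fun j => if d j = i then 1 else 0)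

theorem eigProj_mul_self (i : ℤ) : eigProj q d i * eigProj q d i = eigProj q d i := by
  rw [eigProj, ← map_mul, Matrix.diagonal_mul_diagonal]
  congr 2; funext j
  by_cases h : d j = i <;> simp [h]

theorem mul_eigProj_of_mem_wt {X : CMat n} {k : ℤ} (hX : X ∈ wt q d {k}) (i : ℤ) :
    X * eigProj q d i = eigProj q d (i + k) * X := by
  refine ext_Ad_inv (q := q) fun j l => ?_
  rw [map_mul, map_mul, eigProj, eigProj, Ad_inv_Ad, Ad_inv_Ad, Matrix.mul_diagonal,
    Matrix.diagonal_mul]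
  by_cases h0 : Ad q⁻¹ X j l = 0
  · rw [h0]; simp
  · have h1 : d j - d l = k := hX j l h0
    have h2 : d l = i ↔ d j = i + k := by omega
    simp only [h2, mul_comm]

theorem pow_mul_eigProj_of_mem_wt {X : CMat n} {k : ℤ} (hX : X ∈ wt q d {k}) (i : ℤ) (m : ℕ) :
    X ^ m * eigProj q d i = eigProj q d (i + m * k) * X ^ m := by
  induction m with
  | zero => simp
  | succ m ih =>
    rw [pow_succ', mul_assoc, ih, ← mul_assoc, mul_eigProj_of_mem_wt hX, mul_assoc]
    congr 2; push_cast; ring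

theorem hd_mul_eigProj (i : ℤ) : hd q d * eigProj q d i = (i : ℂ) • eigProj q d i := by
  rw [hd, eigProj, ← map_mul, ← map_smul, Matrix.diagonal_mul_diagonal]
  congr 1; ext j l
  by_cases hjl : j = l
  · subst hjl; by_cases h : d j = i <;> simp [h]
  · simp [hjl]

theorem hd_eq_sum_eigProj {M : ℕ} (hM : ∀ j, |d j| ≤ M) :
    hd q d = ∑ i ∈ Finset.range (M + 1), (i : ℂ) • (eigProj q d i - eigProj q d (-i)) := by
  refine ext_Ad_inv (q := q) fun j l => ?_
  simp only [map_sum, map_smul, map_sub, hd, eigProj, Ad_inv_Ad, Matrix.sum_apply,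
    Matrix.smul_apply, Matrix.sub_apply]
  by_cases hjl : j = l
  · subst hjl
    simp only [Matrix.diagonal_apply_eq]
    have h1 := abs_le.1 (hM j)
    rw [Finset.sum_eq_single (d j).natAbs]
    · rcases le_total 0 (d j) with h | h
      · by_cases h0 : d j = 0
        · simp [h0]
        · have e1 : ((d j).natAbs : ℤ) = d j := Int.natAbs_of_nonneg h
          have e2 : ((d j).natAbs : ℂ) = d j := by rw [← Int.cast_natCast, e1]
          rw [e1, if_pos rfl, if_neg (by omega), e2]; simp
      · by_cases h0 : d j = 0
        · simp [h0]
        · have e1 : ((d j).natAbs : ℤ) = -d j := Int.ofNat_natAbs_of_nonpos h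
          have e2 : ((d j).natAbs : ℂ) = -d j := by rw [← Int.cast_natCast, e1, Int.cast_neg]
          rw [e1, if_neg (by omega), if_pos (by omega), e2]; simp
    · intro i _ hi
      rw [if_neg (by omega), if_neg (by omega)]; simp
    · intro h; exact absurd (Finset.mem_range.2 (by omega)) h
  · simp [hjl]

/-- An element inverting the neutral element of an `𝔰𝔩₂`-triple. -/
theorem IsSl2Triple.exists_Ad_eq_neg {h e f : CMat n} (t : IsSl2Triple h e f) :
    ∃ J : GL (Fin n) ℂ, Ad J h = -h := by
  have hfe : ⁅f, e⁆ = -h := by rw [← lie_skew, t.lie_e_f]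
  have hfh : ⁅f, h⁆ = 2 • f := by rw [← lie_skew, t.lie_h_f_nsmul, neg_neg]
  have heh : ⁅e, h⁆ = -(2 • e) := by rw [← lie_skew, t.lie_h_e_nsmul]
  have h1 : Ad (expG e) h = h - 2 • e := by
    rw [Ad_expG_of_lie_lie_eq_zero (by rw [heh, lie_neg, lie_nsmul, lie_self, smul_zero, neg_zero]),
      heh, sub_eq_add_neg]
  have h2 : Ad (expG (-f)) h = h - 2 • f := by
    rw [Ad_expG_of_lie_lie_eq_zero (by
      rw [neg_lie, neg_lie, hfh, lie_neg, lie_nsmul, lie_self, smul_zero, neg_zero, neg_zero]),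
      neg_lie, hfh, sub_eq_add_neg]
  have h3 : Ad (expG (-f)) e = e + h - f := by
    have hs := hasSum_Ad_expG (-f) e
    have a0 : ((LieAlgebra.ad ℝ (CMat n) (-f)) ^ 0) e = e := rfl
    have a1 : ((LieAlgebra.ad ℝ (CMat n) (-f)) ^ 1) e = h := by
      rw [pow_one, LieAlgebra.ad_apply, neg_lie, hfe, neg_neg]
    have a2 : ((LieAlgebra.ad ℝ (CMat n) (-f)) ^ 2) e = -(2 • f) := by
      rw [pow_succ', Module.End.mul_apply, a1, LieAlgebra.ad_apply, neg_lie, hfh]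
    have a3 : ∀ k, ((LieAlgebra.ad ℝ (CMat n) (-f)) ^ (k + 3)) e = 0 := by
      intro k
      induction k with
      | zero =>
        rw [zero_add, pow_succ', Module.End.mul_apply, a2, LieAlgebra.ad_apply, neg_lie,
          lie_neg, lie_nsmul, lie_self, smul_zero, neg_zero, neg_zero]
      | succ k ih =>
        rw [show k + 1 + 3 = (k + 3) + 1 by ring, pow_succ', Module.End.mul_apply, ih, map_zero]
    have hs' := hasSum_sum_of_ne_finset_zero (L := .unconditional ℕ) (s := Finset.range 3)
      (f := fun k : ℕ => ((k.factorial : ℝ)⁻¹) • ((LieAlgebra.ad ℝ (CMat n) (-f)) ^ k) e)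
      (fun k hk => by
        obtain ⟨m, rfl⟩ := Nat.exists_eq_add_of_le' (not_lt.1 fun h => hk (Finset.mem_range.2 h))
        simp only [a3 m, smul_zero])
    rw [hs.unique hs', Finset.sum_range_succ, Finset.sum_range_succ, Finset.sum_range_succ, a0, a1,
      a2]
    rw [Finset.sum_range_zero, Nat.factorial_zero, Nat.factorial_one, Nat.factorial_two,
      Nat.cast_one, Nat.cast_ofNat]
    module
  -- The usual representative of the nontrivial Weyl group element of SL₂.
  refine ⟨expG e * (expG (-f) * expG e), ?_⟩
  rw [Ad_mul, Ad_mul, h1, map_sub, map_nsmul, h2, h3]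
  have : h - 2 • f - 2 • (e + h - f) = -h - 2 • e := by module
  rw [this, map_sub, map_neg, h1, map_nsmul, Ad_expG_of_lie_eq_zero (lie_self e)]
  abel

theorem Ad_eigProj_of_Ad_eq_neg {J : GL (Fin n) ℂ} (hJ : Ad J (hd q d) = -hd q d) (i : ℤ) :
    Ad J (eigProj q d i) = eigProj q d (-i) := by
  have h1 : (J : CMat n) * hd q d = -hd q d * J := by
    rw [← hJ, Ad_apply, mul_assoc _ _ (J : CMat n), Units.inv_mul, mul_one]
  have h2 : ∀ j l, Ad q⁻¹ (J : CMat n) j l ≠ 0 → d j = -d l := by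
    intro j l hjl
    have := congrArg (fun Y => Ad q⁻¹ Y j l) h1
    simp only [map_mul, map_neg, hd, Ad_inv_Ad, Matrix.mul_diagonal, neg_mul, Matrix.neg_apply,
      Matrix.diagonal_mul] at this
    have h3 : Ad q⁻¹ (J : CMat n) j l * ((d l : ℂ) + d j) = 0 := by linear_combination this
    have h4 := (mul_eq_zero.1 h3).resolve_left hjl
    have h5 : d l + d j = 0 := by exact_mod_cast h4
    omega
  have h3 : (J : CMat n) * eigProj q d i = eigProj q d (-i) * J := by
    refine ext_Ad_inv (q := q) fun j l => ?_
    rw [map_mul, map_mul, eigProj, eigProj, Ad_inv_Ad, Ad_inv_Ad, Matrix.mul_diagonal,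
      Matrix.diagonal_mul]
    by_cases h0 : Ad q⁻¹ (J : CMat n) j l = 0
    · rw [h0]; simp
    · have h1 := h2 j l h0
      have h2 : d l = i ↔ d j = -i := by omega
      simp only [h2, mul_comm]
  rw [Ad_apply, h3, mul_assoc, Units.mul_inv, mul_one]

/-- The absolute value of a polynomial semi-invariant of the centralizer of `hd q d`: the product
over `i` of the `i`-th powers of the determinants of `y ^ i` between opposite eigenspaces, which are
identified by means of `J`. -/
def semiInv (q : GL (Fin n) ℂ) (d : Fin n → ℤ) (J : GL (Fin n) ℂ) (M : ℕ) (y : CMat n) : ℝ :=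
  ∏ i ∈ Finset.range (M + 1), ‖(compress (eigProj q d (-i)) (J * y ^ i)).det‖ ^ i

theorem continuous_semiInv (J : GL (Fin n) ℂ) (M : ℕ) : Continuous (semiInv q d J M) := by
  refine continuous_finsetProd _ fun i _ => (Continuous.norm ?_).pow i
  unfold compress
  exact Continuous.matrix_det (((continuous_const.mul (continuous_const.mul
    (continuous_id.pow i))).mul continuous_const).add continuous_const)

/-- Conjugation by exp Z multiplies the i-th determinant by exp(tr(Z on V_i) - tr(Z on V_{-i})),
where V_i is the i-eigenspace of h. The exponents i are chosen so that these add up to tr(hZ); hence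
the function is invariant when Z is orthogonal to h. -/
theorem semiInv_Ad_expG {J : GL (Fin n) ℂ} (hJ : Ad J (hd q d) = -hd q d) {M : ℕ}
    (hM : ∀ j, |d j| ≤ M) {Z : CMat n} (hZ : Z ∈ wt q d {0}) (y : CMat n) :
    semiInv q d J M (Ad (expG Z) y) = Real.exp (trForm n (hd q d) Z) * semiInv q d J M y := by
  have hP : ∀ i, Z * eigProj q d i = eigProj q d i * Z := fun i => by
    simpa using mul_eigProj_of_mem_wt hZ i
  have hterm : ∀ i : ℕ, (compress (eigProj q d (-i)) (J * (Ad (expG Z) y) ^ i)).det =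
      Complex.exp ((eigProj q d i * Z).trace - (eigProj q d (-i) * Z).trace) *
        (compress (eigProj q d (-i)) (J * y ^ i)).det := by
    intro i
    have hJP := Ad_eigProj_of_Ad_eq_neg hJ i
    have hJZ : Ad J Z * eigProj q d (-i) = eigProj q d (-i) * Ad J Z := by
      rw [← hJP, ← map_mul, ← map_mul, hP]
    have h1 : (J : CMat n) * (Ad (expG Z) y) ^ i = exp (Ad J Z) * ((J * y ^ i) * exp (-Z)) := by
      rw [← map_pow, Ad_expG_apply, Ad_apply, Matrix.exp_units_conj]
      simp only [mul_assoc, Units.inv_mul_cancel_left]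
    have hnZ : -Z * eigProj q d (-i) = eigProj q d (-i) * -Z := by rw [neg_mul, hP, mul_neg]
    rw [h1, compress_mul (eigProj_mul_self _) (commute_exp_of_commute hJZ),
      compress_mul' (eigProj_mul_self _) (commute_exp_of_commute hnZ), Matrix.det_mul,
      Matrix.det_mul, det_compress_exp (eigProj_mul_self _) hJZ,
      det_compress_exp (eigProj_mul_self _) hnZ, ← hJP, ← map_mul, trace_Ad, hJP, mul_neg,
      Matrix.trace_neg, Complex.exp_sub, Complex.exp_neg]
    ring
  have hsum : trForm n (hd q d) Z = ∑ i ∈ Finset.range (M + 1),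
      (i : ℝ) * ((eigProj q d i * Z).trace - (eigProj q d (-i) * Z).trace).re := by
    rw [trForm_apply, hd_eq_sum_eigProj hM, Finset.sum_mul, Matrix.trace_sum, Complex.re_sum]
    refine Finset.sum_congr rfl fun i _ => ?_
    rw [smul_mul_assoc, Matrix.trace_smul, sub_mul, Matrix.trace_sub, smul_eq_mul]
    simp
  rw [semiInv, hsum, Real.exp_sum, semiInv, ← Finset.prod_mul_distrib]
  refine Finset.prod_congr rfl fun i _ => ?_
  rw [hterm, norm_mul, mul_pow, Complex.norm_exp, ← Real.exp_nat_mul]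

/-- By 𝔰𝔩₂-theory x ^ i is injective on the eigenspace of weight -i of the standard module, so no
determinant vanishes. -/
theorem semiInv_ne_zero {J : GL (Fin n) ℂ} (hJ : Ad J (hd q d) = -hd q d) (M : ℕ) {x f : CMat n}
    (t : IsSl2Triple (hd q d) x f) : semiInv q d J M x ≠ 0 := by
  refine Finset.prod_ne_zero_iff.2 fun i _ => pow_ne_zero _ (norm_ne_zero_iff.2 ?_)
  intro hdet
  obtain ⟨v, hv0, hv⟩ := Matrix.exists_mulVec_eq_zero_iff.2 hdet
  set P := eigProj q d (-i) with hPdef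
  have hPP : P * P = P := eigProj_mul_self _
  have hJP : (J : CMat n) * eigProj q d i = P * J := by
    rw [hPdef, ← Ad_eigProj_of_Ad_eq_neg hJ i, Ad_apply, mul_assoc _ _ (J : CMat n), Units.inv_mul,
      mul_one]
  have hxP : x ^ i * P = eigProj q d i * x ^ i := by
    rw [hPdef, pow_mul_eigProj_of_mem_wt (mem_wt_two t)]
    congr 2; ring
  have h1 : P * (J * x ^ i) * P = J * x ^ i * P := by
    rw [mul_assoc, mul_assoc (J : CMat n), hxP, ← mul_assoc (J : CMat n), hJP, ← mul_assoc,
      ← mul_assoc, hPP]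
  rw [compress, h1, Matrix.add_mulVec] at hv
  have h2 : (1 - P).mulVec v = 0 := by
    have := congrArg (1 - P).mulVec hv
    rw [Matrix.mulVec_add, Matrix.mulVec_mulVec, Matrix.mulVec_mulVec, Matrix.mulVec_zero,
      ← h1] at this
    have e1 : (1 - P) * (P * (J * x ^ i) * P) = 0 := by
      rw [mul_assoc P, ← mul_assoc (1 - P), sub_mul, one_mul, hPP, sub_self, zero_mul]
    have e2 : (1 - P) * (1 - P) = 1 - P := by
      rw [sub_mul, one_mul, mul_sub, mul_one, hPP, sub_self, sub_zero]
    rwa [e1, e2, Matrix.zero_mulVec, zero_add] at this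
  have h3 : P.mulVec v = v := by
    rw [Matrix.sub_mulVec, Matrix.one_mulVec, sub_eq_zero] at h2; exact h2.symm
  rw [h2, add_zero, ← Matrix.mulVec_mulVec, h3, ← Matrix.mulVec_mulVec] at hv
  have h4 : (x ^ i).mulVec v = 0 := by
    have := congrArg ((J⁻¹ : GL (Fin n) ℂ) : CMat n).mulVec hv
    rwa [Matrix.mulVec_mulVec, Units.inv_mul, Matrix.one_mulVec, Matrix.mulVec_zero] at this
  obtain ⟨r1, r2, r3⟩ := sl2_end_rel t
  refine hv0 (eq_zero_of_pow_apply_eq_zero (m := i) r1 r2 r3 ?_ ?_)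
  · rw [Matrix.toLinAlgEquiv'_apply, ← h3, Matrix.mulVec_mulVec, hPdef, hd_mul_eigProj,
      Matrix.smul_mulVec]
    push_cast; rfl
  · rw [← map_pow, Matrix.toLinAlgEquiv'_apply]; exact h4

/-- As h ≠ 0 and J exchanges opposite eigenspaces, some eigenspace of weight -i with i ≥ 1 is
nonzero, and its determinant vanishes at 0. -/
theorem semiInv_zero (J : GL (Fin n) ℂ) {M : ℕ} (hM : ∀ j, |d j| ≤ M)
    (hJ : Ad J (hd q d) = -hd q d) (h : hd q d ≠ 0) : semiInv q d J M 0 = 0 := by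
  obtain ⟨i, hi, hi0⟩ : ∃ i ∈ Finset.range (M + 1),
      (i : ℂ) • (eigProj q d i - eigProj q d (-i)) ≠ 0 := by
    by_contra hc
    push Not at hc
    exact h ((hd_eq_sum_eigProj hM).trans (Finset.sum_eq_zero hc))
  have hi1 : i ≠ 0 := fun h0 => hi0 (by simp [h0])
  have hPne : eigProj q d (-i) ≠ 0 := by
    intro h0
    have := Ad_eigProj_of_Ad_eq_neg hJ i
    rw [h0] at this
    have h1 : eigProj q d i = 0 := by rw [← Ad_inv_Ad J (eigProj q d i), this, map_zero]
    exact hi0 (by rw [h0, h1, sub_self, smul_zero])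
  refine Finset.prod_eq_zero hi (pow_eq_zero_iff hi1 |>.2 (norm_eq_zero.2 ?_))
  rw [zero_pow hi1, mul_zero, compress, mul_zero, zero_mul, zero_add]
  by_contra hdet
  have h1 : (1 - eigProj q d (-i)) * eigProj q d (-i) = 0 := by
    rw [sub_mul, one_mul, eigProj_mul_self, sub_self]
  have hu := (Matrix.isUnit_iff_isUnit_det _).2 (isUnit_iff_ne_zero.2 hdet)
  exact hPne (hu.mul_right_eq_zero.1 h1)

end SemiInvariant

/-! ### The Frobenius inner product and first variations -/

section Frobenius

open NormedSpace

/-- The variation of a quadratic form along a conjugation orbit vanishes at a minimum. -/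
theorem apply_lie_eq_zero_of_forall_le {𝔸 : Type*} [NormedRing 𝔸] [NormedAlgebra ℝ 𝔸]
    [FiniteDimensional ℝ 𝔸] (B : LinearMap.BilinForm ℝ 𝔸) (hB : ∀ x y, B x y = B y x) {z y : 𝔸}
    (h : ∀ t : ℝ, B y y ≤ B (exp (t • z) * y * exp (-(t • z))) (exp (t • z) * y * exp (-(t • z)))) :
    B y (z * y - y * z) = 0 := by
  have : CompleteSpace 𝔸 := FiniteDimensional.complete ℝ 𝔸
  let c : ℝ → 𝔸 := fun t => exp (t • z) * y * exp (-(t • z))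
  have hc0 : c 0 = y := by simp [c]
  have hc : HasDerivAt c (z * y - y * z) 0 := by
    have h1 : HasDerivAt (fun t : ℝ => exp (t • z)) z 0 := by
      have := hasDerivAt_exp_smul_const (𝕂 := ℝ) z (0 : ℝ)
      simpa using this
    have h2 : HasDerivAt (fun t : ℝ => exp (-(t • z))) (-z) 0 := by
      have := hasDerivAt_exp_smul_const (𝕂 := ℝ) (-z) (0 : ℝ)
      simpa using this
    have h3 := (h1.mul_const y).mul h2
    exact h3.congr_deriv (by simp [sub_eq_add_neg])
  have hline : HasDerivAt (fun s : ℝ => B (c 0 + s • (z * y - y * z)) (c 0 + s • (z * y - y * z)))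
      (2 * B y (z * y - y * z)) 0 := by
    rw [hc0]
    set w := z * y - y * z
    have h1 : (fun s : ℝ => B (y + s • w) (y + s • w)) = fun s =>
        B y y + s * (2 * B y w) + s ^ 2 * B w w := by
      funext s
      simp only [map_add, map_smul, LinearMap.add_apply, LinearMap.smul_apply, smul_eq_mul, hB w y]
      ring
    rw [h1]
    have h2 := ((hasDerivAt_id (0 : ℝ)).mul_const (2 * B y w)).const_add (B y y)
    have h3 := ((hasDerivAt_id (0 : ℝ)).pow 2).mul_const (B w w)
    refine (h2.add h3).congr_deriv ?_
    simp
  have hdiff : Differentiable ℝ fun x : 𝔸 => B x x := by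
    let L : 𝔸 →L[ℝ] 𝔸 →L[ℝ] ℝ := LinearMap.toContinuousLinearMap
      ((LinearMap.toContinuousLinearMap : (𝔸 →ₗ[ℝ] ℝ) ≃ₗ[ℝ] (𝔸 →L[ℝ] ℝ)).toLinearMap ∘ₗ B)
    have : ∀ x, B x x = L x x := fun x => rfl
    simp only [this]
    fun_prop
  have hD := hasDerivAt_comp_of_line (f := fun x : 𝔸 => B x x) (hdiff _) hline hc
  have hmin : IsLocalMin (fun t => B (c t) (c t)) 0 := Filter.Eventually.of_forall fun t => by
    change B (c 0) (c 0) ≤ _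
    rw [hc0]; exact h t
  have := hmin.hasDerivAt_eq_zero hD
  linarith

variable {n : ℕ}

/-- The real Frobenius inner product of matrices. -/
def frob (n : ℕ) : LinearMap.BilinForm ℝ (CMat n) :=
  LinearMap.mk₂ ℝ (fun X Y => (X.conjTranspose * Y).trace.re)
    (fun X X' Y => by simp [add_mul]) (fun c X Y => by simp)
    (fun X Y Y' => by simp [mul_add]) (fun c X Y => by simp)

theorem frob_apply (X Y : CMat n) : frob n X Y = (X.conjTranspose * Y).trace.re := rfl

theorem frob_comm (X Y : CMat n) : frob n X Y = frob n Y X := by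
  rw [frob_apply, frob_apply, ← Complex.conj_re, ← Complex.star_def, ← Matrix.trace_conjTranspose,
    Matrix.conjTranspose_mul, Matrix.conjTranspose_conjTranspose]

theorem frob_self (X : CMat n) : frob n X X = ∑ j, ∑ i, ‖X i j‖ ^ 2 := by
  rw [frob_apply, Matrix.trace, Complex.re_sum]
  refine Finset.sum_congr rfl fun j _ => ?_
  rw [Matrix.diag_apply, Matrix.mul_apply, Complex.re_sum]
  refine Finset.sum_congr rfl fun i _ => ?_
  rw [Matrix.conjTranspose_apply, Complex.star_def, Complex.conj_mul']
  exact_mod_cast Complex.ofReal_re _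

theorem norm_sq_le_frob (X : CMat n) (i j : Fin n) : ‖X i j‖ ^ 2 ≤ frob n X X := by
  rw [frob_self]
  refine le_trans ?_ (Finset.single_le_sum (f := fun j => ∑ i, ‖X i j‖ ^ 2)
    (fun j _ => Finset.sum_nonneg fun i _ => by positivity) (Finset.mem_univ j))
  exact Finset.single_le_sum (f := fun i => ‖X i j‖ ^ 2) (fun i _ => by positivity)
    (Finset.mem_univ i)

theorem frob_pos {X : CMat n} (h : X ≠ 0) : 0 < frob n X X := by
  by_contra hc
  refine h (Matrix.ext fun i j => ?_)
  have := norm_sq_le_frob X i j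
  have h1 : ‖X i j‖ ^ 2 = 0 := le_antisymm (by linarith) (by positivity)
  simpa using h1

theorem continuous_frob_lie (Z : CMat n) : Continuous fun X => frob n X ⁅Z, X⁆ := by
  simp only [frob_apply, Ring.lie_def]
  exact Complex.continuous_re.comp (Continuous.matrix_trace (continuous_id.matrix_conjTranspose.mul
    ((continuous_const.mul continuous_id).sub (continuous_id.mul continuous_const))))

theorem continuous_frob_self : Continuous fun X => frob n X X := by
  simp only [frob_apply]
  exact Complex.continuous_re.comp (Continuous.matrix_trace
    (continuous_id.matrix_conjTranspose.mul continuous_id))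

theorem isCompact_frob_le (c : ℝ) : IsCompact {X | frob n X X ≤ c} := by
  have h1 : IsCompact (Set.univ.pi fun _ : Fin n => Set.univ.pi fun _ : Fin n =>
      Metric.closedBall (0 : ℂ) (Real.sqrt c)) :=
    isCompact_univ_pi fun _ => isCompact_univ_pi fun _ => isCompact_closedBall _ _
  refine h1.of_isClosed_subset (isClosed_le continuous_frob_self continuous_const) ?_
  intro X hX
  have hX : frob n X X ≤ c := hX
  refine Set.mem_univ_pi.2 fun i => Set.mem_univ_pi.2 fun j => ?_
  rw [mem_closedBall_zero_iff]
  exact Real.le_sqrt_of_sq_le ((norm_sq_le_frob X i j).trans hX)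

open Matrix.Norms.Operator in
theorem frob_lie_eq_zero_of_forall_le {z y : CMat n}
    (h : ∀ t : ℝ, frob n y y ≤ frob n (Ad (expG (t • z)) y) (Ad (expG (t • z)) y)) :
    frob n y ⁅z, y⁆ = 0 :=
  apply_lie_eq_zero_of_forall_le (frob n) frob_comm h

end Frobenius

/-! ### Weight-two elements: open orbits and the moment map equation -/

section WeightTwo

open Topology

variable {n : ℕ} {GR : Subgroup (GL (Fin n) ℂ)} {𝔤R : LieSubalgebra ℝ (CMat n)}
variable {q : GL (Fin n) ℂ} {d : Fin n → ℤ}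

theorem wtProj_eq_self {A : Set ℤ} {X : CMat n} (hX : X ∈ wt q d A) : wtProj q d A X = X :=
  (sub_eq_zero.1 (eq_zero_of_mem_wt_of_disjoint ((wt q d A).sub_mem hX (wtProj_mem X))
    (sub_wtProj_mem X) disjoint_compl_right)).symm

theorem lie_mem_wt_add {i j : ℤ} {X Y : CMat n} (hX : X ∈ wt q d {i}) (hY : Y ∈ wt q d {j}) :
    ⁅X, Y⁆ ∈ wt q d {i + j} :=
  lie_mem_wt hX hY (by rintro a rfl b rfl; rfl)

theorem hd_mem_wt_zero : hd q d ∈ wt q d {0} := by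
  rw [mem_wt_singleton, lie_self, Int.cast_zero, zero_smul]

/-- The orbit of a weight-two element of an even triple is open in the weight-two space. -/
theorem eventually_mem_adjointOrbit (hGR : IsConnectedLieSubgroup GR 𝔤R.toSubmodule)
    (hS : TrNondeg 𝔤R.toSubmodule) (hh : hd q d ∈ 𝔤R)
    (heven : ∀ X ∈ 𝔤R, X ∈ wt q d {i | Even i}) {x f : CMat n} (hx : x ∈ 𝔤R)
    (t : IsSl2Triple (hd q d) x f) :
    ∀ᶠ y in 𝓝[{y | y ∈ 𝔤R ∧ y ∈ wt q d {2}}] x, ∃ g ∈ GR, y = Ad g x := by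
  have hx2 := mem_wt_two t
  have key := eventually_exists_Ad_expG_eq
    (p := 𝔤R.toSubmodule ⊓ (wt q d {0}).restrictScalars ℝ)
    (N := 𝔤R.toSubmodule ⊓ (wt q d {2}).restrictScalars ℝ) (x := x) ⟨hx, hx2⟩
    (fun Z hZ y hy => ⟨𝔤R.lie_mem hZ.1 hy.1, by simpa using lie_mem_wt_add hZ.2 hy.2⟩)
    (by
      rintro y ⟨hy, hy2⟩
      have hy2 : y ∈ wt q d {2} := hy2
      obtain ⟨Z, hZ, -, hZy⟩ := exists_lie_eq_of_even hS
        (fun X hX Y hY => 𝔤R.lie_mem hX hY) t hh hx heven hy (wt_mono (by simp) hy2)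
      refine ⟨wtProj q d {0} Z, ⟨wtProj_mem_of_lie_mem (fun X hX => 𝔤R.lie_mem hh hX) hZ,
        wtProj_mem Z⟩, ?_⟩
      rw [← lie_skew, lie_wtProj hx2, ← lie_skew, hZy, map_neg, neg_neg]
      have : {i : ℤ | i - 2 ∈ ({0} : Set ℤ)} = {2} := by
        ext i; simp [sub_eq_zero]
      rw [this, wtProj_eq_self hy2])
  filter_upwards [key] with y ⟨Z, hZ, hy⟩
  exact ⟨expG Z, hGR.expG_mem hZ.1, hy⟩

/-- A weight-two element at which the moment map takes the value `hd q d` belongs to a real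
`𝔰𝔩₂`-triple with neutral element `hd q d`. -/
theorem exists_isSl2Triple_of_frob (hS : TrNondeg 𝔤R.toSubmodule) (hh : hd q d ∈ 𝔤R)
    (h0 : hd q d ≠ 0) {x : CMat n} (hx : x ∈ 𝔤R) (hx2 : x ∈ wt q d {2})
    (hZ : ∀ Z ∈ 𝔤R, Z ∈ wt q d {0} → frob n x ⁅Z, x⁆ = trForm n (hd q d) Z) :
    ∃ f ∈ 𝔤R, IsSl2Triple (hd q d) x f := by
  have hlie : ∀ X ∈ 𝔤R.toSubmodule, ⁅hd q d, X⁆ ∈ 𝔤R.toSubmodule := fun X hX => 𝔤R.lie_mem hh hX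
  -- The candidate f is the weight -2 part of the trace-form dual of the functional ⟨x, ·⟩. No
  -- compatibility of the inner product with 𝔤_ℝ, such as a Cartan involution, is needed.
  obtain ⟨f₀, hf₀, hf₀x⟩ := hS.exists_represent_linear (frob n x)
  set f := wtProj q d {-2} f₀
  have hf : f ∈ 𝔤R := wtProj_mem_of_lie_mem hlie hf₀
  have hf2 : f ∈ wt q d {-2} := wtProj_mem f₀
  have hfx : ∀ Y ∈ 𝔤R, Y ∈ wt q d {2} → frob n x Y = trForm n f Y := by
    intro Y hY hY2
    have : {i : ℤ | -i ∈ ({-2} : Set ℤ)} = {2} := by ext i; simp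
    rw [hf₀x Y hY, trForm_apply, trForm_apply, trace_wtProj_mul, this, wtProj_eq_self hY2]
  have hxf : ⁅x, f⁆ ∈ wt q d {0} := by simpa using lie_mem_wt_add hx2 hf2
  have hD : ⁅x, f⁆ - hd q d ∈ wt q d {0} := (wt q d {0}).sub_mem hxf hd_mem_wt_zero
  -- By invariance tr([x, f]Z) = tr(f[Z, x]) up to real parts, so the moment equation says that this
  -- weight-zero element is orthogonal to the weight-zero part of 𝔤_ℝ.
  have hD0 : ⁅x, f⁆ - hd q d = 0 := by
    refine eq_zero_of_mem_wt_of_disjoint hD (hS.mem_wt (A := {0}) hlie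
      (𝔤R.sub_mem (𝔤R.lie_mem hx hf) hh) fun Z hZm hZ0 => ?_) ?_
    · have hZx : ⁅Z, x⁆ ∈ wt q d {2} := by simpa using lie_mem_wt_add hZ0 hx2
      rw [map_sub, LinearMap.sub_apply, ← hZ Z hZm hZ0, hfx _ (𝔤R.lie_mem hZm hx) hZx, trForm_lie,
        ← trForm_lie f, trForm_comm ⁅f, Z⁆, sub_self]
    · simp
  refine ⟨f, hf, h0, sub_eq_zero.1 hD0, ?_, ?_⟩
  · rw [mem_wt_singleton.1 hx2, ← Nat.cast_smul_eq_nsmul ℂ]; norm_num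
  · rw [mem_wt_singleton.1 hf2, ← Nat.cast_smul_eq_nsmul ℂ, ← neg_smul]; norm_num

end WeightTwo

/-! ### Finiteness of the real orbits -/

section FiniteOrbits

open Topology

variable {n : ℕ} {GR : Subgroup (GL (Fin n) ℂ)} {𝔤R : LieSubalgebra ℝ (CMat n)}
variable {q : GL (Fin n) ℂ} {d : Fin n → ℤ}

theorem Ad_expG_of_lie_eq_smul {z x : CMat n} {c : ℝ} (h : ⁅z, x⁆ = c • x) :
    Ad (expG z) x = Real.exp c • x := by
  have h1 : ∀ k : ℕ, ((LieAlgebra.ad ℝ (CMat n) z) ^ k) x = c ^ k • x := by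
    intro k
    induction k with
    | zero => simp
    | succ k ih =>
      rw [pow_succ', Module.End.mul_apply, ih, map_smul, LieAlgebra.ad_apply, h, smul_smul,
        pow_succ]
  have h2 := hasSum_Ad_expG z x
  simp only [h1, smul_smul] at h2
  have h3 := NormedSpace.exp_series_hasSum_exp' (𝕂 := ℝ) c
  rw [← Real.exp_eq_exp_ℝ] at h3
  exact h2.unique (h3.smul_const x)

theorem continuous_Ad (g : GL (Fin n) ℂ) : Continuous fun X => Ad g X := by
  simp only [Ad_apply]
  exact (continuous_const.mul continuous_id).mul continuous_const

theorem isClosed_wt_inf (A : Set ℤ) : IsClosed {X | X ∈ 𝔤R ∧ X ∈ wt q d A} :=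
  Submodule.closed_of_finiteDimensional (𝔤R.toSubmodule ⊓ (wt q d A).restrictScalars ℝ)

/-- The elements of the weight-two space at which the moment map takes the value `hd q d`. -/
def momentFiber (𝔤R : LieSubalgebra ℝ (CMat n)) (q : GL (Fin n) ℂ) (d : Fin n → ℤ) :
    Set (CMat n) :=
  {x | (x ∈ 𝔤R ∧ x ∈ wt q d {2}) ∧
    ∀ Z ∈ 𝔤R, Z ∈ wt q d {0} → frob n x ⁅Z, x⁆ = trForm n (hd q d) Z}

theorem lie_hd_of_mem_wt_two {x : CMat n} (hx : x ∈ wt q d {2}) : ⁅hd q d, x⁆ = (2 : ℝ) • x := by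
  rw [mem_wt_singleton.1 hx]
  ext i j; simp

/-- Testing the moment equation on Z = h gives 2⟨x, x⟩ = tr h², which bounds the fiber. -/
theorem isCompact_momentFiber (hh : hd q d ∈ 𝔤R) : IsCompact (momentFiber 𝔤R q d) := by
  refine (isCompact_frob_le (n := n) (trForm n (hd q d) (hd q d) / 2)).of_isClosed_subset ?_ ?_
  · have : momentFiber 𝔤R q d = {X | X ∈ 𝔤R ∧ X ∈ wt q d {2}} ∩
        ⋂ Z ∈ {Z | Z ∈ 𝔤R ∧ Z ∈ wt q d {0}},
          {x | frob n x ⁅Z, x⁆ = trForm n (hd q d) Z} := by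
      ext x
      simp [momentFiber]
    rw [this]
    exact (isClosed_wt_inf _).inter (isClosed_biInter fun Z _ =>
      isClosed_eq (continuous_frob_lie Z) continuous_const)
  · rintro x ⟨⟨-, hx2⟩, hx⟩
    have := hx _ hh hd_mem_wt_zero
    rw [lie_hd_of_mem_wt_two hx2, map_smul, smul_eq_mul] at this
    change frob n x x ≤ _
    linarith

/-- The orbit of a weight-two element of a real `𝔰𝔩₂`-triple accumulates at the fiber of the
moment map. -/
theorem exists_mem_momentFiber (hGR : IsConnectedLieSubgroup GR 𝔤R.toSubmodule)
    (hh : hd q d ∈ 𝔤R) {x f : CMat n} (hx : x ∈ 𝔤R) (t : IsSl2Triple (hd q d) x f) :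
    ∃ y ∈ momentFiber 𝔤R q d,
      y ∈ closure {z | (z ∈ 𝔤R ∧ z ∈ wt q d {2}) ∧ ∃ g ∈ GR, z = Ad g x} := by
  obtain ⟨M, hM⟩ : ∃ M : ℕ, ∀ j, |d j| ≤ M := by
    obtain ⟨M, hM0, hM⟩ := exists_abs_le d
    exact ⟨M.toNat, fun j => by rw [Int.toNat_of_nonneg hM0]; exact hM j⟩
  obtain ⟨J, hJ⟩ := t.exists_Ad_eq_neg
  set κ := trForm n (hd q d) (hd q d) with hκ
  have hκ0 : 0 < κ := trace_hd_sq_pos t.h_ne_zero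
  set V : Set (CMat n) := {X | X ∈ 𝔤R ∧ X ∈ wt q d {2}} with hV
  -- Weight-zero directions orthogonal to h: they preserve the semi-invariant, so the norm can be
  -- minimized on the orbit closure without the orbit collapsing to 0.
  let K : Set (CMat n) := {Z | (Z ∈ 𝔤R ∧ Z ∈ wt q d {0}) ∧ trForm n (hd q d) Z = 0}
  let A : Set (CMat n) := {z | ∃ g ∈ expClosure K, z = Ad g x}
  have hKGR : expClosure K ≤ GR := hGR.expClosure_le fun X hX => hX.1.1
  have hKsmul : ∀ Z ∈ K, ∀ c : ℝ, c • Z ∈ K := fun Z hZ c =>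
    ⟨⟨𝔤R.smul_mem c hZ.1.1, real_smul_mem_wt c hZ.1.2⟩, by rw [map_smul, hZ.2, smul_zero]⟩
  have hAdV : ∀ Z, Z ∈ 𝔤R → Z ∈ wt q d {0} → ∀ z ∈ V, Ad (expG Z) z ∈ V := fun Z hZ hZ0 z hz =>
    Ad_expG_mem (S := 𝔤R.toSubmodule ⊓ (wt q d {2}).restrictScalars ℝ)
      (fun y hy => ⟨𝔤R.lie_mem hZ hy.1, by simpa using lie_mem_wt_add hZ0 hy.2⟩) hz
  have hgrp : ∀ g ∈ expClosure K,
      (∀ z ∈ V, Ad g z ∈ V ∧ Ad g⁻¹ z ∈ V) ∧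
      ∀ z, semiInv q d J M (Ad g z) = semiInv q d J M z := by
    intro g hg
    induction hg using Subgroup.closure_induction with
    | mem g hg =>
      obtain ⟨Z, hZ, rfl⟩ := hg
      refine ⟨fun z hz => ⟨hAdV Z hZ.1.1 hZ.1.2 z hz, ?_⟩, fun z => ?_⟩
      · rw [expG_inv]
        exact hAdV _ (𝔤R.neg_mem hZ.1.1) ((wt q d _).neg_mem hZ.1.2) z hz
      · rw [semiInv_Ad_expG hJ hM hZ.1.2, hZ.2, Real.exp_zero, one_mul]
    | one => simp
    | mul a b _ _ ha hb =>
      refine ⟨fun z hz => ⟨?_, ?_⟩, fun z => ?_⟩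
      · rw [Ad_mul]; exact (ha.1 _ (hb.1 z hz).1).1
      · rw [mul_inv_rev, Ad_mul]; exact (hb.1 _ (ha.1 z hz).2).2
      · rw [Ad_mul, ha.2, hb.2]
    | inv a _ ha =>
      refine ⟨fun z hz => ⟨(ha.1 z hz).2, by rw [inv_inv]; exact (ha.1 z hz).1⟩, fun z => ?_⟩
      rw [← ha.2, Ad_Ad_inv]
  have hxV : x ∈ V := ⟨hx, mem_wt_two t⟩
  have hAV : A ⊆ V := by
    rintro _ ⟨g, hg, rfl⟩; exact ((hgrp g hg).1 x hxV).1
  have hxA : x ∈ A := ⟨1, one_mem _, by simp⟩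
  obtain ⟨y₀, ⟨hy₀A, hy₀x⟩, hy₀min⟩ := ((isCompact_frob_le (frob n x x)).inter_left
    (isClosed_closure (s := A))).exists_isMinOn ⟨x, subset_closure hxA, le_refl (frob n x x)⟩
    continuous_frob_self.continuousOn
  have hmin : ∀ y ∈ closure A, frob n y₀ y₀ ≤ frob n y y := by
    intro y hy
    by_cases hyx : frob n y y ≤ frob n x x
    · exact hy₀min ⟨hy, hyx⟩
    · exact le_trans hy₀x (not_le.1 hyx).le
  have hy₀V : y₀ ∈ V := closure_minimal hAV (isClosed_wt_inf _) hy₀A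
  have hy₀0 : y₀ ≠ 0 := by
    intro h0
    have h1 : closure A ⊆ {z | semiInv q d J M z = semiInv q d J M x} :=
      closure_minimal (by rintro _ ⟨g, hg, rfl⟩; exact (hgrp g hg).2 x)
        (isClosed_eq (continuous_semiInv J M) continuous_const)
    have h2 : semiInv q d J M y₀ = semiInv q d J M x := h1 hy₀A
    rw [h0, semiInv_zero J hM hJ t.h_ne_zero] at h2
    exact semiInv_ne_zero hJ M t h2.symm
  have hφ := frob_pos hy₀0
  have hcrit : ∀ Z ∈ K, frob n y₀ ⁅Z, y₀⁆ = 0 := fun Z hZ =>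
    frob_lie_eq_zero_of_forall_le fun c => hmin _ (by
      refine map_mem_closure (continuous_Ad _) hy₀A ?_
      rintro _ ⟨g, hg, rfl⟩
      exact ⟨expG (c • Z) * g, mul_mem (expG_mem_expClosure (hKsmul Z hZ c)) hg,
        (Ad_mul _ _ _).symm⟩)
  have hcrit' : ∀ Z ∈ 𝔤R, Z ∈ wt q d {0} →
      frob n y₀ ⁅Z, y₀⁆ = trForm n (hd q d) Z / κ * (2 * frob n y₀ y₀) := by
    intro Z hZ hZ0
    -- Z - c h lies in K, where the variation vanishes; the h-component contributes 2c⟨y₀, y₀⟩.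
    set c := trForm n (hd q d) Z / κ with hc
    have h1 := hcrit (Z - c • hd q d) ⟨⟨𝔤R.sub_mem hZ (𝔤R.smul_mem c hh),
      (wt q d _).sub_mem hZ0 (real_smul_mem_wt c hd_mem_wt_zero)⟩, by
        rw [map_sub, map_smul, smul_eq_mul, hc, ← hκ, div_mul_cancel₀ _ hκ0.ne', sub_self]⟩
    rw [sub_lie, smul_lie, lie_hd_of_mem_wt_two hy₀V.2, map_sub, map_smul, map_smul, smul_eq_mul,
      smul_eq_mul, sub_eq_zero] at h1
    exact h1
  -- Conjugation by exp(s h) scales y₀ by exp(2s) and its squared norm by exp(4s); s is chosen so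
  -- that the squared norm becomes κ/2, as the moment equation requires.
  set s := Real.log (κ / (2 * frob n y₀ y₀)) / 4 with hs
  have hAds : Ad (expG (s • hd q d)) y₀ = Real.exp (2 * s) • y₀ :=
    Ad_expG_of_lie_eq_smul (by
      rw [smul_lie, lie_hd_of_mem_wt_two hy₀V.2, smul_smul, mul_comm])
  have hexp : Real.exp (2 * s) * Real.exp (2 * s) = κ / (2 * frob n y₀ y₀) := by
    rw [← Real.exp_add, hs, show 2 * (Real.log (κ / (2 * frob n y₀ y₀)) / 4) +
      2 * (Real.log (κ / (2 * frob n y₀ y₀)) / 4) = Real.log (κ / (2 * frob n y₀ y₀)) by ring,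
      Real.exp_log (by positivity)]
  have hsR : s • hd q d ∈ 𝔤R := 𝔤R.smul_mem s hh
  have hs0 : s • hd q d ∈ wt q d {0} := real_smul_mem_wt s hd_mem_wt_zero
  refine ⟨Ad (expG (s • hd q d)) y₀, ⟨hAdV _ hsR hs0 _ hy₀V, fun Z hZ hZ0 => ?_⟩, ?_⟩
  · rw [hAds, lie_smul, map_smul, map_smul, LinearMap.smul_apply, smul_smul, hexp, smul_eq_mul,
      hcrit' Z hZ hZ0]
    field_simp
  · refine map_mem_closure (continuous_Ad _) hy₀A ?_
    rintro _ ⟨g, hg, rfl⟩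
    exact ⟨hAdV _ hsR hs0 _ (hAV ⟨g, hg, rfl⟩), expG (s • hd q d) * g,
      mul_mem (hGR.expG_mem hsR) (hKGR hg), (Ad_mul _ _ _).symm⟩

/-- There are finitely many real orbits of nilpotent elements belonging to real `𝔰𝔩₂`-triples with
a given even neutral element. -/
theorem exists_finite_orbit_representatives (hGR : IsConnectedLieSubgroup GR 𝔤R.toSubmodule)
    (hS : TrNondeg 𝔤R.toSubmodule) (hh : hd q d ∈ 𝔤R) (h0 : hd q d ≠ 0)
    (heven : ∀ X ∈ 𝔤R, X ∈ wt q d {i | Even i}) :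
    ∃ F : Set (CMat n), F.Finite ∧ ∀ x ∈ 𝔤R, ∀ f, IsSl2Triple (hd q d) x f →
      ∃ y ∈ F, ∃ g ∈ GR, x = Ad g y := by
  have hopen : ∀ y ∈ momentFiber 𝔤R q d,
      ∀ᶠ z in 𝓝[{y | y ∈ 𝔤R ∧ y ∈ wt q d {2}}] y, ∃ g ∈ GR, z = Ad g y := by
    rintro y ⟨⟨hy, hy2⟩, hyZ⟩
    obtain ⟨f, -, t⟩ := exists_isSl2Triple_of_frob hS hh h0 hy hy2 hyZ
    exact eventually_mem_adjointOrbit hGR hS hh heven hy t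
  obtain ⟨F, hF, hFy⟩ : ∃ F : Set (CMat n), F.Finite ∧ ∀ x ∈ momentFiber 𝔤R q d,
      ∃ y ∈ F, ∃ g ∈ GR, x = Ad g y := by
    refine (isCompact_momentFiber hh).induction_on
      (p := fun s => ∃ F : Set (CMat n), F.Finite ∧ ∀ x ∈ s, ∃ y ∈ F, ∃ g ∈ GR, x = Ad g y)
      ⟨∅, Set.finite_empty, by simp⟩ ?_ ?_ ?_
    · rintro s s' hss' ⟨F, hF, h⟩
      exact ⟨F, hF, fun x hx => h x (hss' hx)⟩
    · rintro s s' ⟨F, hF, h⟩ ⟨F', hF', h'⟩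
      refine ⟨F ∪ F', hF.union hF', ?_⟩
      rintro x (hx | hx)
      · obtain ⟨y, hy, hxy⟩ := h x hx; exact ⟨y, Or.inl hy, hxy⟩
      · obtain ⟨y, hy, hxy⟩ := h' x hx; exact ⟨y, Or.inr hy, hxy⟩
    · intro y hy
      refine ⟨_, nhdsWithin_mono y (fun z hz => hz.1) (hopen y hy), {y}, Set.finite_singleton y, ?_⟩
      rintro z ⟨g, hg, hz⟩
      exact ⟨y, rfl, g, hg, hz⟩
  refine ⟨F, hF, fun x hx f t => ?_⟩
  obtain ⟨y, hy, hyx⟩ := exists_mem_momentFiber hGR hh hx t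
  obtain ⟨w, hw, k, hk, rfl⟩ := hFy y hy
  -- The orbit of x accumulates at a point of the fiber whose own orbit is open in the weight-two
  -- space, so the two orbits meet and coincide.
  have h1 := mem_closure_iff_nhdsWithin_neBot.1 hyx
  have h2 : ∀ᶠ z in 𝓝[{z | (z ∈ 𝔤R ∧ z ∈ wt q d {2}) ∧ ∃ g ∈ GR, z = Ad g x}] (Ad k w),
      ∃ g ∈ GR, z = Ad g (Ad k w) :=
    nhdsWithin_mono (Ad k w) (fun z hz => hz.1) (hopen _ hy)
  obtain ⟨z, ⟨g, hg, hz⟩, -, g', hg', hz'⟩ := (Filter.Eventually.and h2 self_mem_nhdsWithin).exists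
  refine ⟨w, hw, g'⁻¹ * (g * k), mul_mem (inv_mem hg') (mul_mem hg hk), ?_⟩
  rw [Ad_mul, Ad_mul, ← hz, hz', Ad_inv_Ad]

end FiniteOrbits

/-! ### Limits of hyperbolic orbits and real forms -/

section Limits

open Topology

variable {n : ℕ} {GR G : Subgroup (GL (Fin n) ℂ)} {𝔤R : LieSubalgebra ℝ (CMat n)}
variable {q : GL (Fin n) ℂ} {d : Fin n → ℤ}

theorem IsSl2Triple.coe {h e f : 𝔤R} (t : IsSl2Triple h e f) :
    IsSl2Triple (h : CMat n) (e : CMat n) (f : CMat n) where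
  h_ne_zero h0 := t.h_ne_zero (Subtype.ext h0)
  lie_e_f := congrArg Subtype.val t.lie_e_f
  lie_h_e_nsmul := congrArg Subtype.val t.lie_h_e_nsmul
  lie_h_f_nsmul := congrArg Subtype.val t.lie_h_f_nsmul

theorem le_of_isComplexification (hGR : IsConnectedLieSubgroup GR 𝔤R.toSubmodule)
    (hG : IsComplexification 𝔤R G) : GR ≤ G := by
  intro g hg
  obtain ⟨l, hl, rfl⟩ := hGR.eq_prod_expG hg
  refine Subgroup.list_prod_mem _ fun k hk => ?_
  obtain ⟨X, hX, rfl⟩ := List.mem_map.1 hk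
  exact hG.connected.expG_mem (mem_complexSpan_of_mem (hl X hX))

theorem Ad_mem_orbit_inter (hGR : IsConnectedLieSubgroup GR 𝔤R.toSubmodule)
    (hG : IsComplexification 𝔤R G) {g : GL (Fin n) ℂ} (hg : g ∈ GR) {e x : CMat n}
    (hx : x ∈ adjointOrbit G e ∩ (𝔤R : Set (CMat n))) :
    Ad g x ∈ adjointOrbit G e ∩ (𝔤R : Set (CMat n)) := by
  obtain ⟨⟨k, hk, rfl⟩, hx⟩ := hx
  exact ⟨⟨g * k, mul_mem (le_of_isComplexification hGR hG hg) hk, (Ad_mul _ _ _).symm⟩,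
    hGR.Ad_mem (fun X hX Y hY => 𝔤R.lie_mem hX hY) hg hx⟩

/-- A real nilpotent element lies in the limit of the orbits of the neutral element. -/
theorem mem_orbitLimit_of_lie_eq (hGR : IsConnectedLieSubgroup GR 𝔤R.toSubmodule) {h x : CMat n}
    (hx : x ∈ 𝔤R) (hhx : ⁅h, x⁆ = 2 • x) : x ∈ orbitLimit GR h := by
  refine Set.mem_iInter₂.2 fun ε hε => ?_
  refine mem_closure_of_tendsto (f := fun ν : ℝ => ν • h + x) (b := 𝓝[>] 0) ?_ ?_
  · have hc : Continuous fun ν : ℝ => ν • h + x := by fun_prop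
    exact (hc.tendsto' 0 x (by simp)).mono_left nhdsWithin_le_nhds
  · filter_upwards [Ioo_mem_nhdsGT (Set.mem_Ioi.1 hε)] with ν hν
    -- For z = -(2ν)⁻¹ x one has [z, νh] = x and [z, x] = 0, so exp z takes νh to νh + x exactly.
    refine Set.mem_iUnion₂.2 ⟨ν, hν, expG ((-(2 * ν)⁻¹) • x), hGR.expG_mem (𝔤R.smul_mem _ hx), ?_⟩
    have h1 : ⁅(-(2 * ν)⁻¹) • x, ν • h⁆ = x := by
      rw [smul_lie, lie_smul, ← lie_skew, hhx, smul_smul, ← Nat.cast_smul_eq_nsmul ℝ, ← neg_smul,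
        smul_smul]
      have := hν.1.ne'
      convert one_smul ℝ x using 2
      push_cast
      field_simp
    change ν • h + x = Ad (expG ((-(2 * ν)⁻¹) • x)) (ν • h)
    rw [Ad_expG_of_lie_lie_eq_zero (by rw [h1, smul_lie, lie_self, smul_zero]), h1]

/-- Every real point of the orbit of `e` belongs to a real triple with neutral element conjugate
to `hd q d` under the real group. -/
theorem exists_real_isSl2Triple (hGR : IsConnectedLieSubgroup GR 𝔤R.toSubmodule)
    (hG : IsComplexification 𝔤R G) (hS : TrNondeg 𝔤R.toSubmodule) {e f : CMat n}
    (t : IsSl2Triple (hd q d) e f) (hh : hd q d ∈ 𝔤R) (hf : f ∈ 𝔤R) {x : CMat n}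
    (hx : x ∈ adjointOrbit G e ∩ (𝔤R : Set (CMat n))) :
    ∃ r ∈ GR, ∃ f', IsSl2Triple (Ad r (hd q d)) x f' := by
  obtain ⟨⟨g, hg, rfl⟩, hx⟩ := hx
  obtain ⟨k, hk, f', -, hk', t'⟩ := exists_isSl2Triple_of_Ad_mem hG t hh hf hg hx
  obtain ⟨r, hr, hrk⟩ := exists_real_conj hGR hG hS hh hk hk'
  exact ⟨r, hr, f', by rw [hrk]; exact t'⟩

open Matrix.Norms.Operator in
theorem orbitLimit_eq_closure (hGR : IsConnectedLieSubgroup GR 𝔤R.toSubmodule)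
    (hG : IsComplexification 𝔤R G) (hS : TrNondeg 𝔤R.toSubmodule) {e f : CMat n}
    (t : IsSl2Triple (hd q d) e f) (hh : hd q d ∈ 𝔤R) (he : e ∈ 𝔤R) (hf : f ∈ 𝔤R)
    (heven : ∀ X ∈ 𝔤R, X ∈ wt q d {i | Even i}) :
    orbitLimit GR (hd q d) = closure (adjointOrbit G e ∩ (𝔤R : Set (CMat n))) := by
  have hlie : ∀ X ∈ 𝔤R.toSubmodule, ∀ Y ∈ 𝔤R.toSubmodule, ⁅X, Y⁆ ∈ 𝔤R.toSubmodule :=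
    fun X hX Y hY => 𝔤R.lie_mem hX hY
  refine Set.Subset.antisymm (fun y hy => ?_) (closure_minimal (fun x hx => ?_)
    (isClosed_biInter fun _ _ => isClosed_closure))
  · obtain ⟨C, hC0, hC⟩ := exists_dist_nilradical_le (q := q) (d := d) hS hlie
    rw [← closure_closure]
    refine Metric.mem_closure_iff.2 fun ε hε => ?_
    -- This bound on ν makes νC at most ε/2; adding 1 covers the case C = 0.
    have hδ : 0 < ε / (2 * (C + 1)) := by positivity
    obtain ⟨w, hw, hyw⟩ := Metric.mem_closure_iff.1 (Set.mem_iInter₂.1 hy _ (Set.mem_Ioi.2 hδ))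
      (ε / 2) (by positivity)
    obtain ⟨ν, hν, g, hg, rfl⟩ := Set.mem_iUnion₂.1 hw
    change dist y (Ad g (ν • hd q d)) < ε / 2 at hyw
    have hgm : hd (g * q) d ∈ 𝔤R := by
      rw [← Ad_hd]; exact hGR.Ad_mem hlie hg hh
    obtain ⟨N, hN, hNw, hNC⟩ := hC g hgm
    refine ⟨ν • N, ?_, ?_⟩
    -- The nilradical of Ad(g) h is carried back by g to that of h; the real points of the complex
    -- orbit are stable under GR.
    · have h1 := nilradical_subset_closure hG hS t hh he heven (x := ν • Ad g⁻¹ N)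
        (𝔤R.smul_mem ν (hGR.Ad_mem hlie (inv_mem hg) hN)) (real_smul_mem_wt ν (mem_wt_mul.1 hNw))
      have h2 := map_mem_closure (continuous_Ad g) h1 fun z hz => Ad_mem_orbit_inter hGR hG hg hz
      rwa [Ad_real_smul, Ad_Ad_inv] at h2
    · have h1 : dist (Ad g (ν • hd q d)) (ν • N) ≤ ν * C := by
        rw [Ad_real_smul, Ad_hd, dist_eq_norm, ← smul_sub, norm_smul, Real.norm_of_nonneg hν.1.le]
        exact mul_le_mul_of_nonneg_left hNC hν.1.le
      have h2 : ν * C ≤ ε / 2 := by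
        have h3 := (lt_div_iff₀ (by positivity)).1 hν.2
        nlinarith [hν.1]
      linarith [dist_triangle y (Ad g (ν • hd q d)) (ν • N)]
  · obtain ⟨r, hr, f', t'⟩ := exists_real_isSl2Triple hGR hG hS t hh hf hx
    rw [← orbitLimit_Ad hr]
    exact mem_orbitLimit_of_lie_eq hGR hx.2 t'.lie_h_e_nsmul

theorem realForms_finite {e f : 𝔤R} (hGR : IsConnectedLieSubgroup GR 𝔤R.toSubmodule)
    (hG : IsComplexification 𝔤R G) (hS : TrNondeg 𝔤R.toSubmodule)
    (t : IsSl2Triple (hd q d) (e : CMat n) f) (hh : hd q d ∈ 𝔤R)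
    (heven : ∀ X ∈ 𝔤R, X ∈ wt q d {i | Even i}) : (realForms GR G 𝔤R e).Finite := by
  obtain ⟨F, hF, hFx⟩ := exists_finite_orbit_representatives hGR hS hh t.h_ne_zero heven
  refine (hF.image (adjointOrbit GR)).subset ?_
  rintro _ ⟨x, hx, rfl⟩
  obtain ⟨r, hr, f', t'⟩ := exists_real_isSl2Triple hGR hG hS t hh f.2 hx
  have t'' := t'.conj r⁻¹
  rw [Ad_inv_Ad] at t''
  obtain ⟨y, hy, g, hg, hxy⟩ := hFx _ (hGR.Ad_mem (fun X hX Y hY => 𝔤R.lie_mem hX hY)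
    (inv_mem hr) hx.2) _ t''
  refine ⟨y, hy, ?_⟩
  rw [← adjointOrbit_Ad (inv_mem hr) x, hxy, adjointOrbit_Ad hg]

theorem biUnion_realForms (hGR : IsConnectedLieSubgroup GR 𝔤R.toSubmodule)
    (hG : IsComplexification 𝔤R G) (e : 𝔤R) :
    ⋃ O ∈ realForms GR G 𝔤R e, O = adjointOrbit G (e : CMat n) ∩ (𝔤R : Set (CMat n)) := by
  refine Set.Subset.antisymm (Set.iUnion₂_subset ?_) fun x hx => ?_
  · rintro _ ⟨x, hx, rfl⟩ _ ⟨g, hg, rfl⟩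
    exact Ad_mem_orbit_inter hGR hG hg hx
  · exact Set.mem_iUnion₂.2 ⟨_, ⟨x, hx, rfl⟩, 1, one_mem _, by simp⟩

theorem adjointOrbit_zero (H : Subgroup (GL (Fin n) ℂ)) :
    adjointOrbit H (0 : CMat n) = {0} := by
  ext Y
  refine ⟨?_, ?_⟩
  · rintro ⟨g, -, rfl⟩; simp
  · rintro rfl; exact ⟨1, one_mem _, by simp⟩

theorem not_isSl2Triple_zero (h f : 𝔤R) : ¬ IsSl2Triple h 0 f := fun t =>
  t.h_ne_zero (by rw [← t.lie_e_f, zero_lie])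

/-- A nonzero weight component of a real element is again real, so it is an eigenvector of ad h on
𝔤. -/
theorem mem_wt_even_of_hasEigenvalue {h : 𝔤R} (hq : (h : CMat n) = hd q d)
    (hev : ∀ μ : ℂ, (LieAlgebra.ad ℂ (complexSpan 𝔤R) (toComplexSpan h)).HasEigenvalue μ →
      ∃ k : ℤ, μ = 2 * (k : ℂ)) : ∀ X ∈ 𝔤R, X ∈ wt q d {i | Even i} := by
  intro X hX
  refine mem_wt_of_forall_wtProj_eq_zero fun k hk => ?_
  by_contra hne
  refine hk ?_
  have hY : wtProj q d {k} X ∈ 𝔤R := wtProj_mem_of_lie_mem (S := 𝔤R.toSubmodule)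
    (fun Y hY => by rw [← hq]; exact 𝔤R.lie_mem h.2 hY) hX
  have hvec : (LieAlgebra.ad ℂ (complexSpan 𝔤R) (toComplexSpan h)).HasEigenvector k
      (toComplexSpan ⟨_, hY⟩) := by
    refine ⟨Module.End.mem_eigenspace_iff.2 (Subtype.ext ?_),
      fun h0 => hne (congrArg Subtype.val h0)⟩
    change ⁅(h : CMat n), wtProj q d {k} X⁆ = (k : ℂ) • wtProj q d {k} X
    rw [hq]; exact mem_wt_singleton.1 (wtProj_mem X)
  obtain ⟨m, hm⟩ := hev k (Module.End.hasEigenvalue_of_hasEigenvector hvec)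
  have hkm : k = 2 * m := by exact_mod_cast hm
  exact ⟨m, by omega⟩

end Limits

end

/-! ### Proof of the theorem -/

theorem theorem7p2 {n : ℕ} (GR G : Subgroup (GL (Fin n) ℂ)) (𝔤R : LieSubalgebra ℝ (CMat n))
    (hGR : IsConnectedLieSubgroup GR 𝔤R.toSubmodule)
    (hsimple : LieAlgebra.IsSimple ℝ 𝔤R)
    (hG : IsComplexification 𝔤R G)
    (e : 𝔤R) (he : IsEvenNilpotent e) :
    (∀ h f : 𝔤R, IsSl2Triple h e f → limitMap GR e = orbitLimit GR (h : CMat n)) ∧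
    limitMap GR e = closure (adjointOrbit G (e : CMat n) ∩ (𝔤R : Set (CMat n))) ∧
    (realForms GR G 𝔤R e).Finite ∧
    limitMap GR e = ⋃ O ∈ realForms GR G 𝔤R e, closure O := by
  suffices H : (∀ h f : 𝔤R, IsSl2Triple h e f → limitMap GR e = orbitLimit GR (h : CMat n)) ∧
      limitMap GR e = closure (adjointOrbit G (e : CMat n) ∩ (𝔤R : Set (CMat n))) ∧
      (realForms GR G 𝔤R e).Finite by
    refine ⟨H.1, H.2.1, H.2.2, ?_⟩
    -- Closure commutes with the union because there are finitely many real forms.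
    rw [H.2.1, ← biUnion_realForms hGR hG, H.2.2.closure_biUnion]
  rcases he.2 with rfl | ⟨h, f, t, hev⟩
  · have h0 : adjointOrbit G ((0 : 𝔤R) : CMat n) ∩ (𝔤R : Set (CMat n)) = {0} := by
      rw [ZeroMemClass.coe_zero, adjointOrbit_zero]
      exact Set.inter_eq_left.2 (Set.singleton_subset_iff.2 𝔤R.zero_mem)
    refine ⟨fun h f t => absurd t (not_isSl2Triple_zero h f), ?_, ?_⟩
    · rw [limitMap, dif_neg (by rintro ⟨h, f, t⟩; exact not_isSl2Triple_zero h f t), h0,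
        closure_singleton]
    · refine (Set.finite_singleton (adjointOrbit GR 0)).subset ?_
      rintro _ ⟨x, hx, rfl⟩
      rw [h0] at hx
      rw [Set.mem_singleton_iff.1 hx]; rfl
  · obtain ⟨q, d, hq⟩ := t.coe.exists_eq_hd
    have t' := t.coe
    have hh := h.2
    rw [hq] at t' hh
    have hS := trNondeg_of_isSimple hsimple hh (trace_hd_sq_pos t'.h_ne_zero).ne'
    have heven := mem_wt_even_of_hasEigenvalue hq hev
    -- Independence of the triple, which also covers the triple selected by choice in `limitMap`.
    have hlim : ∀ h₁ f₁ : 𝔤R, IsSl2Triple h₁ e f₁ →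
        orbitLimit GR (h₁ : CMat n) = orbitLimit GR (hd q d) := by
      intro h₁ f₁ t₁
      obtain ⟨r, hr, hr'⟩ := exists_Ad_eq_of_isSl2Triple hGR t' t₁.coe hh h₁.2
      rw [← hr', orbitLimit_Ad hr]
    have hmap : limitMap GR e = orbitLimit GR (hd q d) := by
      have H : ∃ h f : 𝔤R, IsSl2Triple h e f := ⟨h, f, t⟩
      rw [limitMap, dif_pos H]
      obtain ⟨f₁, t₁⟩ := H.choose_spec
      exact hlim _ f₁ t₁
    refine ⟨fun h₁ f₁ t₁ => hmap.trans (hlim h₁ f₁ t₁).symm, ?_, ?_⟩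
    · rw [hmap]; exact orbitLimit_eq_closure hGR hG hS t' hh e.2 f.2 heven
    · exact realForms_finite hGR hG hS t' hh heven
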